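/- Let $d\ge 2$ and let $f_0$ be a monic centered polynomial of degree $d$ over $\mathbb C$, $f_0(z)\neq z^d$, that is postcritically finite (its postcritical set, i.e. the closure of $\{f_0^n(c): f_0'(c)=0,\ n\ge 1\}$, is finite), hyperbolic (the orbit of each critical point converges to $\infty$ or to an attracting cycle) and primitive (distinct bounded Fatou components, i.e. bounded components of the complement of the Julia set, have disjoint closures). Let $G(z)=\lim_{n\to\infty} d^{-n}\log^+|f_0^n(z)|$ be the Green function, and let $\phi$ be the Böttcher map of $f_0$, i.e. the conformal bijection from the basin of infinity onto $\{|w|>1\}$ with $\phi(z)/z\to1$ as $z\to\infty$ and $\phi\circ f_0=\phi^d$. The external ray of angle $t\in\mathbb R/\mathbb Z$ is $\{\phi^{-1}(re^{2\pi i t}): 1<r<\infty\}$; it lands at $z_0$ if $\phi^{-1}(re^{2\pi it})\to z_0$ as $r\downarrow 1$. A finite set $Z\subset\mathbb C$ is called *$f_0$-admissible* if $f_0(Z)\subset Z$, every periodic point in $Z$ is repelling, and at least two external rays land at each $z\in Z$. Let $\Gamma_0^Z$ be the union of $Z$, of all the external rays landing at points of $Z$, and of the equipotential $\{G=1\}$,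 and let $\Gamma_n^Z=f_0^{-n}(\Gamma_0^Z)$ for $n\ge 1$. A *($Z$-)puzzle piece of depth $n$* is a bounded connected component of $\mathbb C\setminus\Gamma_n^Z$. Let $Z$ be an $f_0$-admissible set such that for each critical point $c\in\mathbb C$ of $f_0$ one has $\bigcap_{n\ge 0}Y_n(c)=\overline{U(c)}$, where $Y_n(c)$ is the puzzle piece of depth $n$ containing $c$ and $U(c)$ is the Fatou component containing $c$. Then $$\sup\{\operatorname{diam}(Y): Y \text{ is a puzzle piece of depth } n,\ \overline{Y}\cap Z\neq\emptyset\}\to 0\quad\text{as } n\to\infty.$$ -/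

import Mathlib

open Set Filter Topology Polynomial

namespace PolyDyn

/-- The self-map of `ℂ` given by the polynomial `f`. -/
noncomputable def toMap (f : ℂ[X]) : ℂ → ℂ := fun z => f.eval z

/-- Monic centered polynomials of degree `d`:
`z ^ d + a_{d-2} z ^ (d-2) + ⋯ + a_0`. Only used for `d ≥ 2`. -/
def IsMonicCentered (d : ℕ) (f : ℂ[X]) : Prop :=
  f.Monic ∧ f.natDegree = d ∧ f.coeff (d - 1) = 0

/-- The attracting basin of infinity. -/
def basin (f : ℂ[X]) : Set ℂ :=
  {z | Tendsto (fun n : ℕ => (toMap f)^[n] z) atTop (Bornology.cobounded ℂ)}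

/-- The filled Julia set, the complement of the basin of infinity. -/
def filledJulia (f : ℂ[X]) : Set ℂ := (basin f)ᶜ

/-- The Julia set, the boundary of the filled Julia set. -/
def julia (f : ℂ[X]) : Set ℂ := frontier (filledJulia f)

/-- The finite critical points. -/
def critSet (f : ℂ[X]) : Set ℂ := {c | f.derivative.eval c = 0}

/-- The postcritical set: the closure of the union of the forward orbits of
the critical values. -/
def postcrit (f : ℂ[X]) : Set ℂ :=
  closure {w | ∃ c ∈ critSet f, ∃ n : ℕ, 1 ≤ n ∧ w = (toMap f)^[n] c}

/-- `f` is postcritically finite. -/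
def IsPostcriticallyFinite (f : ℂ[X]) : Prop := (postcrit f).Finite

/-- The multiplier of a periodic point `z`: the derivative at `z` of the first
return map. Only used at periodic points. -/
noncomputable def multiplier (f : ℂ[X]) (z : ℂ) : ℂ :=
  deriv ((toMap f)^[Function.minimalPeriod (toMap f) z]) z

/-- `z` is an attracting periodic point. -/
def IsAttractingPeriodic (f : ℂ[X]) (z : ℂ) : Prop :=
  z ∈ Function.periodicPts (toMap f) ∧ ‖multiplier f z‖ < 1

/-- `z` is a repelling periodic point. -/
def IsRepellingPeriodic (f : ℂ[X]) (z : ℂ) : Prop :=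
  z ∈ Function.periodicPts (toMap f) ∧ 1 < ‖multiplier f z‖

/-- `f` is hyperbolic: the orbit of each critical point converges to infinity or
to an attracting periodic orbit. -/
def IsHyperbolic (f : ℂ[X]) : Prop :=
  ∀ c ∈ critSet f, c ∈ basin f ∨
    ∃ p, IsAttractingPeriodic f p ∧
      Tendsto (fun n : ℕ => (toMap f)^[n * Function.minimalPeriod (toMap f) p] c) atTop (𝓝 p)

/-- The Fatou component containing `z` (for `z` outside the Julia set). -/
def fatouComponentAt (f : ℂ[X]) (z : ℂ) : Set ℂ := connectedComponentIn (julia f)ᶜ z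

/-- `U` is a Fatou component, i.e. a component of the complement of the Julia set. -/
def IsFatouComponent (f : ℂ[X]) (U : Set ℂ) : Prop :=
  ∃ z ∈ (julia f)ᶜ, U = fatouComponentAt f z

/-- `f` is primitive: distinct bounded Fatou components have disjoint closures. -/
def IsPrimitive (f : ℂ[X]) : Prop :=
  ∀ U V : Set ℂ, IsFatouComponent f U → IsFatouComponent f V →
    Bornology.IsBounded U → Bornology.IsBounded V → U ≠ V →
      Disjoint (closure U) (closure V)

/-- The Green function `G_f(z) = lim d⁻ⁿ log⁺ |fⁿ(z)|`. -/
noncomputable def green (f : ℂ[X]) (z : ℂ) : ℝ :=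
  limUnder atTop
    (fun n : ℕ => Real.posLog ‖(toMap f)^[n] z‖ / (f.natDegree : ℝ) ^ n)

/-- `φ` is a Böttcher map of `f`: a conformal bijection from the basin of infinity onto
the exterior of the closed unit disk, with `φ(z)/z → 1` at infinity and conjugating `f` to
`w ↦ w ^ deg f`. For monic `f` with connected filled Julia set, exactly one such `φ` exists
on the basin; its values elsewhere are irrelevant. -/
structure IsBottcherMap (f : ℂ[X]) (φ : ℂ → ℂ) : Prop where
  differentiableOn : DifferentiableOn ℂ φ (basin f)
  bijOn : BijOn φ (basin f) {w | 1 < ‖w‖}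
  tendsto_div : Tendsto (fun z => φ z / z) (Bornology.cobounded ℂ) (𝓝 1)
  conj : ∀ z ∈ basin f, φ (toMap f z) = φ z ^ f.natDegree

/-- The external ray of angle `t ∈ ℝ/ℤ`: the set of `φ⁻¹(r e^{2πit})`, `1 < r < ∞`. -/
def externalRay (f : ℂ[X]) (t : UnitAddCircle) : Set ℂ :=
  {z | ∃ φ : ℂ → ℂ, IsBottcherMap f φ ∧ z ∈ basin f ∧
    ∃ r : ℝ, 1 < r ∧ φ z = (r : ℂ) * (AddCircle.toCircle t : ℂ)}

/-- The external ray of angle `t` lands at `z₀`: `φ⁻¹(r e^{2πit}) → z₀` as `r ↓ 1`. -/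
def RayLandsAt (f : ℂ[X]) (t : UnitAddCircle) (z₀ : ℂ) : Prop :=
  ∃ φ : ℂ → ℂ, IsBottcherMap f φ ∧
    Tendsto
      (fun r : ℝ => Function.invFunOn φ (basin f) ((r : ℂ) * (AddCircle.toCircle t : ℂ)))
      (𝓝[>] 1) (𝓝 z₀)

/-- `Z` is an `f`-admissible set. -/
structure IsAdmissible (f : ℂ[X]) (Z : Set ℂ) : Prop where
  finite : Z.Finite
  mapsTo : MapsTo (toMap f) Z Z
  repelling : ∀ z ∈ Z, z ∈ Function.periodicPts (toMap f) → IsRepellingPeriodic f z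
  two_rays : ∀ z ∈ Z, ∃ s t : UnitAddCircle, s ≠ t ∧ RayLandsAt f s z ∧ RayLandsAt f t z

/-- The puzzle graph of depth `0`: the external rays landing on `Z`, the set `Z` and the
equipotential `{G_f = 1}`. -/
def puzzleGraphZero (f : ℂ[X]) (Z : Set ℂ) : Set ℂ :=
  {w | ∃ z ∈ Z, ∃ t : UnitAddCircle, RayLandsAt f t z ∧ w ∈ externalRay f t} ∪ Z ∪
    {w | green f w = 1}

/-- The puzzle graph of depth `n`, the preimage under `fⁿ` of the one of depth `0`. -/
def puzzleGraph (f : ℂ[X]) (Z : Set ℂ) (n : ℕ) : Set ℂ :=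
  (toMap f)^[n] ⁻¹' puzzleGraphZero f Z

/-- `Y` is a `Z`-puzzle piece of depth `n`: a bounded component of the complement of the
puzzle graph of depth `n`. -/
def IsPuzzlePiece (f : ℂ[X]) (Z : Set ℂ) (n : ℕ) (Y : Set ℂ) : Prop :=
  (∃ z ∈ (puzzleGraph f Z n)ᶜ, Y = connectedComponentIn (puzzleGraph f Z n)ᶜ z) ∧
    Bornology.IsBounded Y

/-- For each critical point `c`, the puzzle pieces `Y n` of depth `n` containing `c` (there is
at most one for each `n`) exist and satisfy `⋂ n, Y n = closure U`, where `U` is the Fatou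
component containing `c`. -/
def CriticalPiecesShrink (f : ℂ[X]) (Z : Set ℂ) : Prop :=
  ∀ c ∈ critSet f, ∃ Y : ℕ → Set ℂ,
    (∀ n, IsPuzzlePiece f Z n (Y n) ∧ c ∈ Y n) ∧
      ⋂ n, Y n = closure (fatouComponentAt f c)

end PolyDyn

/-! Write `f` for the polynomial and `d` for its degree. The rays landing on preimages of `Z` cut
the part of a puzzle piece in the basin of infinity into sectors. For deep pieces touching `Z`, the
sectors are thin and their number is bounded independently of the depth.

Bounded number. For `N` large, no piece of depth at least `N` touching `Z` contains a critical point
(`exists_depth_critical_free`). Otherwise the closures of all pieces around some critical point `c`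
would contain a point `z` of `Z`. The intersection of these closures exceeds the closed set `L = ⋂
n, Y n` by at most the countable set of iterated preimages of `Z`. But a decreasing sequence of
continua through `c` and `z` contains in its intersection a point at every distance from `L` between
`0` and that of `z`, which is uncountably many points.

Hence, if `Y` has depth `N + k` and touches `Z`, the map `f^k` has no critical point on `Y`. It maps
`Y` properly onto a piece of depth `N`. The complement of that piece is connected, so there is no
monodromy and `f^k` is injective on `Y` (`ProperMap.injOn`, proved by labelling fibres over a fine
triangular lattice). Therefore distinct sectors of `Y` have distinct bounding angles after
multiplication by `d^k`, and their number is at most the number `M` of angles of the graph of depth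
`N` (`ncard_sectorAngles_le`). That `M` is finite comes from the injectivity of `f` near the points
of `Z` and a pigeonhole argument (`finite_angles_at`).

Thin sectors. A sector of `Y` has angular width at most `d^(-k)` and potentials below `d^(-(N+k))`.
Some iterate of `f` expands on the Julia set (`exists_expanding_iterate`), so the inverse Böttcher
map is uniformly continuous up to potential `0` (`uniform_continuity`). Thin sectors thus have
diameter at most any prescribed `ε` once `k` is large.

Conclusion. The frontier of `Y` lies in the closures of the sectors and a finite set. Projecting `Y`
to a line and comparing lengths bounds its diameter by `M ε` (`ediam_le_of_frontier_subset`). -/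

open Set Filter Topology Polynomial

/-! ### Flat cocycles on subsets of the triangular lattice -/

namespace TriLattice

/-- The six neighbours of the origin in the triangular lattice, in cyclic order. -/
def dir : ZMod 6 → ℤ × ℤ := ![(1, 0), (1, 1), (0, 1), (-1, 0), (-1, -1), (0, -1)]

/-- A cocycle with values in `G` on the edges in directions `(1, 0)`, `(0, 1)`, `(1, 1)`, given by
`a`, `b` and `c`, is flat on the triangles with vertices in `X`. -/
structure IsFlat {G : Type*} [Group G] (X : Set (ℤ × ℤ)) (a b c : ℤ × ℤ → G) : Prop where
  lower : ∀ p ∈ X, p + (1, 0) ∈ X → p + (1, 1) ∈ X → a p * b (p + (1, 0)) = c p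
  upper : ∀ p ∈ X, p + (0, 1) ∈ X → p + (1, 1) ∈ X → b p * a (p + (0, 1)) = c p

/-- Dropping one relation from a cyclic system leaves a chain, solved by partial products starting
at `k`; no condition on the total product remains. -/
theorem exists_broken_cycle {G : Type*} [Group G] (e : ZMod 6 → G) (k : ZMod 6) :
    ∃ h : ZMod 6 → G, ∀ i, i + 1 ≠ k → h (i + 1) = h i * e i := by
  let H : ℕ → G := fun n => Nat.rec 1 (fun j x => x * e (k + j)) n
  refine ⟨fun i => H (i - k).val, fun i hi => ?_⟩
  have h1 : (i + 1 - k).val = (i - k).val + 1 := by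
    revert hi; revert i k; decide
  have h2 : H ((i - k).val + 1) = H (i - k).val * e (k + ((i - k).val : ℕ)) := rfl
  simp only [h1, h2, ZMod.natCast_zmod_val, add_sub_cancel]

/-- The unknowns are the values on the six edges at `q`, and each triangle at `q` relates two
consecutive ones. As `q + dir k` is missing, the relation between `k - 1` and `k` is void, so the
cycle of relations opens up and is solvable. -/
theorem IsFlat.exists_extension {G : Type*} [Group G] {X : Set (ℤ × ℤ)} {a b c : ℤ × ℤ → G}
    (h : IsFlat X a b c) {q : ℤ × ℤ} (hq : q ∉ X) {k : ZMod 6} (hk : q + dir k ∉ X) :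
    ∃ a' b' c' : ℤ × ℤ → G, IsFlat (insert q X) a' b' c' ∧
      (∀ p ∈ X, p + (1, 0) ∈ X → a' p = a p) ∧ (∀ p ∈ X, p + (0, 1) ∈ X → b' p = b p) := by
  obtain ⟨x, y⟩ := q
  -- Entry `i` of the list is the transport along the side of the hexagon from `q + dir i` to `q +
  -- dir (i + 1)`; `g i` is the transport from `q` to `q + dir i`.
  obtain ⟨g, hg⟩ := exists_broken_cycle
    (![b (x + 1, y), (a (x, y + 1))⁻¹, (c (x - 1, y))⁻¹, (b (x - 1, y - 1))⁻¹,
      a (x - 1, y - 1), c (x, y - 1)] : ZMod 6 → G) k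
  have g0 : (1 : ZMod 6) ≠ k → g 1 = g 0 * b (x + 1, y) := hg 0
  have g1 : (2 : ZMod 6) ≠ k → g 2 = g 1 * (a (x, y + 1))⁻¹ := hg 1
  have g2 : (3 : ZMod 6) ≠ k → g 3 = g 2 * (c (x - 1, y))⁻¹ := hg 2
  have g3 : (4 : ZMod 6) ≠ k → g 4 = g 3 * (b (x - 1, y - 1))⁻¹ := hg 3
  have g4 : (5 : ZMod 6) ≠ k → g 5 = g 4 * a (x - 1, y - 1) := hg 4
  have g5 : (0 : ZMod 6) ≠ k → g 0 = g 5 * c (x, y - 1) := hg 5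
  have d0 : dir 0 = (1, 0) := rfl
  have d1 : dir 1 = (1, 1) := rfl
  have d2 : dir 2 = (0, 1) := rfl
  have d3 : dir 3 = (-1, 0) := rfl
  have d4 : dir 4 = (-1, -1) := rfl
  have d5 : dir 5 = (0, -1) := rfl
  have key : ∀ (i : ZMod 6), (x, y) + dir i ∈ X → i ≠ k := by
    rintro i hi rfl; exact hk hi
  -- Edges ending at `q` are traversed backwards, hence the inverses.
  refine ⟨fun p => if p = (x, y) then g 0 else if p = (x - 1, y) then (g 3)⁻¹ else a p,
    fun p => if p = (x, y) then g 2 else if p = (x, y - 1) then (g 5)⁻¹ else b p,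
    fun p => if p = (x, y) then g 1 else if p = (x - 1, y - 1) then (g 4)⁻¹ else c p,
    ⟨?_, ?_⟩, ?_, ?_⟩
  · rintro ⟨s, t⟩ hp hp1 hp2
    simp only [mem_insert_iff, Prod.mk_add_mk, Prod.mk.injEq, add_zero] at hp hp1 hp2 ⊢
    by_cases e1 : s = x ∧ t = y
    · obtain ⟨rfl, rfl⟩ := e1
      simp at hp1 hp2 ⊢
      rw [g0 (key 1 (by simpa [d1] using hp2))]
    by_cases e2 : s + 1 = x ∧ t = y
    · obtain ⟨rfl, rfl⟩ := e2
      simp at hp hp1 hp2 ⊢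
      have n1 : t ≠ t - 1 := by omega
      rw [g2 (key 3 (by simpa [d3] using hp))]
      simp [n1]
    by_cases e3 : s + 1 = x ∧ t + 1 = y
    · obtain ⟨rfl, rfl⟩ := e3
      simp at hp hp1 hp2 ⊢
      rw [g4 (key 5 (by simpa [d5] using hp1))]
      simp
    · have n1 : ¬ (s = x - 1 ∧ t = y) := by omega
      have n2 : ¬ (s = x - 1 ∧ t = y - 1) := by omega
      have n3 : ¬ (s + 1 = x ∧ t = y - 1) := by omega
      simp only [e1, e2, e3, n1, n2, n3, if_false, false_or] at hp hp1 hp2 ⊢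
      simpa using h.lower (s, t) hp (by simpa using hp1) (by simpa using hp2)
  · rintro ⟨s, t⟩ hp hp1 hp2
    simp only [mem_insert_iff, Prod.mk_add_mk, Prod.mk.injEq, add_zero] at hp hp1 hp2 ⊢
    by_cases e1 : s = x ∧ t = y
    · obtain ⟨rfl, rfl⟩ := e1
      simp at hp1 hp2 ⊢
      rw [g1 (key 2 (by simpa [d2] using hp1))]
      simp
    by_cases e2 : s = x ∧ t + 1 = y
    · obtain ⟨rfl, rfl⟩ := e2
      simp at hp hp1 hp2 ⊢
      have n1 : s ≠ s - 1 := by omega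
      rw [g5 (key 0 (by simpa [d0] using hp2))]
      simp [n1]
    by_cases e3 : s + 1 = x ∧ t + 1 = y
    · obtain ⟨rfl, rfl⟩ := e3
      simp at hp hp1 hp2 ⊢
      rw [g3 (key 4 (by simpa [d4] using hp))]
      simp
    · have n1 : ¬ (s = x ∧ t = y - 1) := by omega
      have n2 : ¬ (s = x - 1 ∧ t = y - 1) := by omega
      have n3 : ¬ (s = x - 1 ∧ t + 1 = y) := by omega
      simp only [e1, e2, e3, n1, n2, n3, if_false, false_or] at hp hp1 hp2 ⊢
      simpa using h.upper (s, t) hp (by simpa using hp1) (by simpa using hp2)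
  · rintro ⟨s, t⟩ hp hp1
    have n1 : (s, t) ≠ (x, y) := by rintro h; exact hq (h ▸ hp)
    have n2 : (s, t) ≠ (x - 1, y) := by
      intro h; apply hq; rw [h] at hp1; simpa using hp1
    simp [n1, n2]
  · rintro ⟨s, t⟩ hp hp1
    have n1 : (s, t) ≠ (x, y) := by rintro h; exact hq (h ▸ hp)
    have n2 : (s, t) ≠ (x, y - 1) := by
      intro h; apply hq; rw [h] at hp1; simpa using hp1
    simp [n1, n2]

/-- The square `[0, M]²` of lattice points. -/
noncomputable def box (M : ℕ) : Finset (ℤ × ℤ) := Finset.Icc 0 (M : ℤ) ×ˢ Finset.Icc 0 (M : ℤ)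

theorem mem_box {M : ℕ} {p : ℤ × ℤ} :
    p ∈ box M ↔ (0 ≤ p.1 ∧ p.1 ≤ M) ∧ (0 ≤ p.2 ∧ p.2 ≤ M) := by
  simp [box]

/-- Integrate `a` along the bottom row and then `b` up each column; the two triangles of each square
carry the horizontal relation from one row to the next. -/
theorem IsFlat.exists_potential_box {G : Type*} [Group G] {M : ℕ} {a b c : ℤ × ℤ → G}
    (h : IsFlat (box M : Set (ℤ × ℤ)) a b c) :
    ∃ u : ℤ × ℤ → G, (∀ p ∈ box M, p + (1, 0) ∈ box M → u p * a p = u (p + (1, 0))) ∧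
      (∀ p ∈ box M, p + (0, 1) ∈ box M → u p * b p = u (p + (0, 1))) := by
  let R : ℕ → G := fun n => Nat.rec 1 (fun j x => x * a (j, 0)) n
  let U : ℕ → ℕ → G := fun i n => Nat.rec (R i) (fun j x => x * b (i, j)) n
  have hU : ∀ i j, U i (j + 1) = U i j * b (i, j) := fun _ _ => rfl
  have hR : ∀ j i : ℕ, i + 1 ≤ M → j ≤ M → U (i + 1) j = U i j * a (i, j) := by
    intro j
    induction j with
    | zero => intro i _ _; rfl
    | succ j ih =>
      intro i hi hj
      rw [hU (i + 1) j, hU i j, ih i hi (by omega), mul_assoc, mul_assoc]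
      have m0 : ((i : ℤ), (j : ℤ)) ∈ (box M : Set (ℤ × ℤ)) := by simp [box]; omega
      have m1 : ((i : ℤ), (j : ℤ)) + (1, 0) ∈ (box M : Set (ℤ × ℤ)) := by simp [box]; omega
      have m2 : ((i : ℤ), (j : ℤ)) + (0, 1) ∈ (box M : Set (ℤ × ℤ)) := by simp [box]; omega
      have m3 : ((i : ℤ), (j : ℤ)) + (1, 1) ∈ (box M : Set (ℤ × ℤ)) := by simp [box]; omega
      have e1 := h.lower _ m0 m1 m3
      have e2 := h.upper _ m0 m2 m3
      simp only [Prod.mk_add_mk, add_zero] at e1 e2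
      push_cast
      rw [e1, ← e2]
  refine ⟨fun p => U p.1.toNat p.2.toNat, ?_, ?_⟩
  · rintro ⟨s, t⟩ hp hp1
    simp only [mem_box, Prod.mk_add_mk, add_zero] at hp hp1
    lift s to ℕ using hp.1.1
    lift t to ℕ using hp.2.1
    have := hR t s (by omega) (by omega)
    simp only [Prod.mk_add_mk, add_zero, Int.toNat_natCast, Int.toNat_natCast_add_one, this]
  · rintro ⟨s, t⟩ hp hp1
    simp only [mem_box, Prod.mk_add_mk, add_zero] at hp hp1
    lift s to ℕ using hp.1.1
    lift t to ℕ using hp.2.1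
    simp only [Prod.mk_add_mk, add_zero, Int.toNat_natCast, Int.toNat_natCast_add_one, hU]

/-- A flat cocycle on a subset `X` of a square has a potential, if every point of the complement
of `X` can be joined in that complement to the outside of the square. -/
theorem IsFlat.exists_potential {G : Type*} [Group G] {M : ℕ} (r : ℤ × ℤ → ℕ)
    {X : Set (ℤ × ℤ)} {a b c : ℤ × ℤ → G} (h : IsFlat X a b c) (hX : X ⊆ box M)
    (hr : ∀ p ∈ box M, p ∉ X → ∃ k, p + dir k ∉ X ∧ (p + dir k ∉ box M ∨ r (p + dir k) < r p)) :
    ∃ u : ℤ × ℤ → G, (∀ p ∈ X, p + (1, 0) ∈ X → u p * a p = u (p + (1, 0))) ∧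
      (∀ p ∈ X, p + (0, 1) ∈ X → u p * b p = u (p + (0, 1))) := by
  classical
  induction hn : ((box M).filter (· ∉ X)).card generalizing X a b c with
  | zero =>
    rw [Finset.card_eq_zero, Finset.filter_eq_empty_iff] at hn
    have : X = box M := Subset.antisymm hX fun p hp => by simpa using hn hp
    subst this
    simpa using h.exists_potential_box
  | succ n ih =>
    -- Steps towards the outside leave the box or decrease the rank, so a point of maximal rank is
    -- never the next step of another point. Filling it in preserves the hypothesis on the remaining
    -- holes.
    obtain ⟨q, hq, hmax⟩ := ((box M).filter (· ∉ X)).exists_max_image r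
      (Finset.card_pos.1 (by omega))
    rw [Finset.mem_filter] at hq
    obtain ⟨k, hk, -⟩ := hr q hq.1 hq.2
    obtain ⟨a', b', c', hflat, ha, hb⟩ := h.exists_extension hq.2 hk
    obtain ⟨u, hu1, hu2⟩ := ih hflat (insert_subset hq.1 hX) (fun p hp hpX => by
      rw [mem_insert_iff, not_or] at hpX
      obtain ⟨j, hj, hj'⟩ := hr p hp hpX.2
      refine ⟨j, ?_, hj'⟩
      rw [mem_insert_iff, not_or]
      refine ⟨?_, hj⟩
      rintro h
      rcases hj' with hj' | hj'
      · exact hj' (h ▸ hq.1)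
      · have := hmax p (Finset.mem_filter.2 ⟨hp, hpX.2⟩)
        rw [h] at hj'
        omega) (by
      have : n = (((box M).filter (· ∉ X)).erase q).card := by
        rw [Finset.card_erase_of_mem (Finset.mem_filter.2 hq), hn]; rfl
      rw [this]
      congr 1
      ext p; simp only [Finset.mem_filter, Finset.mem_erase, mem_insert_iff]; tauto)
    refine ⟨u, fun p hp hp1 => ?_, fun p hp hp1 => ?_⟩
    · rw [← ha p hp hp1]
      exact hu1 p (mem_insert_of_mem _ hp) (mem_insert_of_mem _ hp1)
    · rw [← hb p hp hp1]
      exact hu2 p (mem_insert_of_mem _ hp) (mem_insert_of_mem _ hp1)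

/-- Lattice points which can be joined to the outside of the square in at most `k` steps through
the complement of `X`. -/
def reach (X : Set (ℤ × ℤ)) (M : ℕ) : ℕ → Set (ℤ × ℤ)
  | 0 => {p | p ∉ box M}
  | k + 1 => reach X M k ∪ {p | p ∉ X ∧ ∃ j, p + dir j ∉ X ∧ p + dir j ∈ reach X M k}

/-- The rank is the length of a shortest way out, and the first step of such a way decreases it. -/
theorem exists_rank {X : Set (ℤ × ℤ)} {M : ℕ} (hX : ∀ p ∈ box M, p ∉ X → ∃ k, p ∈ reach X M k) :
    ∃ r : ℤ × ℤ → ℕ, ∀ p ∈ box M, p ∉ X →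
      ∃ k, p + dir k ∉ X ∧ (p + dir k ∉ box M ∨ r (p + dir k) < r p) := by
  refine ⟨fun p => sInf {k | p ∈ reach X M k}, fun p hp hpX => ?_⟩
  have hmem : p ∈ reach X M (sInf {k | p ∈ reach X M k}) := Nat.sInf_mem (hX p hp hpX)
  rcases hs : sInf {k | p ∈ reach X M k} with _ | s
  · rw [hs] at hmem
    exact absurd hp hmem
  · rw [hs] at hmem
    rcases hmem with hmem | ⟨-, j, hj, hj'⟩
    · have := Nat.sInf_le (s := {k | p ∈ reach X M k}) hmem
      omega
    · refine ⟨j, hj, Or.inr ?_⟩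
      have := Nat.sInf_le (s := {k | p + dir j ∈ reach X M k}) hj'
      exact (this.trans_lt (Nat.lt_succ_self s)).trans_eq hs.symm

/-- The lattice point with given coordinates, for mesh `ε` and origin `x (1 + i)`. -/
def pos (x ε : ℝ) (p : ℤ × ℤ) : ℂ := ⟨x + ε * p.1, x + ε * p.2⟩

/-- The lower left corner of the lattice square containing `w`. -/
noncomputable def cell (x ε : ℝ) (w : ℂ) : ℤ × ℤ := (⌊(w.re - x) / ε⌋, ⌊(w.im - x) / ε⌋)

/-- `w` lies in the open square of side `2 ε` centered at the lattice point `p`. -/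
def InSquare (x ε : ℝ) (p : ℤ × ℤ) (w : ℂ) : Prop :=
  |w.re - (x + ε * p.1)| < ε ∧ |w.im - (x + ε * p.2)| < ε

theorem floor_bounds {ε : ℝ} (hε : 0 < ε) (x t : ℝ) :
    x + ε * ⌊(t - x) / ε⌋ ≤ t ∧ t < x + ε * ⌊(t - x) / ε⌋ + ε := by
  have h1 := Int.floor_le ((t - x) / ε)
  have h2 := Int.lt_floor_add_one ((t - x) / ε)
  rw [le_div_iff₀ hε] at h1
  rw [div_lt_iff₀ hε] at h2
  constructor <;> linarith

theorem eq_floor_or {ε : ℝ} (hε : 0 < ε) {x t : ℝ} {k : ℤ} (h : |t - (x + ε * k)| < ε) :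
    k = ⌊(t - x) / ε⌋ ∨ k = ⌊(t - x) / ε⌋ + 1 := by
  obtain ⟨h1, h2⟩ := floor_bounds hε x t
  rw [abs_lt] at h
  set m := ⌊(t - x) / ε⌋
  have a1 : k < m + 2 := by
    have : ε * (k : ℝ) < ε * ((m + 2 : ℤ) : ℝ) := by push_cast; linarith
    exact_mod_cast lt_of_mul_lt_mul_left this hε.le
  have a2 : m < k + 1 := by
    have : ε * (m : ℝ) < ε * ((k + 1 : ℤ) : ℝ) := by push_cast; linarith
    exact_mod_cast lt_of_mul_lt_mul_left this hε.le
  omega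

theorem floor_close {ε : ℝ} (hε : 0 < ε) {x t t' : ℝ} (h : |t - t'| < ε / 2) :
    ⌊(t' - x) / ε⌋ = ⌊(t - x) / ε⌋ ∨
    (⌊(t' - x) / ε⌋ = ⌊(t - x) / ε⌋ + 1 ∧ |t - (x + ε * (⌊(t - x) / ε⌋ + 1))| < ε) ∨
    (⌊(t' - x) / ε⌋ = ⌊(t - x) / ε⌋ - 1 ∧ |t' - (x + ε * ⌊(t - x) / ε⌋)| < ε) := by
  obtain ⟨h1, h2⟩ := floor_bounds hε x t
  obtain ⟨h3, h4⟩ := floor_bounds hε x t'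
  rw [abs_lt] at h
  set m := ⌊(t - x) / ε⌋
  set k := ⌊(t' - x) / ε⌋
  have a1 : k < m + 2 := by
    have : ε * (k : ℝ) < ε * ((m + 2 : ℤ) : ℝ) := by push_cast; linarith
    exact_mod_cast lt_of_mul_lt_mul_left this hε.le
  have a2 : m < k + 2 := by
    have : ε * (m : ℝ) < ε * ((k + 2 : ℤ) : ℝ) := by push_cast; linarith
    exact_mod_cast lt_of_mul_lt_mul_left this hε.le
  have : k = m ∨ k = m + 1 ∨ k = m - 1 := by omega
  rcases this with h0 | h0 | h0
  · exact Or.inl h0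
  · refine Or.inr (Or.inl ⟨h0, ?_⟩)
    have : (k : ℝ) = m + 1 := by exact_mod_cast h0
    rw [this] at h3
    rw [abs_lt]; constructor <;> linarith
  · refine Or.inr (Or.inr ⟨h0, ?_⟩)
    have : (k : ℝ) = m - 1 := by exact_mod_cast h0
    rw [this] at h4
    rw [abs_lt]; constructor <;> linarith

theorem reach_adj {X : Set (ℤ × ℤ)} {M : ℕ} {p q : ℤ × ℤ} (hp : p ∉ X)
    (hq : ∃ k, q ∈ reach X M k) (hqX : q ∉ X)
    (hpq : ∃ j, p + dir j = q) : ∃ k, p ∈ reach X M k := by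
  obtain ⟨k, hk⟩ := hq
  obtain ⟨j, rfl⟩ := hpq
  exact ⟨k + 1, Or.inr ⟨hp, j, hqX, hk⟩⟩

theorem exists_dir {p q : ℤ × ℤ} (h : (q.1 = p.1 + 1 ∧ q.2 = p.2) ∨ (q.1 = p.1 + 1 ∧ q.2 = p.2 + 1) ∨
    (q.1 = p.1 ∧ q.2 = p.2 + 1) ∨ (q.1 = p.1 - 1 ∧ q.2 = p.2) ∨ (q.1 = p.1 - 1 ∧ q.2 = p.2 - 1) ∨
    (q.1 = p.1 ∧ q.2 = p.2 - 1)) : ∃ j, p + dir j = q := by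
  rcases h with h | h | h | h | h | h
  · exact ⟨0, Prod.ext h.1.symm (by rw [h.2]; exact add_zero _)⟩
  · exact ⟨1, Prod.ext h.1.symm h.2.symm⟩
  · exact ⟨2, Prod.ext (by rw [h.1]; exact add_zero _) h.2.symm⟩
  · exact ⟨3, Prod.ext h.1.symm (by rw [h.2]; exact add_zero _)⟩
  · exact ⟨4, Prod.ext h.1.symm h.2.symm⟩
  · exact ⟨5, Prod.ext (by rw [h.1]; exact add_zero _) h.2.symm⟩

theorem inSquare_cell {x ε : ℝ} (hε : 0 < ε) (w : ℂ) : InSquare x ε (cell x ε w) w := by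
  obtain ⟨h1, h2⟩ := floor_bounds hε x w.re
  obtain ⟨h3, h4⟩ := floor_bounds hε x w.im
  constructor <;> rw [abs_lt] <;> constructor <;> simp only [cell] <;> linarith

/-- If the complement of `V` is connected, then the lattice points which are not well inside `V`
can be joined to the outside. -/
theorem exists_reach {V : Set ℂ} (hV : IsPreconnected Vᶜ) {x ε : ℝ} (hε : 0 < ε) {M : ℕ}
    {X : Set (ℤ × ℤ)} (hX : X = {p | p ∈ box M ∧ ∀ w, InSquare x ε p w → w ∈ V})
    {b₀ : ℂ} (hb₀ : b₀ ∉ V) (hcell : cell x ε b₀ ∉ box M) :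
    ∀ p ∈ box M, p ∉ X → ∃ k, p ∈ reach X M k := by
  have hnot : ∀ b ∉ V, ∀ p, InSquare x ε p b → p ∉ X := by
    intro b hb p hp hpX
    rw [hX] at hpX
    exact hb (hpX.2 b hp)
  have hcellX : ∀ b ∉ V, cell x ε b ∉ X := fun b hb => hnot b hb _ (inSquare_cell hε b)
  have hstep : ∀ b ∉ V, ∀ b' ∉ V, |b.re - b'.re| < ε / 2 → |b.im - b'.im| < ε / 2 →
      (∃ k, cell x ε b ∈ reach X M k) → ∃ k, cell x ε b' ∈ reach X M k := by
    intro b hb b' hb' hre him hreach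
    have hc := hcellX b hb
    have hc' := hcellX b' hb'
    have hadj := fun h => reach_adj hc' hreach hc (exists_dir (p := cell x ε b') h)
    obtain ⟨f1, f2⟩ := floor_bounds hε x b.re
    obtain ⟨f3, f4⟩ := floor_bounds hε x b.im
    obtain ⟨f5, f6⟩ := floor_bounds hε x b'.re
    obtain ⟨f7, f8⟩ := floor_bounds hε x b'.im
    rcases floor_close hε (x := x) hre with h1 | h1 | h1 <;>
      rcases floor_close hε (x := x) him with h2 | h2 | h2
    · have : cell x ε b' = cell x ε b := Prod.ext h1 h2
      rwa [this]
    · exact hadj (by simp only [cell]; omega)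
    · exact hadj (by simp only [cell]; omega)
    · exact hadj (by simp only [cell]; omega)
    · exact hadj (by simp only [cell]; omega)
    -- `(1, -1)` is not a direction of the lattice, so the path makes a detour through a lattice
    -- point whose open square still contains `b`. The opposite diagonal below is treated in the
    -- same way.
    · have hm : (⌊(b.re - x) / ε⌋ + 1, ⌊(b.im - x) / ε⌋) ∉ X := by
        refine hnot b hb _ ⟨by push_cast; exact h1.2, ?_⟩
        rw [abs_lt]; constructor <;> simp only <;> linarith
      refine reach_adj hc' (reach_adj hm hreach hc (exists_dir ?_)) hm (exists_dir ?_) <;>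
        simp only [cell, and_true] <;> omega
    · exact hadj (by simp only [cell]; omega)
    · have hm : (⌊(b.re - x) / ε⌋, ⌊(b.im - x) / ε⌋ + 1) ∉ X := by
        refine hnot b hb _ ⟨?_, by push_cast; exact h2.2⟩
        rw [abs_lt]; constructor <;> simp only <;> linarith
      refine reach_adj hc' (reach_adj hm hreach hc (exists_dir ?_)) hm (exists_dir ?_) <;>
        simp only [cell, true_and] <;> omega
    · exact hadj (by simp only [cell]; omega)
  have hall : ∀ b ∉ V, ∃ k, cell x ε b ∈ reach X M k := by
    intro b hb
    -- Having a cell that reaches the outside is a locally constant property on the connected set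
    -- `Vᶜ`, and it holds at `b₀`.
    refine hV.induction₂' (fun z w => (∃ k, cell x ε z ∈ reach X M k) ↔
      ∃ k, cell x ε w ∈ reach X M k) (fun z hz => ?_) (fun _ _ _ _ _ _ h1 h2 => h1.trans h2)
      hb₀ hb |>.1 ⟨0, hcell⟩
    have h1 : ∀ᶠ y in 𝓝[Vᶜ] z, dist y z < ε / 2 :=
      mem_nhdsWithin_of_mem_nhds (Metric.ball_mem_nhds z (by positivity))
    filter_upwards [h1, self_mem_nhdsWithin] with y hy hyV
    have e1 : |z.re - y.re| < ε / 2 := by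
      rw [← Complex.sub_re]
      exact (Complex.abs_re_le_norm _).trans_lt (by rwa [← dist_eq_norm, dist_comm])
    have e2 : |z.im - y.im| < ε / 2 := by
      rw [← Complex.sub_im]
      exact (Complex.abs_im_le_norm _).trans_lt (by rwa [← dist_eq_norm, dist_comm])
    have := hstep z hz y hyV e1 e2
    have h' := hstep y hyV z hz (by rwa [abs_sub_comm]) (by rwa [abs_sub_comm])
    exact ⟨⟨this, h'⟩, ⟨h', this⟩⟩
  intro p hp hpX
  have : ∃ w, InSquare x ε p w ∧ w ∉ V := by
    by_contra! hcon
    apply hpX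
    rw [hX]
    exact ⟨hp, hcon⟩
  obtain ⟨b, hb, hbV⟩ := this
  have h1 := eq_floor_or hε hb.1
  have h2 := eq_floor_or hε hb.2
  by_cases hpc : p = cell x ε b
  · rw [hpc]; exact hall b hbV
  · refine reach_adj hpX (hall b hbV) (hcellX b hbV) (exists_dir ?_)
    have : ¬ (p.1 = (cell x ε b).1 ∧ p.2 = (cell x ε b).2) := fun h => hpc (Prod.ext h.1 h.2)
    simp only [cell] at this ⊢
    omega

/-- Sending a fibre point to one within `η` in the nearby fibre is injective, because points of a
fibre are `6 η`-separated; fibres have the same finite size, so it is a permutation of the indices.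
-/
theorem exists_transport {n : ℕ} {V : Set ℂ} {enum : ℂ → Fin n → ℂ} {r η : ℝ} (hη : 0 < η)
    (hu : ∀ w ∈ V, ∀ i j, dist (enum w i) (enum w j) < 6 * η → i = j)
    (hl : ∀ w ∈ V, ∀ w' ∈ V, dist w w' < r → ∀ i, ∃ j, dist (enum w' j) (enum w i) < η)
    {w w' : ℂ} (hw : w ∈ V) (hw' : w' ∈ V) (hww : dist w w' < r) :
    ∃ σ : Equiv.Perm (Fin n), ∀ i, dist (enum w (σ i)) (enum w' i) < η := by
  choose s hs using hl w' hw' w hw (by rwa [dist_comm])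
  have hinj : Function.Injective s := by
    intro i j hij
    apply hu w' hw'
    have h1 := hs i
    have h2 := hs j
    rw [hij] at h1
    have := dist_triangle_left (enum w' i) (enum w' j) (enum w (s j))
    linarith
  exact ⟨Equiv.ofBijective s (Finite.injective_iff_bijective.1 hinj), hs⟩

/-- Over a bounded plane set with connected complement, the points of the fibres of a "covering"
can be labelled consistently. The covering is given by an enumeration of its fibres. -/
theorem exists_label {n : ℕ} {V C : Set ℂ} (hV : IsPreconnected Vᶜ)
    (hVb : Bornology.IsBounded V) {κ r η : ℝ} (hκ : 0 < κ) (hr : 0 < r) (hη : 0 < η)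
    (hC : ∀ w ∈ C, Metric.ball w κ ⊆ V) (enum : ℂ → Fin n → ℂ)
    (hu : ∀ w ∈ V, ∀ i j, dist (enum w i) (enum w j) < 6 * η → i = j)
    (hl : ∀ w ∈ V, ∀ w' ∈ V, dist w w' < r → ∀ i, ∃ j, dist (enum w' j) (enum w i) < η) :
    ∃ (lab : ℂ → Fin n → Fin n) (ε : ℝ), 0 < ε ∧ (∀ w ∈ C, Function.Injective (lab w)) ∧
      ∀ w ∈ C, ∀ w' ∈ C, dist w w' < ε → ∀ i j, dist (enum w i) (enum w' j) < η →
        lab w i = lab w' j := by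
  classical
  obtain ⟨R, hR⟩ := hVb.subset_ball (0 : ℂ)
  -- Squares around lattice points near `C` reach less than `6 ε` from `C`, hence stay in `V`;
  -- neighbouring lattice points are less than `4 ε` apart, hence within the range `r` of the
  -- transport.
  set ε : ℝ := min (κ / 8) (r / 8) with hεdef
  have hε : 0 < ε := by positivity
  have hεκ : 8 * ε ≤ κ := by have := min_le_left (κ / 8) (r / 8); linarith
  have hεr : 8 * ε ≤ r := by have := min_le_right (κ / 8) (r / 8); linarith
  obtain ⟨M, hM⟩ := exists_nat_ge (2 * R / ε)
  rw [div_le_iff₀ hε] at hM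
  set x : ℝ := -R with hx
  set X : Set (ℤ × ℤ) := {p | p ∈ box M ∧ ∀ w, InSquare x ε p w → w ∈ V} with hX
  have hXM : X ⊆ box M := fun p hp => hp.1
  have hXV : ∀ p ∈ X, pos x ε p ∈ V := by
    intro p hp
    exact hp.2 _ (by simp [InSquare, pos, hε])
  have hbig : ∀ w ∈ V, |w.re| < R ∧ |w.im| < R := by
    intro w hw
    have := hR hw
    rw [mem_ball_zero_iff] at this
    exact ⟨(Complex.abs_re_le_norm w).trans_lt this, (Complex.abs_im_le_norm w).trans_lt this⟩
  have hdist : ∀ w w' : ℂ, ∀ A B : ℝ, |w.re - w'.re| < A → |w.im - w'.im| < B →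
      dist w w' < A + B := by
    intro w w' A B h1 h2
    rw [dist_eq_norm]
    have := Complex.norm_le_abs_re_add_abs_im (w - w')
    rw [Complex.sub_re, Complex.sub_im] at this
    linarith
  -- lattice points close to `C` belong to `X`
  have hnear : ∀ w ∈ C, ∀ p : ℤ × ℤ, |w.re - (pos x ε p).re| < 2 * ε →
      |w.im - (pos x ε p).im| < 2 * ε → p ∈ X := by
    intro w hw p h1 h2
    have hsq : ∀ w', InSquare x ε p w' → w' ∈ V := by
      intro w' hw'
      apply hC w hw
      simp only [pos] at h1 h2
      have a1 := hw'.1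
      have a2 := hw'.2
      rw [Metric.mem_ball]
      refine lt_of_lt_of_le (hdist w' w (3 * ε) (3 * ε) ?_ ?_) (by linarith)
      · rw [abs_lt] at *; constructor <;> linarith
      · rw [abs_lt] at *; constructor <;> linarith
    refine ⟨?_, hsq⟩
    have hp : pos x ε p ∈ V := hsq _ (by simp [InSquare, pos, hε])
    obtain ⟨b1, b2⟩ := hbig _ hp
    simp only [pos, abs_lt] at b1 b2
    rw [mem_box]
    have c : ∀ t : ℤ, -R < x + ε * t → x + ε * t < R → 0 ≤ t ∧ t ≤ M := by
      intro t h1 h2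
      constructor
      · have : ε * 0 < ε * (t : ℝ) := by rw [hx] at h1; linarith
        have := lt_of_mul_lt_mul_left this hε.le
        exact_mod_cast this.le
      · have : ε * (t : ℝ) < ε * (M : ℤ) := by rw [hx] at h2; push_cast; linarith
        have := lt_of_mul_lt_mul_left this hε.le
        exact_mod_cast this.le
    exact ⟨c _ b1.1 b1.2, c _ b2.1 b2.2⟩
  -- the cocycle
  have htr : ∀ q : (ℤ × ℤ), ∃ τ : ℤ × ℤ → Equiv.Perm (Fin n),
      (|q.1| ≤ 1 ∧ |q.2| ≤ 1) → ∀ p ∈ X, p + q ∈ X → ∀ i, dist (enum (pos x ε p) (τ p i)) (enum (pos x ε (p + q)) i) < η := by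
    intro q
    by_cases hq : |q.1| ≤ 1 ∧ |q.2| ≤ 1
    swap
    · exact ⟨fun _ => 1, fun h => absurd h hq⟩
    have : ∀ p, ∃ σ : Equiv.Perm (Fin n), p ∈ X → p + q ∈ X → ∀ i,
        dist (enum (pos x ε p) (σ i)) (enum (pos x ε (p + q)) i) < η := by
      intro p
      by_cases hp : p ∈ X ∧ p + q ∈ X
      · obtain ⟨σ, hσ⟩ := exists_transport (r := r) hη hu hl (hXV p hp.1) (hXV _ hp.2) (by
          have e : ∀ s t : ℤ, |t| ≤ 1 → |x + ε * s - (x + ε * ((s + t : ℤ) : ℝ))| < 2 * ε := by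
            intro s t ht
            have : x + ε * s - (x + ε * ((s + t : ℤ) : ℝ)) = - (ε * t) := by push_cast; ring
            rw [this, abs_neg, abs_mul, abs_of_pos hε]
            have : |(t : ℝ)| ≤ 1 := by exact_mod_cast ht
            nlinarith
          have := hdist (pos x ε p) (pos x ε (p + q)) (2 * ε) (2 * ε)
            (e p.1 q.1 hq.1) (e p.2 q.2 hq.2)
          linarith)
        exact ⟨σ, fun _ _ => hσ⟩
      · exact ⟨1, fun h1 h2 => absurd ⟨h1, h2⟩ hp⟩
    choose τ hτ using this
    exact ⟨τ, fun _ => hτ⟩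
  obtain ⟨a, ha⟩ := htr (1, 0)
  obtain ⟨b, hb⟩ := htr (0, 1)
  obtain ⟨c, hc⟩ := htr (1, 1)
  replace ha := ha (by norm_num)
  replace hb := hb (by norm_num)
  replace hc := hc (by norm_num)
  have e10 : ∀ p : ℤ × ℤ, p + (1, 0) + (0, 1) = p + (1, 1) := fun p => by simp [add_assoc]
  have e01 : ∀ p : ℤ × ℤ, p + (0, 1) + (1, 0) = p + (1, 1) := fun p => by simp [add_assoc]
  -- The two ways along a triangle end at fibre points less than `3 η` apart, hence equal.
  have hflat : IsFlat X a b c := by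
    constructor
    · intro p hp hp1 hp2
      ext i : 1
      apply hu _ (hXV p hp)
      have h1 := ha p hp hp1 (b (p + (1, 0)) i)
      have h2 := hb _ hp1 (by rwa [e10]) i
      have h3 := hc p hp hp2 i
      rw [e10] at h2
      rw [Equiv.Perm.mul_apply]
      have t1 := dist_triangle (enum (pos x ε p) (a p (b (p + (1, 0)) i)))
        (enum (pos x ε (p + (1, 0))) (b (p + (1, 0)) i)) (enum (pos x ε (p + (1, 1))) i)
      have t2 := dist_triangle_right (enum (pos x ε p) (a p (b (p + (1, 0)) i)))
        (enum (pos x ε p) (c p i)) (enum (pos x ε (p + (1, 1))) i)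
      linarith
    · intro p hp hp1 hp2
      ext i : 1
      apply hu _ (hXV p hp)
      have h1 := hb p hp hp1 (a (p + (0, 1)) i)
      have h2 := ha _ hp1 (by rwa [e01]) i
      have h3 := hc p hp hp2 i
      rw [e01] at h2
      rw [Equiv.Perm.mul_apply]
      have t1 := dist_triangle (enum (pos x ε p) (b p (a (p + (0, 1)) i)))
        (enum (pos x ε (p + (0, 1))) (a (p + (0, 1)) i)) (enum (pos x ε (p + (1, 1))) i)
      have t2 := dist_triangle_right (enum (pos x ε p) (b p (a (p + (0, 1)) i)))
        (enum (pos x ε p) (c p i)) (enum (pos x ε (p + (1, 1))) i)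
      linarith
  -- the potential
  have hb₀ : (⟨-|R| - 2 * ε - 1, 0⟩ : ℂ) ∉ V := by
    intro h
    have := (hbig _ h).1
    have h3 := le_abs_self R
    have h4 := abs_nonneg R
    rw [abs_lt] at this
    simp only at this
    linarith [this.1]
  obtain ⟨rk, hrk⟩ := exists_rank (exists_reach hV hε hX hb₀ (by
    rw [mem_box]
    rintro ⟨⟨h1, -⟩, -⟩
    simp only [cell] at h1
    rw [Int.floor_nonneg, le_div_iff₀ hε] at h1
    have := le_abs_self R
    linarith))
  obtain ⟨u, hu1, hu2⟩ := hflat.exists_potential rk hXM hrk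
  -- `5 η` plus the displacement `η` of the transport stays within the separation `6 η`, so `i` must
  -- be the transport of `j`.
  have sa : ∀ p ∈ X, p + (1, 0) ∈ X → ∀ i j,
      dist (enum (pos x ε p) i) (enum (pos x ε (p + (1, 0))) j) < 5 * η →
        u p i = u (p + (1, 0)) j := by
    intro p hp hp1 i j hij
    rw [← hu1 p hp hp1, Equiv.Perm.mul_apply]
    congr 1
    apply hu _ (hXV p hp)
    have := dist_triangle_right (enum (pos x ε p) i) (enum (pos x ε p) (a p j))
      (enum (pos x ε (p + (1, 0))) j)
    have := ha p hp hp1 j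
    linarith
  have sb : ∀ p ∈ X, p + (0, 1) ∈ X → ∀ i j,
      dist (enum (pos x ε p) i) (enum (pos x ε (p + (0, 1))) j) < 5 * η →
        u p i = u (p + (0, 1)) j := by
    intro p hp hp1 i j hij
    rw [← hu2 p hp hp1, Equiv.Perm.mul_apply]
    congr 1
    apply hu _ (hXV p hp)
    have := dist_triangle_right (enum (pos x ε p) i) (enum (pos x ε p) (b p j))
      (enum (pos x ε (p + (0, 1))) j)
    have := hb p hp hp1 j
    linarith
  have sh : ∀ p ∈ X, ∀ q ∈ X, (q.1 = p.1 ∨ q.1 = p.1 + 1 ∨ q.1 = p.1 - 1) → q.2 = p.2 → ∀ i j,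
      dist (enum (pos x ε p) i) (enum (pos x ε q) j) < 5 * η → u p i = u q j := by
    intro p hp q hq h1 h2 i j hij
    rcases h1 with h1 | h1 | h1
    · have : q = p := Prod.ext h1 h2
      subst this
      rw [hu _ (hXV q hp) i j (by linarith)]
    · have : q = p + (1, 0) := Prod.ext h1 (by simp [h2])
      subst this
      exact sa p hp hq i j hij
    · have : p = q + (1, 0) := Prod.ext (by simp [h1]) (by simp [h2])
      subst this
      exact (sa q hq hp j i (by rwa [dist_comm])).symm
  have sv : ∀ p ∈ X, ∀ q ∈ X, q.1 = p.1 → (q.2 = p.2 ∨ q.2 = p.2 + 1 ∨ q.2 = p.2 - 1) → ∀ i j,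
      dist (enum (pos x ε p) i) (enum (pos x ε q) j) < 5 * η → u p i = u q j := by
    intro p hp q hq h2 h1 i j hij
    rcases h1 with h1 | h1 | h1
    · have : q = p := Prod.ext h2 h1
      subst this
      rw [hu _ (hXV q hp) i j (by linarith)]
    · have : q = p + (0, 1) := Prod.ext (by simp [h2]) h1
      subst this
      exact sb p hp hq i j hij
    · have : p = q + (0, 1) := Prod.ext (by simp [h2]) (by simp [h1])
      subst this
      exact (sb q hq hp j i (by rwa [dist_comm])).symm
  -- the labels
  have hcn : ∀ w : ℂ, |w.re - (pos x ε (cell x ε w)).re| < ε ∧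
      |w.im - (pos x ε (cell x ε w)).im| < ε := fun w => inSquare_cell hε w
  have hcX : ∀ w ∈ C, cell x ε w ∈ X := fun w hw =>
    hnear w hw _ (by linarith [(hcn w).1]) (by linarith [(hcn w).2])
  have hCV : ∀ w ∈ C, w ∈ V := fun w hw => hC w hw (Metric.mem_ball_self hκ)
  have hex : ∀ w, ∀ i, ∃ k, w ∈ C → dist (enum (pos x ε (cell x ε w)) k) (enum w i) < η := by
    intro w i
    by_cases hw : w ∈ C
    · obtain ⟨k, hk⟩ := hl w (hCV w hw) _ (hXV _ (hcX w hw)) (by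
        have := hdist _ _ _ _ (hcn w).1 (hcn w).2
        linarith) i
      exact ⟨k, fun _ => hk⟩
    · exact ⟨i, fun h => absurd h hw⟩
  choose K hK using hex
  -- A fibre point over `w` receives the potential of the fibre point within `η` of it over the
  -- corner of the cell of `w`.
  refine ⟨fun w i => u (cell x ε w) (K w i), ε / 2, by positivity, ?_, ?_⟩
  · intro w hw i j hij
    have hij : K w i = K w j := (u _).injective hij
    apply hu w (hCV w hw)
    have h1 := hK w i hw
    have h2 := hK w j hw
    rw [hij] at h1
    have := dist_triangle_left (enum w i) (enum w j) (enum (pos x ε (cell x ε w)) (K w j))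
    linarith
  · intro w hw w' hw' hww i j hij
    have hre : |w.re - w'.re| < ε / 2 := by
      rw [← Complex.sub_re]
      exact (Complex.abs_re_le_norm _).trans_lt (by rwa [← dist_eq_norm])
    have him : |w.im - w'.im| < ε / 2 := by
      rw [← Complex.sub_im]
      exact (Complex.abs_im_le_norm _).trans_lt (by rwa [← dist_eq_norm])
    have f1 := floor_close hε (x := x) hre
    have f2 := floor_close hε (x := x) him
    -- The cells of `w` and `w'` may be diagonal neighbours; `m` replaces the diagonal move by a
    -- horizontal one followed by a vertical one.
    set m : ℤ × ℤ := ((cell x ε w').1, (cell x ε w).2) with hm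
    have hmre : |w'.re - (pos x ε m).re| < ε := (hcn w').1
    have hmim : |w.im - (pos x ε m).im| < ε := (hcn w).2
    have hmre' : |w.re - (pos x ε m).re| < 2 * ε := by
      rw [abs_lt] at *; constructor <;> linarith
    have hmX : m ∈ X := hnear w hw m hmre' (by linarith)
    have hK1 := hK w i hw
    have hK2 := hK w' j hw'
    obtain ⟨t, ht⟩ := hl w' (hCV _ hw') (pos x ε m) (hXV m hmX) (by
      have : |w'.im - (pos x ε m).im| < 2 * ε := by rw [abs_lt] at *; constructor <;> linarith
      have := hdist w' (pos x ε m) _ _ hmre this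
      linarith) j
    have T1 : dist (enum (pos x ε (cell x ε w)) (K w i)) (enum w' j) < 2 * η := by
      have := dist_triangle (enum (pos x ε (cell x ε w)) (K w i)) (enum w i) (enum w' j)
      linarith
    have s1 : u (cell x ε w) (K w i) = u m t := by
      refine sh _ (hcX w hw) m hmX ?_ rfl _ _ ?_
      · simp only [hm, cell]; omega
      · have := dist_triangle_right (enum (pos x ε (cell x ε w)) (K w i)) (enum (pos x ε m) t)
          (enum w' j)
        linarith
    have s2 : u m t = u (cell x ε w') (K w' j) := by
      refine sv m hmX _ (hcX w' hw') rfl ?_ _ _ ?_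
      · simp only [hm, cell]; omega
      · have := dist_triangle_right (enum (pos x ε m) t)
          (enum (pos x ε (cell x ε w')) (K w' j)) (enum w' j)
        linarith
    exact s1.trans s2

end TriLattice

/-! ### Proper local biholomorphisms onto plane sets with connected complement -/

namespace ProperMap

/-- A closed thickening of a connected set is connected. -/
theorem isPreconnected_infDist_le {S : Set ℂ} (hS : IsPreconnected S) (hSc : IsClosed S)
    (hSn : S.Nonempty) (ρ : ℝ) (hρ : 0 ≤ ρ) : IsPreconnected {w | Metric.infDist w S ≤ ρ} := by
  obtain ⟨y₀, hy₀⟩ := hSn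
  have hsub : S ⊆ {w | Metric.infDist w S ≤ ρ} := fun w hw => by
    simpa [Metric.infDist_zero_of_mem hw] using hρ
  refine isPreconnected_of_forall y₀ fun w hw => ?_
  obtain ⟨y, hy, hyw⟩ := hSc.exists_infDist_eq_dist ⟨y₀, hy₀⟩ w
  refine ⟨segment ℝ w y ∪ S, union_subset ?_ hsub, Or.inr hy₀, Or.inl (left_mem_segment ℝ w y), ?_⟩
  · intro v hv
    have h1 : dist v y ≤ dist w y := by
      have := (convex_closedBall y (dist w y)).segment_subset (Metric.mem_closedBall.2 le_rfl)
        (Metric.mem_closedBall_self dist_nonneg) hv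
      exact this
    have := Metric.infDist_le_dist_of_mem (x := v) hy
    simp only [mem_ofPred_eq] at hw ⊢
    linarith
  · exact (convex_segment w y).isPreconnected.union y (right_mem_segment ℝ w y) hy hS

section
variable {F : ℂ → ℂ} {A Y : Set ℂ}

/-- This is properness of `F : A → Y`: frontier points go outside `Y`, so replacing `A` by its
compact closure adds nothing to the preimage of `K`. -/
theorem isCompact_inter_preimage (hF : Continuous F) (hA : Bornology.IsBounded A)
    (hfr : ∀ x ∈ frontier A, F x ∉ Y) {K : Set ℂ} (hK : IsClosed K) (hKY : K ⊆ Y) :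
    IsCompact (A ∩ F ⁻¹' K) := by
  have : A ∩ F ⁻¹' K = closure A ∩ F ⁻¹' K := by
    refine Subset.antisymm (inter_subset_inter_left _ subset_closure) ?_
    rintro x ⟨hx, hxK⟩
    refine ⟨?_, hxK⟩
    by_contra hxA
    exact hfr x ⟨hx, fun h => hxA (interior_subset h)⟩ (hKY hxK)
  rw [this]
  exact hA.isCompact_closure.inter_right (hK.preimage hF)

theorem hasStrictDerivAt (hF : Differentiable ℂ F) (x : ℂ) :
    HasStrictDerivAt F (deriv F x) x :=
  (hF.contDiff (n := 1)).contDiffAt.hasStrictDerivAt one_ne_zero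

theorem exists_nhds_injOn (hF : Differentiable ℂ F) {x : ℂ} (hx : deriv F x ≠ 0) :
    ∃ U : Set ℂ, IsOpen U ∧ x ∈ U ∧ InjOn F U := by
  have h := (hasStrictDerivAt hF x).hasStrictFDerivAt_equiv hx
  exact ⟨_, h.toOpenPartialHomeomorph.open_source, h.mem_toOpenPartialHomeomorph_source,
    h.toOpenPartialHomeomorph.injOn⟩

/-- `δ` is a Lebesgue number of the cover of `D` by open sets on which `F` is injective. The second
point `x'` is not required to lie in `D`. -/
theorem exists_uniform_injective (hF : Differentiable ℂ F) (hd : ∀ x ∈ A, deriv F x ≠ 0)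
    {D : Set ℂ} (hD : IsCompact D) (hDA : D ⊆ A) :
    ∃ δ > 0, ∀ x ∈ D, ∀ x', F x = F x' → dist x x' < δ → x = x' := by
  choose! U hUo hxU hU using fun x (hx : x ∈ D) => exists_nhds_injOn hF (hd x (hDA hx))
  obtain ⟨δ, hδ, h⟩ := lebesgue_number_lemma_of_metric (c := fun x : D => U x) hD
    (fun x => hUo x x.2) (fun x hx => mem_iUnion.2 ⟨⟨x, hx⟩, hxU x hx⟩)
  refine ⟨δ, hδ, fun x hx x' hxx hdist => ?_⟩
  obtain ⟨i, hi⟩ := h x hx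
  exact hU i i.2 (hi (Metric.mem_ball_self hδ)) (hi (by rwa [Metric.mem_ball, dist_comm])) hxx

/-- Where the derivative does not vanish, images of small balls are neighbourhoods; compactness of
`D` makes their size uniform. -/
theorem exists_uniform_lift (hF : Differentiable ℂ F) (hA : IsOpen A)
    (hd : ∀ x ∈ A, deriv F x ≠ 0) {D : Set ℂ} (hD : IsCompact D) (hDA : D ⊆ A) {η : ℝ}
    (hη : 0 < η) :
    ∃ r > 0, ∀ x ∈ D, ∀ w, dist (F x) w < r → ∃ x' ∈ A, F x' = w ∧ dist x' x < η := by
  refine hD.induction_on (p := fun S => ∃ r > 0, ∀ x ∈ S, ∀ w, dist (F x) w < r →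
    ∃ x' ∈ A, F x' = w ∧ dist x' x < η) ⟨1, one_pos, by simp⟩ ?_ ?_ ?_
  · rintro s t hst ⟨r, hr, h⟩
    exact ⟨r, hr, fun x hx => h x (hst hx)⟩
  · rintro s t ⟨r, hr, h⟩ ⟨r', hr', h'⟩
    refine ⟨min r r', lt_min hr hr', ?_⟩
    rintro x (hx | hx) w hw
    · exact h x hx w (hw.trans_le (min_le_left _ _))
    · exact h' x hx w (hw.trans_le (min_le_right _ _))
  · intro x hx
    have h1 : F '' (A ∩ Metric.ball x (η / 2)) ∈ 𝓝 (F x) := by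
      rw [← (hasStrictDerivAt hF x).map_nhds_eq (hd x (hDA hx))]
      exact image_mem_map (inter_mem (hA.mem_nhds (hDA hx)) (Metric.ball_mem_nhds x (by positivity)))
    obtain ⟨r, hr, hball⟩ := Metric.mem_nhds_iff.1 h1
    refine ⟨Metric.ball x (η / 2) ∩ F ⁻¹' Metric.ball (F x) (r / 2),
      mem_nhdsWithin_of_mem_nhds (inter_mem (Metric.ball_mem_nhds x (by positivity))
        (hF.continuous.continuousAt.preimage_mem_nhds (Metric.ball_mem_nhds _ (by positivity)))),
      r / 2, by positivity, ?_⟩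
    rintro y ⟨hy, hFy⟩ w hw
    rw [mem_preimage, Metric.mem_ball] at hFy
    rw [Metric.mem_ball] at hy
    obtain ⟨x', ⟨hx'A, hx'⟩, rfl⟩ := hball (show w ∈ Metric.ball (F x) r by
      rw [Metric.mem_ball]
      have := dist_triangle_left w (F x) (F y)
      linarith)
    refine ⟨x', hx'A, rfl, ?_⟩
    rw [Metric.mem_ball] at hx'
    have := dist_triangle_right x' y x
    linarith

/-- The quantitative covering property over `K`. The ratio `6` between separation and lifting
distance absorbs the displacements by `η` composed in the lattice argument. -/
theorem exists_uniform_covering (hF : Differentiable ℂ F) (hA : IsOpen A)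
    (hAb : Bornology.IsBounded A) (hfr : ∀ x ∈ frontier A, F x ∉ Y)
    (hd : ∀ x ∈ A, deriv F x ≠ 0) {K : Set ℂ} (hK : IsClosed K) (hKY : K ⊆ Y) :
    ∃ η > 0, ∃ r > 0, (∀ x ∈ A, F x ∈ K → ∀ x', F x = F x' → dist x x' < 6 * η → x = x') ∧
      ∀ x ∈ A, F x ∈ K → ∀ w, dist (F x) w < r → ∃ x' ∈ A, F x' = w ∧ dist x' x < η := by
  have hD := isCompact_inter_preimage hF.continuous hAb hfr hK hKY
  obtain ⟨δ, hδ, h1⟩ := exists_uniform_injective hF hd hD inter_subset_left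
  obtain ⟨r, hr, h2⟩ := exists_uniform_lift hF hA hd hD inter_subset_left
    (show 0 < δ / 6 by positivity)
  refine ⟨δ / 6, by positivity, r, hr, fun x hx hxK x' h h' => h1 x ⟨hx, hxK⟩ x' h ?_,
    fun x hx hxK => h2 x ⟨hx, hxK⟩⟩
  linarith

theorem finite_fibre (hF : Differentiable ℂ F) (hAb : Bornology.IsBounded A)
    (hfr : ∀ x ∈ frontier A, F x ∉ Y) (hd : ∀ x ∈ A, deriv F x ≠ 0) {w : ℂ} (hw : w ∈ Y) :
    (A ∩ F ⁻¹' {w}).Finite := by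
  have hD := isCompact_inter_preimage hF.continuous hAb hfr isClosed_singleton
    (singleton_subset_iff.2 hw)
  obtain ⟨δ, hδ, h1⟩ := exists_uniform_injective hF hd hD inter_subset_left
  obtain ⟨t, ht, htc⟩ := hD.elim_nhds_subcover (fun x => Metric.ball x δ)
    (fun x _ => Metric.ball_mem_nhds x hδ)
  refine t.finite_toSet.subset fun x hx => ?_
  obtain ⟨y, hy, hxy⟩ := mem_iUnion₂.1 (htc hx)
  have : x = y := h1 x hx y (hx.2.trans (ht y hy).2.symm) hxy
  exact this ▸ hy

/-- Lifting moves points by less than `η` while fibres are `6 η`-separated, so nearby fibres inject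
into each other. The cardinality is thus locally constant on the connected set `Y`. -/
theorem ncard_fibre_eq (hF : Differentiable ℂ F) (hA : IsOpen A) (hAb : Bornology.IsBounded A)
    (hY : IsOpen Y) (hYc : IsPreconnected Y) (hfr : ∀ x ∈ frontier A, F x ∉ Y)
    (hd : ∀ x ∈ A, deriv F x ≠ 0) {w w' : ℂ} (hw : w ∈ Y) (hw' : w' ∈ Y) :
    (A ∩ F ⁻¹' {w}).ncard = (A ∩ F ⁻¹' {w'}).ncard := by
  refine hYc.constant (f := fun w => (A ∩ F ⁻¹' {w}).ncard) ?_ hw hw'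
  intro w hw
  refine ContinuousAt.continuousWithinAt ?_
  rw [ContinuousAt, nhds_discrete ℕ, tendsto_pure]
  obtain ⟨s, hs, hsY⟩ := Metric.nhds_basis_closedBall.mem_iff.1 (hY.mem_nhds hw)
  obtain ⟨η, hη, r, hr, h1, h2⟩ := exists_uniform_covering hF hA hAb hfr hd
    Metric.isClosed_closedBall hsY
  have key : ∀ v ∈ Metric.closedBall w s, ∀ v' ∈ Metric.closedBall w s, dist v v' < r →
      (A ∩ F ⁻¹' {v}).ncard ≤ (A ∩ F ⁻¹' {v'}).ncard := by
    intro v hv v' hv' hvv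
    have hlift : ∀ x, ∃ x', x ∈ A ∩ F ⁻¹' {v} → x' ∈ A ∧ F x' = v' ∧ dist x' x < η := by
      intro x
      by_cases hx : x ∈ A ∩ F ⁻¹' {v}
      · have hxv : F x = v := hx.2
        obtain ⟨x', a, b, c⟩ := h2 x hx.1 (by rwa [hxv]) v' (by rwa [hxv])
        exact ⟨x', fun _ => ⟨a, b, c⟩⟩
      · exact ⟨x, fun h => absurd h hx⟩
    choose g hg using hlift
    refine Set.ncard_le_ncard_of_injOn g (fun x hx => ⟨(hg x hx).1, (hg x hx).2.1⟩) ?_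
      (finite_fibre hF hAb hfr hd (hsY hv'))
    intro x hx y hy hxy
    have a := (hg x hx).2.2
    have b := (hg y hy).2.2
    rw [hxy] at a
    have hxv : F x = v := hx.2
    have hyv : F y = v := hy.2
    refine h1 x hx.1 (by rwa [hxv]) y (hxv.trans hyv.symm) ?_
    have := dist_triangle_left x y (g y)
    linarith
  filter_upwards [Metric.ball_mem_nhds w (lt_min hs hr)] with v hv
  rw [Metric.mem_ball, lt_min_iff] at hv
  have hv1 : v ∈ Metric.closedBall w s := Metric.mem_closedBall.2 hv.1.le
  have hw1 : w ∈ Metric.closedBall w s := Metric.mem_closedBall_self hs.le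
  exact le_antisymm (key v hv1 w hw1 hv.2) (key w hw1 v hv1 (by rw [dist_comm]; exact hv.2))

/-- A proper holomorphic map without critical points from a connected plane set to a connected
plane set with connected complement is injective. -/
theorem injOn (hF : Differentiable ℂ F) (hA : IsOpen A) (hAc : IsPreconnected A)
    (hAb : Bornology.IsBounded A) (hY : IsOpen Y) (hYc : IsPreconnected Y)
    (hYb : Bornology.IsBounded Y) (hYn : IsPreconnected Yᶜ) (hmap : MapsTo F A Y)
    (hfr : ∀ x ∈ frontier A, F x ∉ Y) (hd : ∀ x ∈ A, deriv F x ≠ 0) : InjOn F A := by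
  intro x₁ hx₁ x₂ hx₂ hx
  -- A path in `A` between two points with the same image maps to a closed curve in `Y`; consistent
  -- labels over that curve will force the end points to coincide.
  have hjoin : JoinedIn A x₁ x₂ :=
    ((hA.isConnected_iff_isPathConnected).1 ⟨⟨x₁, hx₁⟩, hAc⟩).joinedIn x₁ hx₁ x₂ hx₂
  obtain ⟨γ, hγ⟩ := hjoin
  set C : Set ℂ := range (F ∘ γ) with hCdef
  have hCc : IsCompact C := isCompact_range (hF.continuous.comp γ.continuous)
  have hCY : C ⊆ Y := by rintro _ ⟨t, rfl⟩; exact hmap (hγ t)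
  obtain ⟨κ, hκ, hκY⟩ := hCc.exists_thickening_subset_open hY hCY
  have hYne : Yᶜ.Nonempty := by
    rw [nonempty_compl]
    rintro rfl
    exact NormedSpace.unbounded_univ ℝ ℂ hYb
  have hYcl : IsClosed Yᶜ := hY.isClosed_compl
  set ρ := κ / 2 with hρ
  have hρ0 : 0 < ρ := by positivity
  -- The uniform estimates hold over a closed set `K ⊇ V` inside `Y`, and `Vᶜ` is a closed
  -- thickening of `Yᶜ`, hence still connected.
  set V : Set ℂ := {w | ρ < Metric.infDist w Yᶜ} with hV
  set K : Set ℂ := {w | ρ ≤ Metric.infDist w Yᶜ} with hK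
  have hKcl : IsClosed K := isClosed_le continuous_const (Metric.continuous_infDist_pt _)
  have hKY : K ⊆ Y := by
    intro w hw
    by_contra hwY
    have : Metric.infDist w Yᶜ = 0 := Metric.infDist_zero_of_mem hwY
    simp only [hK, mem_ofPred_eq, this] at hw
    linarith
  have hVK : V ⊆ K := fun w (hw : ρ < _) => show ρ ≤ _ from hw.le
  have hVc : IsPreconnected Vᶜ := by
    have : Vᶜ = {w | Metric.infDist w Yᶜ ≤ ρ} := by ext w; simp [hV]
    rw [this]
    exact isPreconnected_infDist_le hYn hYcl hYne ρ hρ0.le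
  have hCV : ∀ w ∈ C, Metric.ball w ρ ⊆ V := by
    intro w hw v hv
    have h1 : κ ≤ Metric.infDist w Yᶜ := by
      rw [Metric.le_infDist hYne]
      intro y hy
      by_contra hcon
      exact hy (hκY (Metric.mem_thickening_iff.2 ⟨w, hw, by rw [dist_comm]; linarith⟩))
    have h2 := Metric.infDist_le_infDist_add_dist (s := Yᶜ) (x := w) (y := v)
    rw [Metric.mem_ball, dist_comm] at hv
    simp only [hV, mem_ofPred_eq]
    linarith
  obtain ⟨η, hη, r, hr, h1, h2⟩ := exists_uniform_covering hF hA hAb hfr hd hKcl hKY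
  set n := (A ∩ F ⁻¹' {F x₁}).ncard with hn
  have hequiv : ∀ w ∈ Y, Nonempty (Fin n ≃ (A ∩ F ⁻¹' {w} : Set ℂ)) := by
    intro w hw
    have hfin := finite_fibre hF hAb hfr hd hw
    have : Finite (A ∩ F ⁻¹' {w} : Set ℂ) := hfin
    refine ⟨(Finite.equivFinOfCardEq ?_).symm⟩
    rw [Nat.card_coe_set_eq, hn]
    exact ncard_fibre_eq hF hA hAb hY hYc hfr hd hw (hmap hx₁)
  have henum : ∀ w, ∃ e : Fin n → ℂ, w ∈ Y → Function.Injective e ∧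
      range e = A ∩ F ⁻¹' {w} := by
    intro w
    by_cases hw : w ∈ Y
    · obtain ⟨e⟩ := hequiv w hw
      exact ⟨fun i => e i, fun _ => ⟨Subtype.val_injective.comp e.injective, by
        rw [show (fun i => (e i : ℂ)) = Subtype.val ∘ e from rfl, range_comp, e.range_eq_univ,
          image_univ, Subtype.range_coe]⟩⟩
    · exact ⟨fun _ => 0, fun h => absurd h hw⟩
  choose enum henum using henum
  have hmem : ∀ w ∈ Y, ∀ i, enum w i ∈ A ∧ F (enum w i) = w := by
    intro w hw i
    have : enum w i ∈ A ∩ F ⁻¹' {w} := (henum w hw).2 ▸ mem_range_self i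
    exact ⟨this.1, this.2⟩
  have hsurj : ∀ x ∈ A, ∃ i, enum (F x) i = x := by
    intro x hx
    have : x ∈ range (enum (F x)) := by
      rw [(henum _ (hmap hx)).2]; exact ⟨hx, rfl⟩
    exact this
  obtain ⟨lab, ε, hε, hinj, hlab⟩ := TriLattice.exists_label (n := n) hVc
    (hYb.subset (hVK.trans hKY)) hρ0 hr hη hCV enum
    (by
      intro w hw i j hij
      have hwY := hKY (hVK hw)
      refine (henum w hwY).1 (h1 _ (hmem w hwY i).1 ?_ _ ?_ hij)
      · rw [(hmem w hwY i).2]; exact hVK hw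
      · rw [(hmem w hwY i).2, (hmem w hwY j).2])
    (by
      intro w hw w' hw' hww i
      have hwY := hKY (hVK hw)
      obtain ⟨x', hx', hFx', hdx⟩ := h2 _ (hmem w hwY i).1
        (by rw [(hmem w hwY i).2]; exact hVK hw) w' (by rwa [(hmem w hwY i).2])
      obtain ⟨j, hj⟩ := hsurj x' hx'
      rw [hFx'] at hj
      exact ⟨j, by rwa [hj]⟩)
  choose ix hix using fun t => hsurj (γ t) (hγ t)
  -- The label of `γ t` in its fibre does not change with `t`; at both ends the fibre is the same,
  -- and labels are injective on it.
  have hloc : IsLocallyConstant fun t => lab (F (γ t)) (ix t) := by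
    rw [IsLocallyConstant.iff_eventually_eq]
    intro t
    have c1 : ∀ᶠ s in 𝓝 t, dist (γ s) (γ t) < η :=
      γ.continuous.continuousAt (Metric.ball_mem_nhds _ hη)
    have c2 : ∀ᶠ s in 𝓝 t, dist (F (γ s)) (F (γ t)) < ε :=
      (hF.continuous.comp γ.continuous).continuousAt (Metric.ball_mem_nhds _ hε)
    filter_upwards [c1, c2] with s hs1 hs2
    refine hlab _ ⟨s, rfl⟩ _ ⟨t, rfl⟩ hs2 _ _ ?_
    simpa only [Function.comp_apply, hix] using hs1
  have hfin := hloc.apply_eq_of_preconnectedSpace 0 1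
  have e0 := hix 0
  have e1 := hix 1
  simp only [γ.source, γ.target] at hfin e0 e1
  rw [← hx] at hfin e1
  have := hinj (F x₁) ⟨0, by simp⟩ hfin
  rw [← e0, ← e1, this]

end
end ProperMap

/-! ### Basic polynomial dynamics -/

namespace PolyDyn

variable {f : ℂ[X]}

theorem differentiable_toMap (f : ℂ[X]) : Differentiable ℂ (toMap f) := f.differentiable

theorem differentiable_iterate (f : ℂ[X]) (n : ℕ) : Differentiable ℂ (toMap f)^[n] :=
  (differentiable_toMap f).iterate n

theorem deriv_toMap (f : ℂ[X]) (z : ℂ) : deriv (toMap f) z = f.derivative.eval z := f.deriv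

/-- `f` at least doubles the modulus outside the disk of radius `R`. -/
def IsEscapeRadius (f : ℂ[X]) (R : ℝ) : Prop := 1 ≤ R ∧ ∀ z, R ≤ ‖z‖ → 2 * ‖z‖ ≤ ‖toMap f z‖

/-- Write `f = z g + f(0)` with `g` nonconstant, so that `|g|` exceeds `2 + |f(0)|` far out. -/
theorem exists_isEscapeRadius (hd : 2 ≤ f.natDegree) : ∃ R, IsEscapeRadius f R := by
  have hdeg : 0 < f.divX.degree := by
    rw [← natDegree_pos_iff_degree_pos, natDegree_divX_eq_natDegree_tsub_one]
    omega
  have h := f.divX.tendsto_norm_atTop hdeg (tendsto_norm_cobounded_atTop (E := ℂ))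
  have h1 : ∀ᶠ z in Bornology.cobounded ℂ, 2 + ‖f.coeff 0‖ ≤ ‖f.divX.eval z‖ :=
    h.eventually_ge_atTop _
  obtain ⟨R, hR⟩ := (Metric.hasBasis_cobounded_compl_closedBall (0 : ℂ)).eventually_iff.1 h1
  refine ⟨max 1 (R + 1), le_max_left _ _, fun z hz => ?_⟩
  have hz1 : 1 ≤ ‖z‖ := (le_max_left _ _).trans hz
  have hz2 : R + 1 ≤ ‖z‖ := (le_max_right _ _).trans hz
  have h2 := hR.2 (x := z) (by
    rw [mem_compl_iff, mem_closedBall_zero_iff]; linarith)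
  have h3 : toMap f z = f.divX.eval z * z + f.coeff 0 := by
    conv_lhs => rw [toMap, ← f.divX_mul_X_add]
    simp
  rw [h3]
  have h4 := norm_sub_le_norm_add (f.divX.eval z * z) (f.coeff 0)
  rw [norm_mul] at h4
  have := norm_nonneg (f.coeff 0)
  nlinarith

namespace IsEscapeRadius

variable {R : ℝ}

theorem mono (h : IsEscapeRadius f R) {R' : ℝ} (hR : R ≤ R') : IsEscapeRadius f R' :=
  ⟨h.1.trans hR, fun z hz => h.2 z (hR.trans hz)⟩

theorem pow_mul_le (h : IsEscapeRadius f R) {z : ℂ} (hz : R ≤ ‖z‖) (n : ℕ) :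
    2 ^ n * ‖z‖ ≤ ‖(toMap f)^[n] z‖ := by
  induction n with
  | zero => simp
  | succ n ih =>
    rw [Function.iterate_succ_apply']
    have h1 : (1 : ℝ) ≤ 2 ^ n := one_le_pow₀ (by norm_num)
    have h2 : 0 ≤ ‖z‖ := norm_nonneg z
    have := h.2 ((toMap f)^[n] z) (by nlinarith)
    rw [pow_succ]; linarith

theorem le_norm_iterate (h : IsEscapeRadius f R) {z : ℂ} (hz : R ≤ ‖z‖) (n : ℕ) :
    ‖z‖ ≤ ‖(toMap f)^[n] z‖ := by
  have h1 : (1 : ℝ) ≤ 2 ^ n := one_le_pow₀ (by norm_num)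
  have h2 : 0 ≤ ‖z‖ := norm_nonneg z
  have := h.pow_mul_le hz n
  nlinarith

theorem norm_lt_of_iterate (h : IsEscapeRadius f R) {z : ℂ} {n : ℕ}
    (hz : ‖(toMap f)^[n] z‖ < R) : ‖z‖ < R := by
  by_contra! hcon
  linarith [h.le_norm_iterate hcon n]

theorem mem_basin (h : IsEscapeRadius f R) {z : ℂ} (hz : R ≤ ‖z‖) : z ∈ basin f := by
  show Tendsto _ _ _
  rw [← tendsto_norm_atTop_iff_cobounded]
  have h1 : Tendsto (fun n : ℕ => (2 : ℝ) ^ n * ‖z‖) atTop atTop :=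
    (tendsto_pow_atTop_atTop_of_one_lt (by norm_num)).atTop_mul_const (by linarith [h.1])
  exact tendsto_atTop_mono (fun n => h.pow_mul_le hz n) h1

end IsEscapeRadius

theorem iterate_mem_basin_iff {z : ℂ} (n : ℕ) : (toMap f)^[n] z ∈ basin f ↔ z ∈ basin f := by
  show Tendsto (fun k => (toMap f)^[k] ((toMap f)^[n] z)) _ _ ↔ Tendsto _ _ _
  simp only [← Function.iterate_add_apply]
  exact tendsto_add_atTop_iff_nat (f := fun k => (toMap f)^[k] z) n

theorem map_mem_basin_iff {z : ℂ} : toMap f z ∈ basin f ↔ z ∈ basin f :=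
  iterate_mem_basin_iff 1

theorem mem_basin_iff {R : ℝ} (h : IsEscapeRadius f R) {z : ℂ} :
    z ∈ basin f ↔ ∃ n, R < ‖(toMap f)^[n] z‖ := by
  constructor
  · intro hz
    have hz : Tendsto (fun n : ℕ => (toMap f)^[n] z) atTop (Bornology.cobounded ℂ) := hz
    rw [← tendsto_norm_atTop_iff_cobounded] at hz
    exact (hz.eventually_gt_atTop R).exists
  · rintro ⟨n, hn⟩
    exact (iterate_mem_basin_iff n).1 (h.mem_basin hn.le)

theorem isOpen_basin (hd : 2 ≤ f.natDegree) : IsOpen (basin f) := by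
  obtain ⟨R, hR⟩ := exists_isEscapeRadius hd
  have : basin f = ⋃ n : ℕ, {z | R < ‖(toMap f)^[n] z‖} := by
    ext z; rw [mem_basin_iff hR, mem_iUnion]; rfl
  rw [this]
  exact isOpen_iUnion fun n =>
    isOpen_lt continuous_const (differentiable_iterate f n).continuous.norm

theorem norm_iterate_lt_of_notMem_basin {R : ℝ} (h : IsEscapeRadius f R) {z : ℂ}
    (hz : z ∉ basin f) (n : ℕ) : ‖(toMap f)^[n] z‖ < R := by
  by_contra! hcon
  exact hz ((iterate_mem_basin_iff n).1 (h.mem_basin hcon))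

theorem mem_julia_iff (hd : 2 ≤ f.natDegree) {z : ℂ} :
    z ∈ julia f ↔ z ∈ closure (basin f) ∧ z ∉ basin f := by
  rw [julia, filledJulia, frontier_compl, (isOpen_basin hd).frontier_eq]
  rfl

theorem isOpenMap_toMap (hd : 2 ≤ f.natDegree) : IsOpenMap (toMap f) := by
  have h : AnalyticOnNhd ℂ (toMap f) univ := (differentiable_toMap f).differentiableOn.analyticOnNhd
    isOpen_univ
  rcases h.is_constant_or_isOpen isPreconnected_univ with ⟨w, hw⟩ | h
  · obtain ⟨R, hR⟩ := exists_isEscapeRadius hd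
    have h1 := hw (((max R ‖w‖ : ℝ) : ℂ)) trivial
    have h2 : ‖((max R ‖w‖ : ℝ) : ℂ)‖ = max R ‖w‖ := by
      rw [Complex.norm_real, Real.norm_of_nonneg]
      exact (norm_nonneg w).trans (le_max_right _ _)
    have h3 := hR.2 _ (h2.symm ▸ le_max_left R ‖w‖)
    rw [h1, h2] at h3
    have := le_max_right R ‖w‖
    have := le_max_left R ‖w‖
    have := hR.1
    linarith
  · exact fun s hs => h s (subset_univ s) hs

/-- The basin is completely invariant, and taking preimages under a continuous open map commutes
with closure. -/
theorem map_mem_julia_iff (hd : 2 ≤ f.natDegree) {z : ℂ} : toMap f z ∈ julia f ↔ z ∈ julia f := by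
  rw [mem_julia_iff hd, mem_julia_iff hd, map_mem_basin_iff]
  refine and_congr_left fun _ => ?_
  have h1 : basin f = toMap f ⁻¹' basin f := by ext w; exact map_mem_basin_iff.symm
  have := (isOpenMap_toMap hd).preimage_closure_eq_closure_preimage
    (differentiable_toMap f).continuous (basin f)
  rw [← h1] at this
  exact Set.ext_iff.1 this z

theorem iterate_mem_julia_iff (hd : 2 ≤ f.natDegree) {z : ℂ} (n : ℕ) :
    (toMap f)^[n] z ∈ julia f ↔ z ∈ julia f := by
  induction n with
  | zero => rfl
  | succ n ih => rw [Function.iterate_succ_apply', map_mem_julia_iff hd, ih]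

theorem isCompact_julia (hd : 2 ≤ f.natDegree) : IsCompact (julia f) := by
  obtain ⟨R, hR⟩ := exists_isEscapeRadius hd
  refine Metric.isCompact_of_isClosed_isBounded isClosed_frontier
    ((Metric.isBounded_ball (x := (0 : ℂ)) (r := R)).subset fun z hz => ?_)
  rw [mem_ball_zero_iff]
  exact norm_iterate_lt_of_notMem_basin hR ((mem_julia_iff hd).1 hz).2 0

/-- The return map sends a small ball around `p` into itself, so no orbit starting there escapes. -/
theorem notMem_closure_basin_of_attracting {p : ℂ} (hp : IsAttractingPeriodic f p) :
    p ∉ closure (basin f) := by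
  obtain ⟨hper, hmul⟩ := hp
  set k := Function.minimalPeriod (toMap f) p with hk
  have hk0 : 0 < k := Function.minimalPeriod_pos_of_mem_periodicPts hper
  set g := (toMap f)^[k] with hg
  have hgp : g p = p := Function.iterate_minimalPeriod
  have hder : HasDerivAt g (multiplier f p) p := (differentiable_iterate f k p).hasDerivAt
  have h1 := hder.isLittleO.def (c := 1 - ‖multiplier f p‖) (by linarith)
  obtain ⟨ε, hε, hball⟩ := Metric.eventually_nhds_iff_ball.1 h1
  have h2 : MapsTo g (Metric.ball p ε) (Metric.ball p ε) := by
    intro w hw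
    have h3 := hball w hw
    rw [hgp] at h3
    rw [mem_ball_iff_norm] at hw ⊢
    have h4 : g w - p = (g w - p - (w - p) • multiplier f p) + (w - p) • multiplier f p := by ring
    rw [h4]
    refine (norm_add_le _ _).trans_lt ?_
    rw [norm_smul]
    nlinarith [norm_nonneg (w - p)]
  intro hcl
  obtain ⟨w, hw, hwb⟩ := mem_closure_iff_nhds.1 hcl _ (Metric.ball_mem_nhds p hε)
  have hwb : Tendsto (fun n : ℕ => (toMap f)^[n] w) atTop (Bornology.cobounded ℂ) := hwb
  have h5 : Tendsto (fun n : ℕ => g^[n] w) atTop (Bornology.cobounded ℂ) := by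
    have := hwb.comp (tendsto_id.const_mul_atTop' hk0)
    refine this.congr fun n => ?_
    simp [hg, ← Function.iterate_mul]
  obtain ⟨n, hn⟩ := (h5.eventually (Bornology.isBounded_def.1 (Metric.isBounded_ball (x := p)
    (r := ε)))).exists
  exact hn (h2.iterate n hw)

/-- A critical orbit in the Julia set stays in the closure of the basin, but hyperbolicity would
drive it to an attracting point, which is not in that closure. -/
theorem critical_iterate_notMem_julia (hd : 2 ≤ f.natDegree) (hhyp : IsHyperbolic f) {c : ℂ}
    (hc : c ∈ critSet f) (n : ℕ) : (toMap f)^[n] c ∉ julia f := by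
  rw [iterate_mem_julia_iff hd, mem_julia_iff hd]
  rintro ⟨h1, h2⟩
  rcases hhyp c hc with h | ⟨p, hp, hlim⟩
  · exact h2 h
  · have h3 : (closure (basin f))ᶜ ∈ 𝓝 p :=
      isClosed_closure.isOpen_compl.mem_nhds (notMem_closure_basin_of_attracting hp)
    obtain ⟨m, hm⟩ := (hlim.eventually_mem h3).exists
    apply hm
    have h4 : c ∈ julia f := (mem_julia_iff hd).2 ⟨h1, h2⟩
    rw [← iterate_mem_julia_iff hd (m * Function.minimalPeriod (toMap f) p)] at h4
    exact ((mem_julia_iff hd).1 h4).1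

/-- Finiteness of the postcritical set makes the closure in its definition superfluous. -/
theorem disjoint_postcrit_julia (hd : 2 ≤ f.natDegree) (hhyp : IsHyperbolic f)
    (hpcf : IsPostcriticallyFinite f) : Disjoint (julia f) (postcrit f) := by
  have hcl : postcrit f = {w | ∃ c ∈ critSet f, ∃ n : ℕ, 1 ≤ n ∧ w = (toMap f)^[n] c} :=
    (hpcf.subset subset_closure).isClosed.closure_eq
  rw [disjoint_right, hcl]
  rintro _ ⟨c, hc, n, -, rfl⟩
  exact critical_iterate_notMem_julia hd hhyp hc n

theorem iterate_mem_postcrit {c : ℂ} (hc : c ∈ critSet f) {n : ℕ} (hn : 1 ≤ n) :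
    (toMap f)^[n] c ∈ postcrit f := subset_closure ⟨c, hc, n, hn, rfl⟩

theorem deriv_iterate_succ (f : ℂ[X]) (n : ℕ) (z : ℂ) :
    deriv (toMap f)^[n + 1] z = deriv (toMap f)^[n] (toMap f z) * deriv (toMap f) z := by
  rw [Function.iterate_succ]
  exact deriv_comp z (differentiable_iterate f n _) (differentiable_toMap f z)

theorem exists_critical_of_deriv_iterate_eq_zero {n : ℕ} {z : ℂ}
    (h : deriv (toMap f)^[n] z = 0) : ∃ i < n, (toMap f)^[i] z ∈ critSet f := by
  induction n generalizing z with
  | zero => simp at h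
  | succ n ih =>
    rw [deriv_iterate_succ, mul_eq_zero] at h
    rcases h with h | h
    · obtain ⟨i, hi, hic⟩ := ih h
      exact ⟨i + 1, by omega, by rwa [Function.iterate_succ_apply]⟩
    · exact ⟨0, by omega, by rw [deriv_toMap] at h; exact h⟩

/-- Critical values of iterates are postcritical. -/
theorem iterate_mem_postcrit_of_deriv_eq_zero {n : ℕ} {z : ℂ}
    (h : deriv (toMap f)^[n] z = 0) : (toMap f)^[n] z ∈ postcrit f := by
  obtain ⟨i, hi, hic⟩ := exists_critical_of_deriv_iterate_eq_zero h
  have := iterate_mem_postcrit hic (n := n - i) (by omega)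
  rwa [← Function.iterate_add_apply, Nat.sub_add_cancel hi.le] at this

end PolyDyn

/-! ### Inverse branches over disks and a covering estimate -/

namespace ProperMap

/-- The frontier of a component of an open set is disjoint from the open set. -/
theorem notMem_of_mem_frontier_component {U : Set ℂ} (hU : IsOpen U) {a x : ℂ}
    (hx : x ∈ frontier (connectedComponentIn U a)) : x ∉ U := by
  intro hxU
  have h1 : connectedComponentIn U x ∈ 𝓝 x :=
    hU.connectedComponentIn.mem_nhds (mem_connectedComponentIn hxU)
  obtain ⟨y, hy1, hy2⟩ := mem_closure_iff_nhds.1 hx.1 _ h1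
  have h2 := (connectedComponentIn_eq hy1).trans (connectedComponentIn_eq hy2).symm
  apply hx.2
  rw [hU.connectedComponentIn.interior_eq, ← h2]
  exact mem_connectedComponentIn hxU

theorem isPreconnected_compl_ball (y : ℂ) (r : ℝ) :
    IsPreconnected (Metric.ball y r)ᶜ := by
  have h : (Metric.ball y r)ᶜ =
      (fun p : ℝ × ℝ => y + p.1 * Complex.exp (p.2 * Complex.I)) '' (Ici r ×ˢ univ) := by
    ext w
    constructor
    · intro hw
      rw [mem_compl_iff, Metric.mem_ball, not_lt, dist_eq_norm] at hw
      exact ⟨(‖w - y‖, (w - y).arg), ⟨hw, trivial⟩, by simp [Complex.norm_mul_exp_arg_mul_I]⟩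
    · rintro ⟨⟨t, θ⟩, ⟨ht, -⟩, rfl⟩
      rw [mem_Ici] at ht
      rw [mem_compl_iff, Metric.mem_ball, not_lt, dist_eq_norm, add_sub_cancel_left, norm_mul,
        Complex.norm_exp_ofReal_mul_I, mul_one, Complex.norm_real]
      exact ht.trans (le_abs_self t)
  rw [h]
  exact (isPreconnected_Ici.prod isPreconnected_univ).image _ (by fun_prop)

/-- Over a disk without critical values, an entire map with bounded preimages of disks has
holomorphic inverse branches. -/
theorem exists_inverse_branch {F : ℂ → ℂ} (hF : Differentiable ℂ F) {x : ℂ} {r : ℝ} (hr : 0 < r)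
    (hb : Bornology.IsBounded (F ⁻¹' Metric.ball (F x) r))
    (hd : ∀ z, F z ∈ Metric.ball (F x) r → deriv F z ≠ 0) :
    ∃ g : ℂ → ℂ, DifferentiableOn ℂ g (Metric.ball (F x) r) ∧ g (F x) = x ∧
      ∀ w ∈ Metric.ball (F x) r, F (g w) = w ∧ deriv g w = (deriv F (g w))⁻¹ := by
  set B := Metric.ball (F x) r with hB
  have hBo : IsOpen B := Metric.isOpen_ball
  have hU : IsOpen (F ⁻¹' B) := hBo.preimage hF.continuous
  set A := connectedComponentIn (F ⁻¹' B) x with hA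
  have hxA : x ∈ A := mem_connectedComponentIn (Metric.mem_ball_self hr)
  have hAo : IsOpen A := hU.connectedComponentIn
  have hAc : IsPreconnected A := isPreconnected_connectedComponentIn
  have hAU : A ⊆ F ⁻¹' B := connectedComponentIn_subset _ _
  have hAb : Bornology.IsBounded A := hb.subset hAU
  have hfr : ∀ z ∈ frontier A, F z ∉ B := fun z hz => notMem_of_mem_frontier_component hU hz
  have hdA : ∀ z ∈ A, deriv F z ≠ 0 := fun z hz => hd z (hAU hz)
  have hBc : IsPreconnected B := (convex_ball _ _).isPreconnected
  have hinj : InjOn F A := injOn hF hAo hAc hAb hBo hBc Metric.isBounded_ball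
    (isPreconnected_compl_ball _ _) hAU hfr hdA
  -- The number of preimages in `A` is constant over the disk, and positive over its center.
  have hsurj : SurjOn F A B := by
    intro w hw
    have h1 := ncard_fibre_eq hF hAo hAb hBo hBc hfr hdA (Metric.mem_ball_self hr) hw
    have h2 : 0 < (A ∩ F ⁻¹' {F x}).ncard :=
      (ncard_pos (finite_fibre hF hAb hfr hdA (Metric.mem_ball_self hr))).2 ⟨x, hxA, rfl⟩
    rw [h1] at h2
    obtain ⟨z, hz, hzw⟩ := nonempty_of_ncard_ne_zero h2.ne'
    exact ⟨z, hz, hzw⟩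
  set g := Function.invFunOn F A with hg
  have hgA : ∀ w ∈ B, g w ∈ A := fun w hw => Function.invFunOn_mem (hsurj hw)
  have hFg : ∀ w ∈ B, F (g w) = w := fun w hw => Function.invFunOn_eq (hsurj hw)
  have hgF : ∀ z ∈ A, g (F z) = z := fun z hz => hinj.leftInvOn_invFunOn hz
  have hder : ∀ w ∈ B, HasDerivAt g (deriv F (g w))⁻¹ w := by
    intro w hw
    refine HasDerivAt.of_local_left_inverse ?_ (hF (g w)).hasDerivAt (hdA _ (hgA w hw))
      (by filter_upwards [hBo.mem_nhds hw] with v hv using hFg v hv)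
    intro N hN
    have h1 : F '' (A ∩ N) ∈ 𝓝 (F (g w)) := by
      rw [← (hasStrictDerivAt hF (g w)).map_nhds_eq (hdA _ (hgA w hw))]
      exact image_mem_map (inter_mem (hAo.mem_nhds (hgA w hw)) hN)
    rw [hFg w hw] at h1
    refine Filter.mem_map.2 (mem_of_superset h1 ?_)
    rintro _ ⟨z, ⟨hzA, hzN⟩, rfl⟩
    rw [mem_preimage, hgF z hzA]
    exact hzN
  exact ⟨g, fun w hw => (hder w hw).differentiableAt.differentiableWithinAt, hgF x hxA,
    fun w hw => ⟨hFg w hw, (hder w hw).deriv⟩⟩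

/-- A bounded holomorphic function on a disk whose derivative at the center is not small covers a
disk of definite radius. -/
theorem exists_ball_subset_image {r M : ℝ} (hr : 0 < r) (hM : 0 ≤ M) :
    ∃ ρ > 0, ∀ (g : ℂ → ℂ) (y : ℂ), DifferentiableOn ℂ g (Metric.ball y r) →
      (∀ w ∈ Metric.ball y r, ‖g w‖ ≤ M) → 1 / 2 ≤ ‖deriv g y‖ →
      Metric.ball (g y) ρ ⊆ g '' Metric.ball y r := by
  -- `B` bounds the slopes `(g w - g y) / (w - y)` by the Schwarz lemma; `s` is so small that at
  -- distance `s` the slope differs from `g'(y)` by at most `1 / 4`.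
  set B := 2 * M / r with hB
  have hB0 : 0 ≤ B := by positivity
  set s := r / (8 * B + 8) with hs
  have hs0 : 0 < s := by positivity
  have hsr : s < r := by
    rw [hs, div_lt_iff₀ (by positivity)]
    nlinarith
  -- On the circle of radius `s` the slope is at least `1 / 2 - 1 / 4`, so `g` stays `s / 4` away
  -- from `g y`; the quantitative open mapping theorem yields half of this radius.
  refine ⟨s / 4 / 2, by positivity, fun g y hg hbd hder => ?_⟩
  have hy : y ∈ Metric.ball y r := Metric.mem_ball_self hr
  have hmaps : MapsTo g (Metric.ball y r) (Metric.closedBall (g y) (2 * M)) := by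
    intro w hw
    rw [mem_closedBall_iff_norm]
    have := norm_sub_le (g w) (g y)
    linarith [hbd w hw, hbd y hy]
  have hq : ∀ w ∈ Metric.ball y r, ‖dslope g y w‖ ≤ B := fun w hw =>
    Complex.norm_dslope_le_div_of_mapsTo_ball hg hmaps hw
  have hqd : DifferentiableOn ℂ (dslope g y) (Metric.ball y r) :=
    (Complex.differentiableOn_dslope (Metric.ball_mem_nhds y hr)).2 hg
  have hqm : MapsTo (dslope g y) (Metric.ball y r)
      (Metric.closedBall (dslope g y y) (2 * B)) := by
    intro w hw
    rw [mem_closedBall_iff_norm]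
    have := norm_sub_le (dslope g y w) (dslope g y y)
    linarith [hq w hw, hq y hy]
  have hsub : Metric.closedBall y s ⊆ Metric.ball y r := Metric.closedBall_subset_ball hsr
  have hdiff : DiffContOnCl ℂ g (Metric.ball y s) := by
    refine DifferentiableOn.diffContOnCl ?_
    rw [closure_ball y hs0.ne']
    exact hg.mono hsub
  refine (hdiff.ball_subset_image_closedBall (ε := s / 4) hs0 ?_ ?_).trans (image_mono hsub)
  · intro w hw
    have hw' : w ∈ Metric.ball y r := hsub (Metric.sphere_subset_closedBall hw)
    have h1 := Complex.dist_le_div_mul_dist_of_mapsTo_ball hqd hqm hw'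
    rw [Metric.mem_sphere] at hw
    rw [hw, dslope_same, dist_eq_norm] at h1
    have h2 : 2 * B / r * s ≤ 1 / 4 := by
      have : 2 * B / r * s = 2 * B / (8 * B + 8) := by rw [hs]; field_simp
      rw [this, div_le_iff₀ (by positivity)]
      linarith
    have h3 : 1 / 4 ≤ ‖dslope g y w‖ := by
      have := norm_sub_norm_le (deriv g y) (dslope g y w)
      rw [norm_sub_rev] at this
      linarith
    have h4 : g w - g y = (w - y) • dslope g y w := (sub_smul_dslope g y w).symm
    rw [h4, norm_smul, ← dist_eq_norm, hw]
    nlinarith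
  · have h1 : HasDerivAt g (deriv g y) y :=
      (hg.differentiableAt (Metric.ball_mem_nhds y hr)).hasDerivAt
    have h2 : deriv g y ≠ 0 := by
      intro h; rw [h, norm_zero] at hder; norm_num at hder
    exact (h1.eventually_ne h2).frequently.filter_mono nhdsWithin_le_nhds

end ProperMap

/-! ### Expansion on the Julia set -/

namespace PolyDyn

/-- For a postcritically finite hyperbolic polynomial, some iterate is expanding on the Julia
set. -/
theorem exists_expanding_iterate {f : ℂ[X]} (hd : 2 ≤ f.natDegree) (hhyp : IsHyperbolic f)
    (hpcf : IsPostcriticallyFinite f) :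
    ∃ m : ℕ, 1 ≤ m ∧ ∀ x ∈ julia f, 2 ≤ ‖deriv (toMap f)^[m] x‖ := by
  obtain ⟨R, hR⟩ := exists_isEscapeRadius hd
  have hJc := isCompact_julia hd
  obtain ⟨r₀, hr₀, hdisj⟩ := (disjoint_postcrit_julia hd hhyp hpcf).exists_thickenings hJc
    hpcf.isClosed
  set r := min r₀ 1 with hrdef
  have hr : 0 < r := lt_min hr₀ one_pos
  have hR' : IsEscapeRadius f (R + 1) := hR.mono (by linarith)
  obtain ⟨ρ, hρ, hcov⟩ := ProperMap.exists_ball_subset_image (r := r) (M := R + 1) hr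
    (by linarith [hR.1])
  obtain ⟨t, htJ, htc⟩ := hJc.elim_nhds_subcover (fun a => Metric.ball a (ρ / 2))
    (fun a _ => Metric.ball_mem_nhds a (by positivity))
  -- Every disk of radius `ρ` centered in the Julia set contains one of these finitely many escaping
  -- points, so a single time `m` serves for all of them.
  have hb : ∀ a ∈ t, ∃ b ∈ basin f, dist b a < ρ / 2 := by
    intro a ha
    obtain ⟨b, hb, hab⟩ := Metric.mem_closure_iff.1 ((mem_julia_iff hd).1 (htJ a ha)).1 (ρ / 2)
      (by positivity)
    exact ⟨b, hb, by rwa [dist_comm]⟩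
  choose! b hbb hba using hb
  have hev : ∀ᶠ n : ℕ in atTop, ∀ a ∈ t, R + 1 ≤ ‖(toMap f)^[n] (b a)‖ := by
    rw [Filter.eventually_all_finset]
    intro a ha
    have : Tendsto (fun n : ℕ => (toMap f)^[n] (b a)) atTop (Bornology.cobounded ℂ) := hbb a ha
    rw [← tendsto_norm_atTop_iff_cobounded] at this
    exact this.eventually_ge_atTop _
  obtain ⟨m, hm, hm1⟩ := (hev.and (eventually_ge_atTop 1)).exists
  refine ⟨m, hm1, fun x hx => ?_⟩
  set F := (toMap f)^[m] with hF
  have hFd : Differentiable ℂ F := differentiable_iterate f m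
  have hFx : F x ∈ julia f := (iterate_mem_julia_iff hd m).2 hx
  have hball : Metric.ball (F x) r ⊆ Metric.ball 0 (R + 1) := by
    intro w hw
    have h1 := norm_iterate_lt_of_notMem_basin hR ((mem_julia_iff hd).1 hx).2 m
    rw [mem_ball_iff_norm] at hw
    rw [mem_ball_zero_iff]
    have h2 := norm_le_norm_add_norm_sub (F x) w
    have h3 : r ≤ 1 := min_le_right _ _
    rw [norm_sub_rev] at h2
    have h1 : ‖F x‖ < R := h1
    linarith
  have hnorm : ∀ z, F z ∈ Metric.ball (F x) r → ‖z‖ < R + 1 := by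
    intro z hz
    have := hball hz
    rw [mem_ball_zero_iff] at this
    exact hR'.norm_lt_of_iterate this
  have hcrit : ∀ z, F z ∈ Metric.ball (F x) r → deriv F z ≠ 0 := by
    intro z hz h0
    have h1 : F z ∈ postcrit f := iterate_mem_postcrit_of_deriv_eq_zero h0
    refine disjoint_left.1 hdisj (Metric.mem_thickening_iff.2 ⟨F x, hFx, ?_⟩)
      (Metric.self_subset_thickening hr₀ _ h1)
    exact (Metric.mem_ball.1 hz).trans_le (min_le_left _ _)
  obtain ⟨g, hg, hgx, hgF⟩ := ProperMap.exists_inverse_branch hFd hr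
    ((Metric.isBounded_ball (x := (0 : ℂ)) (r := R + 1)).subset fun z hz =>
      mem_ball_zero_iff.2 (hnorm z hz)) hcrit
  -- A derivative below `2` at `x` makes the inverse branch at `F x` cover the disk of radius `ρ`
  -- about `x`. Some `b a` in it would then be mapped by `F` into the disk of radius `R + 1`, though
  -- it has already left it.
  by_contra! hcon
  have hx0 : F x ∈ Metric.ball (F x) r := Metric.mem_ball_self hr
  have hder : 1 / 2 ≤ ‖deriv g (F x)‖ := by
    rw [(hgF _ hx0).2, hgx, norm_inv, one_div]
    exact inv_anti₀ (norm_pos_iff.2 (hcrit x hx0)) hcon.le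
  have hsub := hcov g (F x) hg (fun w hw => (hnorm _ (by rwa [(hgF w hw).1])).le) hder
  rw [hgx] at hsub
  obtain ⟨a, ha, hxa⟩ := mem_iUnion₂.1 (htc hx)
  obtain ⟨w, hw, hwb⟩ := hsub (show b a ∈ Metric.ball x ρ by
    rw [Metric.mem_ball] at hxa ⊢
    have := dist_triangle_right (b a) x a
    linarith [hba a ha])
  have h1 := hm a ha
  rw [← hwb] at h1
  have h2 := hball hw
  rw [← (hgF w hw).1, mem_ball_zero_iff] at h2
  linarith

end PolyDyn

/-! ### The Böttcher map and its inverse -/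

/-- The inverse of an injective holomorphic function on an open set is holomorphic on an open
set. -/
theorem isOpen_image_and_differentiableOn_invFunOn {φ : ℂ → ℂ} {U : Set ℂ} (hU : IsOpen U)
    (hφ : DifferentiableOn ℂ φ U) (hinj : InjOn φ U) :
    IsOpen (φ '' U) ∧ DifferentiableOn ℂ (Function.invFunOn φ U) (φ '' U) := by
  have han : AnalyticOnNhd ℂ φ U := hφ.analyticOnNhd hU
  have hnc : ∀ z ∈ U, ¬ ∀ᶠ v in 𝓝 z, φ v = φ z := by
    intro z hz hcon
    have h1 : ∀ᶠ v in 𝓝[≠] z, φ v = φ z ∧ v ∈ U :=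
      ((hcon.and (hU.mem_nhds hz)).filter_mono nhdsWithin_le_nhds)
    obtain ⟨v, ⟨hv, hvU⟩, hvz⟩ := (h1.and self_mem_nhdsWithin).exists
    exact hvz (hinj hvU hz hv)
  have hopen : ∀ z ∈ U, ∀ N ∈ 𝓝 z, φ '' (U ∩ N) ∈ 𝓝 (φ z) := by
    intro z hz N hN
    rcases (han z hz).eventually_constant_or_nhds_le_map_nhds with h | h
    · exact absurd h (hnc z hz)
    · exact h (image_mem_map (inter_mem (hU.mem_nhds hz) hN))
  have himg : IsOpen (φ '' U) := by
    rw [isOpen_iff_mem_nhds]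
    rintro _ ⟨z, hz, rfl⟩
    simpa using hopen z hz univ univ_mem
  set ψ := Function.invFunOn φ U
  have hψφ : ∀ z ∈ U, ψ (φ z) = z := fun z hz => hinj.leftInvOn_invFunOn hz
  have hcont : ∀ z ∈ U, ContinuousAt ψ (φ z) := by
    intro z hz N hN
    rw [hψφ z hz] at hN
    refine Filter.mem_map.2 (mem_of_superset (hopen z hz N hN) ?_)
    rintro _ ⟨v, ⟨hvU, hvN⟩, rfl⟩
    rw [mem_preimage, hψφ v hvU]
    exact hvN
  have hdiff : ∀ z ∈ U, deriv φ z ≠ 0 → DifferentiableAt ℂ ψ (φ z) := by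
    intro z hz hz0
    have h1 : HasDerivAt φ (deriv φ z) (ψ (φ z)) := by
      rw [hψφ z hz]; exact (hφ.differentiableAt (hU.mem_nhds hz)).hasDerivAt
    refine (HasDerivAt.of_local_left_inverse (hcont z hz) h1 hz0 ?_).differentiableAt
    filter_upwards [himg.mem_nhds ⟨z, hz, rfl⟩]
    rintro _ ⟨v, hv, rfl⟩
    rw [hψφ v hv]
  refine ⟨himg, ?_⟩
  rintro _ ⟨z, hz, rfl⟩
  -- Zeros of the derivative are isolated, so near `φ z` the inverse is holomorphic except possibly
  -- at `φ z`; being continuous there, it has a removable singularity.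
  have hev : ∀ᶠ v in 𝓝[≠] z, deriv φ v ≠ 0 := by
    rcases (han z hz).deriv.eventually_eq_zero_or_eventually_ne_zero with h | h
    · exfalso
      apply hnc z hz
      obtain ⟨r, hr, hball⟩ := Metric.mem_nhds_iff.1 (h.and (hU.mem_nhds hz))
      filter_upwards [Metric.ball_mem_nhds z hr] with v hv
      refine (convex_ball z r).is_const_of_fderivWithin_eq_zero (𝕜 := ℂ)
        (hφ.mono fun x hx => (hball hx).2) ?_ hv (Metric.mem_ball_self hr)
      intro x hx
      have hx' := hball hx
      rw [fderivWithin_of_isOpen Metric.isOpen_ball hx]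
      ext
      simpa using hx'.1
    · exact h
  have hev' : ∀ᶠ w in 𝓝[≠] (φ z), DifferentiableAt ℂ ψ w := by
    have h1 : Tendsto ψ (𝓝[≠] (φ z)) (𝓝[≠] z) := by
      refine tendsto_nhdsWithin_iff.2 ⟨?_, ?_⟩
      · have := (hcont z hz).tendsto
        rw [hψφ z hz] at this
        exact this.mono_left nhdsWithin_le_nhds
      · filter_upwards [mem_nhdsWithin_of_mem_nhds (himg.mem_nhds ⟨z, hz, rfl⟩),
          self_mem_nhdsWithin]
        rintro _ ⟨v, hv, rfl⟩ hne
        rw [hψφ v hv]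
        rintro rfl
        exact hne rfl
    filter_upwards [h1.eventually hev,
      mem_nhdsWithin_of_mem_nhds (himg.mem_nhds ⟨z, hz, rfl⟩)]
    rintro _ h2 ⟨v, hv, rfl⟩
    rw [hψφ v hv] at h2
    exact hdiff v hv h2
  have hpt : DifferentiableAt ℂ ψ (φ z) := by
    obtain ⟨t, htd, hto, hzt⟩ : ∃ t ⊆ {w | w ≠ φ z → DifferentiableAt ℂ ψ w}, IsOpen t ∧ φ z ∈ t :=
      mem_nhds_iff.1 (eventually_nhdsWithin_iff.1 hev')
    have htn : t ∈ 𝓝 (φ z) := hto.mem_nhds hzt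
    refine ((Complex.differentiableOn_compl_singleton_and_continuousAt_iff htn).1
      ⟨fun w hw => ?_, hcont z hz⟩).differentiableAt htn
    exact (htd hw.1 hw.2).differentiableWithinAt
  exact hpt.differentiableWithinAt

namespace PolyDyn

/-- The inverse of a Böttcher map in the coordinate `exp` of the exterior of the unit disk. -/
noncomputable def Psi (f : ℂ[X]) (φ : ℂ → ℂ) (ζ : ℂ) : ℂ :=
  Function.invFunOn φ (basin f) (Complex.exp ζ)

namespace IsBottcherMap

variable {f : ℂ[X]} {φ : ℂ → ℂ}

theorem exp_mem (_h : IsBottcherMap f φ) {ζ : ℂ} (hζ : 0 < ζ.re) :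
    Complex.exp ζ ∈ {w : ℂ | 1 < ‖w‖} := by
  show 1 < ‖Complex.exp ζ‖
  rw [Complex.norm_exp]
  exact Real.one_lt_exp_iff.2 hζ

theorem Psi_mem (h : IsBottcherMap f φ) {ζ : ℂ} (hζ : 0 < ζ.re) : Psi f φ ζ ∈ basin f :=
  Function.invFunOn_mem (h.bijOn.surjOn (h.exp_mem hζ))

theorem map_Psi (h : IsBottcherMap f φ) {ζ : ℂ} (hζ : 0 < ζ.re) :
    φ (Psi f φ ζ) = Complex.exp ζ :=
  Function.invFunOn_eq (h.bijOn.surjOn (h.exp_mem hζ))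

theorem one_lt_norm (h : IsBottcherMap f φ) {z : ℂ} (hz : z ∈ basin f) : 1 < ‖φ z‖ :=
  h.bijOn.mapsTo hz

theorem eq_of_map_eq (h : IsBottcherMap f φ) {z w : ℂ} (hz : z ∈ basin f) (hw : w ∈ basin f)
    (hzw : φ z = φ w) : z = w := h.bijOn.injOn hz hw hzw

theorem exists_Psi_eq (h : IsBottcherMap f φ) {z : ℂ} (hz : z ∈ basin f) :
    ∃ ζ : ℂ, 0 < ζ.re ∧ Psi f φ ζ = z := by
  have h1 := h.one_lt_norm hz
  have h0 : φ z ≠ 0 := by intro h0; rw [h0, norm_zero] at h1; linarith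
  have hre : 0 < (Complex.log (φ z)).re := by
    rw [Complex.log_re]; exact Real.log_pos h1
  refine ⟨Complex.log (φ z), hre, h.eq_of_map_eq (h.Psi_mem hre) hz ?_⟩
  rw [h.map_Psi hre, Complex.exp_log h0]

theorem exp_eq_of_Psi_eq (h : IsBottcherMap f φ) {ζ ζ' : ℂ} (hζ : 0 < ζ.re) (hζ' : 0 < ζ'.re)
    (he : Psi f φ ζ = Psi f φ ζ') : Complex.exp ζ = Complex.exp ζ' := by
  rw [← h.map_Psi hζ, ← h.map_Psi hζ', he]

theorem toMap_Psi (h : IsBottcherMap f φ) (hd : 2 ≤ f.natDegree) {ζ : ℂ} (hζ : 0 < ζ.re) :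
    toMap f (Psi f φ ζ) = Psi f φ (f.natDegree * ζ) := by
  have hre : 0 < ((f.natDegree : ℂ) * ζ).re := by
    rw [← Complex.ofReal_natCast, Complex.re_ofReal_mul]
    have : (0 : ℝ) < f.natDegree := by exact_mod_cast (by omega : 0 < f.natDegree)
    positivity
  refine h.eq_of_map_eq (map_mem_basin_iff.2 (h.Psi_mem hζ)) (h.Psi_mem hre) ?_
  rw [h.conj _ (h.Psi_mem hζ), h.map_Psi hζ, h.map_Psi hre, ← Complex.exp_nat_mul]

theorem re_pow_mul_pos (hd : 2 ≤ f.natDegree) {ζ : ℂ} (hζ : 0 < ζ.re) (n : ℕ) :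
    0 < ((f.natDegree : ℂ) ^ n * ζ).re := by
  rw [← Complex.ofReal_natCast, ← Complex.ofReal_pow, Complex.re_ofReal_mul]
  have : (0 : ℝ) < f.natDegree := by exact_mod_cast (by omega : 0 < f.natDegree)
  positivity

theorem iterate_Psi (h : IsBottcherMap f φ) (hd : 2 ≤ f.natDegree) {ζ : ℂ} (hζ : 0 < ζ.re)
    (n : ℕ) : (toMap f)^[n] (Psi f φ ζ) = Psi f φ ((f.natDegree : ℂ) ^ n * ζ) := by
  induction n with
  | zero => simp
  | succ n ih =>
    rw [Function.iterate_succ_apply', ih, h.toMap_Psi hd (re_pow_mul_pos hd hζ n), pow_succ']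
    ring_nf

theorem differentiableOn_Psi (h : IsBottcherMap f φ) (hd : 2 ≤ f.natDegree) :
    DifferentiableOn ℂ (Psi f φ) {ζ | 0 < ζ.re} := by
  have h1 := (isOpen_image_and_differentiableOn_invFunOn (isOpen_basin hd) h.differentiableOn
    h.bijOn.injOn).2
  rw [h.bijOn.image_eq] at h1
  exact h1.comp Complex.differentiable_exp.differentiableOn fun ζ hζ => h.exp_mem hζ

theorem isOpen_re_pos : IsOpen {ζ : ℂ | 0 < ζ.re} :=
  isOpen_lt continuous_const Complex.continuous_re

theorem differentiableAt_Psi (h : IsBottcherMap f φ) (hd : 2 ≤ f.natDegree) {ζ : ℂ}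
    (hζ : 0 < ζ.re) : DifferentiableAt ℂ (Psi f φ) ζ :=
  (h.differentiableOn_Psi hd).differentiableAt (isOpen_re_pos.mem_nhds hζ)

theorem image_Psi (h : IsBottcherMap f φ) : Psi f φ '' {ζ | 0 < ζ.re} = basin f := by
  ext z
  constructor
  · rintro ⟨ζ, hζ, rfl⟩; exact h.Psi_mem hζ
  · intro hz
    obtain ⟨ζ, hζ, rfl⟩ := h.exists_Psi_eq hz
    exact ⟨ζ, hζ, rfl⟩

theorem isPreconnected_basin (h : IsBottcherMap f φ) (hd : 2 ≤ f.natDegree) :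
    IsPreconnected (basin f) := by
  rw [← h.image_Psi]
  exact (convex_halfSpace_re_gt 0).isPreconnected.image _ (h.differentiableOn_Psi hd).continuousOn

theorem map_iterate (h : IsBottcherMap f φ) {z : ℂ} (hz : z ∈ basin f) (n : ℕ) :
    φ ((toMap f)^[n] z) = φ z ^ f.natDegree ^ n := by
  induction n with
  | zero => simp
  | succ n ih =>
    rw [Function.iterate_succ_apply', h.conj _ ((iterate_mem_basin_iff n).2 hz), ih, ← pow_mul,
      pow_succ]

/-- Near `1`, the map `v ↦ v ^ d` is repelling. -/
theorem eq_one_of_pow_near {d : ℕ} (hd : 2 ≤ d) :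
    ∃ c > 0, ∀ v : ℂ, (∀ n : ℕ, ‖v ^ d ^ n - 1‖ < c) → v = 1 := by
  have hcont : Continuous fun v : ℂ => ‖∑ k ∈ Finset.range d, v ^ k‖ := by fun_prop
  have h1 : (3 / 2 : ℝ) < ‖∑ k ∈ Finset.range d, (1 : ℂ) ^ k‖ := by
    simp only [one_pow, Finset.sum_const, Finset.card_range, nsmul_eq_mul, mul_one,
      Complex.norm_natCast]
    have : (2 : ℝ) ≤ d := by exact_mod_cast hd
    linarith
  -- `v ^ d - 1` is `v - 1` times the geometric sum, which equals `d ≥ 2` at `v = 1`; so each power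
  -- step near `1` expands the distance to `1` by `3 / 2`.
  obtain ⟨c, hc, hball⟩ := Metric.eventually_nhds_iff.1
    (hcont.continuousAt.eventually (lt_mem_nhds h1))
  refine ⟨c, hc, fun v hv => ?_⟩
  have hgrow : ∀ n : ℕ, (3 / 2 : ℝ) ^ n * ‖v - 1‖ ≤ ‖v ^ d ^ n - 1‖ := by
    intro n
    induction n with
    | zero => simp
    | succ n ih =>
      have h2 := hball (show dist (v ^ d ^ n) 1 < c by rw [dist_eq_norm]; exact hv n)
      have h3 : v ^ d ^ (n + 1) - 1 =
          (∑ k ∈ Finset.range d, (v ^ d ^ n) ^ k) * (v ^ d ^ n - 1) := by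
        rw [geom_sum_mul, ← pow_mul, pow_succ]
      rw [h3, norm_mul, pow_succ]
      nlinarith [norm_nonneg (v - 1), norm_nonneg (v ^ d ^ n - 1)]
  by_contra hne
  have hpos : 0 < ‖v - 1‖ := norm_pos_iff.2 (sub_ne_zero.2 hne)
  have h4 : Tendsto (fun n : ℕ => (3 / 2 : ℝ) ^ n * ‖v - 1‖) atTop atTop :=
    (tendsto_pow_atTop_atTop_of_one_lt (by norm_num)).atTop_mul_const hpos
  obtain ⟨n, hn⟩ := (h4.eventually_ge_atTop c).exists
  linarith [hgrow n, hv n]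

/-- Uniqueness of the Böttcher map. -/
theorem eqOn (h : IsBottcherMap f φ) (hd : 2 ≤ f.natDegree) {φ' : ℂ → ℂ}
    (h' : IsBottcherMap f φ') : EqOn φ φ' (basin f) := by
  obtain ⟨c, hc, hone⟩ := eq_one_of_pow_near hd
  obtain ⟨R, hR⟩ := exists_isEscapeRadius hd
  -- Along an orbit near infinity the quotient `φ / φ'` runs through its `d^n`-th powers, all close
  -- to `1`, so it equals `1`. The identity theorem extends this to the connected basin.
  have hlim : Tendsto (fun z => (φ z / z) / (φ' z / z)) (Bornology.cobounded ℂ) (𝓝 1) := by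
    simpa [Pi.div_def] using h.tendsto_div.div h'.tendsto_div one_ne_zero
  obtain ⟨r, -, hr⟩ := (Metric.hasBasis_cobounded_compl_closedBall (0 : ℂ)).eventually_iff.1
    (Metric.tendsto_nhds.1 hlim c hc)
  set s := max (r + 1) R with hs
  have hs0 : R ≤ s := le_max_right _ _
  have hR1 := hR.1
  have hbig : ∀ z, s ≤ ‖z‖ → ‖φ z / φ' z - 1‖ < c := by
    intro z hz
    have h1 := hr (x := z) (by
      rw [mem_compl_iff, mem_closedBall_zero_iff]
      linarith [le_max_left (r + 1) R])
    have hz0 : z ≠ 0 := by rw [← norm_pos_iff]; linarith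
    rwa [div_div_div_cancel_right₀ hz0, dist_eq_norm] at h1
  have heq : ∀ z, s ≤ ‖z‖ → φ z = φ' z := by
    intro z hz
    have hzb : z ∈ basin f := hR.mem_basin (hs0.trans hz)
    have h1 : φ z / φ' z = 1 := by
      apply hone
      intro n
      have := hbig ((toMap f)^[n] z) (hz.trans (hR.le_norm_iterate (hs0.trans hz) n))
      rwa [h.map_iterate hzb, h'.map_iterate hzb, ← div_pow] at this
    have h2 : φ' z ≠ 0 := by rw [← norm_pos_iff]; linarith [h'.one_lt_norm hzb]
    exact (div_eq_one_iff_eq h2).1 h1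
  have hz₀ : ‖((s + 1 : ℝ) : ℂ)‖ = s + 1 := by
    rw [Complex.norm_real, Real.norm_of_nonneg (by linarith)]
  refine (h.differentiableOn.analyticOnNhd (isOpen_basin hd)).eqOn_of_preconnected_of_eventuallyEq
    (h'.differentiableOn.analyticOnNhd (isOpen_basin hd)) (h.isPreconnected_basin hd)
    (z₀ := ((s + 1 : ℝ) : ℂ)) (hR.mem_basin (by rw [hz₀]; linarith)) ?_
  have : ∀ᶠ z in 𝓝 ((s + 1 : ℝ) : ℂ), s < ‖z‖ :=
    continuous_norm.continuousAt.eventually (lt_mem_nhds (by simp only [hz₀]; linarith))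
  filter_upwards [this] with z hz using heq z hz.le

theorem Psi_eq (h : IsBottcherMap f φ) (hd : 2 ≤ f.natDegree) {φ' : ℂ → ℂ}
    (h' : IsBottcherMap f φ') {ζ : ℂ} (hζ : 0 < ζ.re) : Psi f φ' ζ = Psi f φ ζ := by
  refine h.eq_of_map_eq (h'.Psi_mem hζ) (h.Psi_mem hζ) ?_
  rw [h.eqOn hd h' (h'.Psi_mem hζ), h'.map_Psi hζ, h.map_Psi hζ]

/-- Since `φ(f^n z) = φ(z)^(d^n)` exactly, replacing `f^n z` by its Böttcher coordinate costs only
`log |φ(w)/w|` at `w = f^n z`, which tends to `0` even before division by `d^n`. -/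
theorem green_of_mem (h : IsBottcherMap f φ) (hd : 2 ≤ f.natDegree) {z : ℂ} (hz : z ∈ basin f) :
    green f z = Real.log ‖φ z‖ := by
  refine Tendsto.limUnder_eq ?_
  have hinf : Tendsto (fun n : ℕ => (toMap f)^[n] z) atTop (Bornology.cobounded ℂ) := hz
  have hd1 : (1 : ℝ) < f.natDegree := by exact_mod_cast (by omega : 1 < f.natDegree)
  have h1 : Tendsto (fun n : ℕ => Real.log ‖φ ((toMap f)^[n] z) / (toMap f)^[n] z‖) atTop (𝓝 0) := by
    have := (h.tendsto_div.comp hinf).norm.log (by simp)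
    simpa using this
  have h2 : Tendsto (fun n : ℕ => Real.log ‖φ z‖ -
      Real.log ‖φ ((toMap f)^[n] z) / (toMap f)^[n] z‖ * ((f.natDegree : ℝ) ^ n)⁻¹) atTop
      (𝓝 (Real.log ‖φ z‖)) := by
    have := h1.mul (tendsto_inv_atTop_zero.comp (tendsto_pow_atTop_atTop_of_one_lt hd1))
    simpa using this.const_sub (Real.log ‖φ z‖)
  refine h2.congr' ?_
  have h3 : ∀ᶠ n : ℕ in atTop, 1 ≤ ‖(toMap f)^[n] z‖ :=
    (tendsto_norm_atTop_iff_cobounded.2 hinf).eventually_ge_atTop 1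
  filter_upwards [h3] with n hn
  have hφ0 : ‖φ z‖ ≠ 0 := by linarith [h.one_lt_norm hz]
  have hdn : (f.natDegree : ℝ) ^ n ≠ 0 := by positivity
  rw [Real.posLog_eq_log (by rwa [abs_norm]), h.map_iterate hz, norm_div, norm_pow,
    Real.log_div (pow_ne_zero _ hφ0) (by linarith), Real.log_pow]
  push_cast
  field_simp
  ring

theorem green_Psi (h : IsBottcherMap f φ) (hd : 2 ≤ f.natDegree) {ζ : ℂ} (hζ : 0 < ζ.re) :
    green f (Psi f φ ζ) = ζ.re := by
  rw [h.green_of_mem hd (h.Psi_mem hζ), h.map_Psi hζ, Complex.norm_exp, Real.log_exp]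

end IsBottcherMap

theorem green_of_notMem {f : ℂ[X]} (hd : 2 ≤ f.natDegree) {z : ℂ} (hz : z ∉ basin f) :
    green f z = 0 := by
  refine Tendsto.limUnder_eq ?_
  obtain ⟨R, hR⟩ := exists_isEscapeRadius hd
  have hd1 : (1 : ℝ) < f.natDegree := by exact_mod_cast (by omega : 1 < f.natDegree)
  refine squeeze_zero (g := fun n : ℕ => R * ((f.natDegree : ℝ) ^ n)⁻¹)
    (fun n => div_nonneg Real.posLog_nonneg (by positivity)) (fun n => ?_) ?_
  · rw [div_eq_mul_inv]
    have h0 : ‖(toMap f)^[n] z‖ < R := norm_iterate_lt_of_notMem_basin hR hz n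
    have h1 := hR.1
    refine mul_le_mul_of_nonneg_right ?_ (by positivity)
    refine (Real.monotoneOn_posLog (norm_nonneg _) (by simp; linarith) h0.le).trans ?_
    rw [Real.posLog_eq_log (by rw [abs_of_pos] <;> linarith)]
    linarith [Real.log_le_sub_one_of_pos (show 0 < R by linarith)]
  · simpa using (tendsto_inv_atTop_zero.comp
      (tendsto_pow_atTop_atTop_of_one_lt hd1)).const_mul R

namespace IsBottcherMap

variable {f : ℂ[X]} {φ : ℂ → ℂ}

theorem Psi_periodic (k : ℤ) (ζ : ℂ) :
    Psi f φ (ζ + k * (2 * Real.pi * Complex.I)) = Psi f φ ζ := by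
  rw [Psi, Complex.exp_add, Complex.exp_int_mul_two_pi_mul_I, mul_one, Psi]

/-- Near infinity `|φ(z)| > |z| / 2`, while `|φ| < e < 3` at potential below `1`; this forces `|z| <
6`. -/
theorem exists_norm_Psi_lt (h : IsBottcherMap f φ) :
    ∃ R : ℝ, ∀ ζ : ℂ, 0 < ζ.re → ζ.re < 1 → ‖Psi f φ ζ‖ < R := by
  have h1 : ∀ᶠ z in Bornology.cobounded ℂ, 1 / 2 < ‖φ z / z‖ :=
    h.tendsto_div.norm.eventually (lt_mem_nhds (by norm_num))
  obtain ⟨r, -, hr⟩ := (Metric.hasBasis_cobounded_compl_closedBall (0 : ℂ)).eventually_iff.1 h1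
  refine ⟨max (|r| + 1) 6, fun ζ h0 h1 => ?_⟩
  by_contra! hcon
  have hz1 := (le_max_left _ _).trans hcon
  have hz6 := (le_max_right _ _).trans hcon
  have h2 := hr (x := Psi f φ ζ) (by
    rw [mem_compl_iff, mem_closedBall_zero_iff]
    linarith [le_abs_self r])
  rw [norm_div, h.map_Psi h0, Complex.norm_exp, lt_div_iff₀ (by linarith)] at h2
  have h3 : Real.exp ζ.re ≤ Real.exp 1 := Real.exp_le_exp.2 h1.le
  linarith [Real.exp_one_lt_d9]

/-- Points of small potential are close to the Julia set. -/
theorem exists_Psi_mem_nhds_julia (h : IsBottcherMap f φ) (hd : 2 ≤ f.natDegree) {O : Set ℂ}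
    (hO : IsOpen O) (hJO : julia f ⊆ O) :
    ∃ s > 0, ∀ ζ : ℂ, 0 < ζ.re → ζ.re ≤ s → Psi f φ ζ ∈ O := by
  obtain ⟨R, hR⟩ := h.exists_norm_Psi_lt
  -- Since `O` contains the Julia set, `S` is a compact subset of the open basin, where the
  -- potential has a positive lower bound.
  set S := closure (basin f) ∩ Metric.closedBall 0 R ∩ Oᶜ with hS
  have hSc : IsCompact S :=
    ((isCompact_closedBall _ _).inter_left isClosed_closure).inter_right hO.isClosed_compl
  have hSb : S ⊆ basin f := by
    rintro z ⟨⟨hz1, -⟩, hz2⟩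
    by_contra hz3
    exact hz2 (hJO ((mem_julia_iff hd).2 ⟨hz1, hz3⟩))
  have key : ∃ s > 0, ∀ z ∈ S, s < Real.log ‖φ z‖ := by
    rcases S.eq_empty_or_nonempty with hE | hne
    · exact ⟨1, one_pos, by simp [hE]⟩
    · obtain ⟨z₀, hz₀, hmin⟩ := hSc.exists_isMinOn hne
        ((h.differentiableOn.continuousOn.mono hSb).norm)
      have h1 := h.one_lt_norm (hSb hz₀)
      have hpos := Real.log_pos h1
      refine ⟨Real.log ‖φ z₀‖ / 2, by positivity, fun z hz => ?_⟩
      have h2 : ‖φ z₀‖ ≤ ‖φ z‖ := hmin hz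
      have := Real.log_le_log (by linarith) h2
      linarith
  obtain ⟨s, hs, hlog⟩ := key
  refine ⟨min s (1 / 2), by positivity, fun ζ h0 h1 => ?_⟩
  by_contra hcon
  have h2 := hlog (Psi f φ ζ) ⟨⟨subset_closure (h.Psi_mem h0),
    mem_closedBall_zero_iff.2 (hR ζ h0 (by linarith [h1.trans (min_le_right _ _)])).le⟩, hcon⟩
  rw [h.map_Psi h0, Complex.norm_exp, Real.log_exp] at h2
  linarith [h1.trans (min_le_left _ _)]

theorem deriv_Psi_periodic (k : ℤ) (ζ : ℂ) :
    deriv (Psi f φ) (ζ + k * (2 * Real.pi * Complex.I)) = deriv (Psi f φ) ζ := by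
  have : Psi f φ = fun w => Psi f φ (w + k * (2 * Real.pi * Complex.I)) := by
    ext w; rw [Psi_periodic]
  conv_rhs => rw [this, deriv_comp_add_const]

theorem deriv_iterate_Psi (h : IsBottcherMap f φ) (hd : 2 ≤ f.natDegree) {ζ : ℂ}
    (hζ : 0 < ζ.re) (n : ℕ) :
    deriv (toMap f)^[n] (Psi f φ ζ) * deriv (Psi f φ) ζ =
      (f.natDegree : ℂ) ^ n * deriv (Psi f φ) ((f.natDegree : ℂ) ^ n * ζ) := by
  have h1 : HasDerivAt (fun w => (toMap f)^[n] (Psi f φ w))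
      (deriv (toMap f)^[n] (Psi f φ ζ) * deriv (Psi f φ) ζ) ζ :=
    (differentiable_iterate f n _).hasDerivAt.comp ζ (h.differentiableAt_Psi hd hζ).hasDerivAt
  have h2 : HasDerivAt (fun w => Psi f φ ((f.natDegree : ℂ) ^ n * w))
      (deriv (Psi f φ) ((f.natDegree : ℂ) ^ n * ζ) * ((f.natDegree : ℂ) ^ n * 1)) ζ :=
    (h.differentiableAt_Psi hd (re_pow_mul_pos hd hζ n)).hasDerivAt.comp ζ
      ((hasDerivAt_id ζ).const_mul _)
  have h3 : (fun w => (toMap f)^[n] (Psi f φ w)) =ᶠ[𝓝 ζ]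
      fun w => Psi f φ ((f.natDegree : ℂ) ^ n * w) := by
    filter_upwards [isOpen_re_pos.mem_nhds hζ] with w hw using h.iterate_Psi hd hw n
  rw [h1.unique (h2.congr_of_eventuallyEq h3), mul_one, mul_comm]

/-- The derivative of `Psi` in the hyperbolic metric tends to `0` geometrically. -/
theorem exists_decay (h : IsBottcherMap f φ) (hd : 2 ≤ f.natDegree) (hhyp : IsHyperbolic f)
    (hpcf : IsPostcriticallyFinite f) :
    ∃ q > (1 : ℝ), ∃ s > (0 : ℝ), ∃ C ≥ (0 : ℝ), ∀ (k : ℕ) (ζ : ℂ), s / q ^ k ≤ ζ.re →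
      ζ.re ≤ q * (s / q ^ k) → ζ.re * ‖deriv (Psi f φ) ζ‖ ≤ C * (2 / 3) ^ k := by
  obtain ⟨m, hm, hexp⟩ := exists_expanding_iterate hd hhyp hpcf
  set q : ℝ := (f.natDegree : ℝ) ^ m with hq
  have hd1 : (1 : ℝ) < f.natDegree := by exact_mod_cast (by omega : 1 < f.natDegree)
  have hq1 : 1 < q := one_lt_pow₀ hd1 (by omega)
  have hcd : Continuous (deriv (toMap f)^[m]) :=
    ((differentiable_iterate f m).contDiff (n := 1)).continuous_deriv_one
  have hO : IsOpen {z | 3 / 2 < ‖deriv (toMap f)^[m] z‖} :=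
    isOpen_lt continuous_const hcd.norm
  obtain ⟨s, hs, hPsi⟩ := h.exists_Psi_mem_nhds_julia hd hO
    (fun x hx => show 3 / 2 < ‖deriv (toMap f)^[m] x‖ by linarith [hexp x hx])
  have hcontd : ContinuousOn (deriv (Psi f φ)) {ζ | 0 < ζ.re} :=
    ((h.differentiableOn_Psi hd).deriv isOpen_re_pos).continuousOn
  -- a bound on a fundamental strip
  set K : Set ℂ := Icc s (q * s) ×ℂ Icc 0 (2 * Real.pi) with hK
  have hKc : IsCompact K := isCompact_Icc.reProdIm isCompact_Icc
  have hKpos : K ⊆ {ζ | 0 < ζ.re} := fun ζ hζ => hs.trans_le hζ.1.1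
  obtain ⟨C, hC⟩ := hKc.exists_bound_of_continuousOn (f := fun ζ : ℂ => (ζ.re : ℂ) * deriv (Psi f φ) ζ)
    ((Complex.continuous_ofReal.comp Complex.continuous_re).continuousOn.mul (hcontd.mono hKpos))
  -- Periodicity under `2πi` reduces the strip to the compact rectangle `K`.
  have hstrip : ∀ ζ : ℂ, s ≤ ζ.re → ζ.re ≤ q * s → ζ.re * ‖deriv (Psi f φ) ζ‖ ≤ C := by
    intro ζ h1 h2
    set k : ℤ := -⌊ζ.im / (2 * Real.pi)⌋ with hk
    have hre : (ζ + k * (2 * Real.pi * Complex.I)).re = ζ.re := by simp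
    have him : (ζ + k * (2 * Real.pi * Complex.I)).im = ζ.im + k * (2 * Real.pi) := by simp
    have hpi := Real.two_pi_pos
    have h3 := hC (ζ + k * (2 * Real.pi * Complex.I)) ⟨by simpa using ⟨h1, h2⟩, by
      rw [mem_preimage, him]
      have e1 := Int.floor_le (ζ.im / (2 * Real.pi))
      have e2 := Int.lt_floor_add_one (ζ.im / (2 * Real.pi))
      rw [le_div_iff₀ hpi] at e1
      rw [div_lt_iff₀ hpi] at e2
      rw [hk]; push_cast
      constructor <;> linarith⟩
    simp only [deriv_Psi_periodic, norm_mul, Complex.norm_real] at h3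
    rw [hre, Real.norm_of_nonneg (by linarith)] at h3
    exact h3
  refine ⟨q, hq1, s, hs, max C 0, le_max_right _ _, fun k => ?_⟩
  induction k with
  | zero =>
    intro ζ h1 h2
    simp only [pow_zero, div_one, mul_one] at *
    exact (hstrip ζ h1 h2).trans (le_max_left _ _)
  | succ k ih =>
    intro ζ h1 h2
    have hqk : 0 < q ^ k := by positivity
    have e : s / q ^ (k + 1) * q = s / q ^ k := by rw [pow_succ]; field_simp
    have h0 : 0 < ζ.re := lt_of_lt_of_le (by positivity) h1
    have hle : ζ.re ≤ s := by
      have : s / q ^ k ≤ s := div_le_self hs.le (one_le_pow₀ hq1.le)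
      linarith
    have h4 : 3 / 2 < ‖deriv (toMap f)^[m] (Psi f φ ζ)‖ := hPsi ζ h0 hle
    have hqc : (f.natDegree : ℂ) ^ m = ((q : ℝ) : ℂ) := by rw [hq]; push_cast; rfl
    -- `(f^m)'(Ψ ζ) Ψ'(ζ) = q Ψ'(q ζ)`, and the first factor exceeds `3 / 2` near the Julia set;
    -- hence passing from `q ζ` to `ζ` shrinks `Re ζ · |Ψ'(ζ)|` by at least `2 / 3`.
    have h5 := congrArg norm (h.deriv_iterate_Psi hd h0 m)
    rw [hqc, norm_mul, norm_mul, Complex.norm_real, Real.norm_of_nonneg (by linarith)] at h5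
    have hre : ((q : ℂ) * ζ).re = q * ζ.re := Complex.re_ofReal_mul _ _
    have h6 := ih ((q : ℂ) * ζ) (by rw [hre]; nlinarith) (by rw [hre]; nlinarith)
    rw [hre] at h6
    have h7 := norm_nonneg (deriv (Psi f φ) ζ)
    have h8 : 3 / 2 * (ζ.re * ‖deriv (Psi f φ) ζ‖) ≤ max C 0 * (2 / 3) ^ k := by
      calc 3 / 2 * (ζ.re * ‖deriv (Psi f φ) ζ‖)
          = ζ.re * (3 / 2 * ‖deriv (Psi f φ) ζ‖) := by ring
        _ ≤ ζ.re * (q * ‖deriv (Psi f φ) ((q : ℂ) * ζ)‖) := by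
            rw [← h5]
            gcongr
        _ = q * ζ.re * ‖deriv (Psi f φ) ((q : ℂ) * ζ)‖ := by ring
        _ ≤ _ := h6
    rw [pow_succ]
    linarith

/-- `Psi` is uniformly continuous up to the boundary: its boundary values parametrize the Julia
set continuously. -/
theorem uniform_continuity (h : IsBottcherMap f φ) (hd : 2 ≤ f.natDegree) (hhyp : IsHyperbolic f)
    (hpcf : IsPostcriticallyFinite f) {ε : ℝ} (hε : 0 < ε) :
    ∃ η > 0, ∀ ζ ζ' : ℂ, 0 < ζ.re → ζ.re < η → 0 < ζ'.re → ζ'.re < η → |ζ.im - ζ'.im| < η →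
      dist (Psi f φ ζ) (Psi f φ ζ') < ε := by
  obtain ⟨q, hq, s, hs, C, hC, hdec⟩ := h.exists_decay hd hhyp hpcf
  have hq0 : 0 < q := by linarith
  have hsk : ∀ k : ℕ, 0 < s / q ^ k := fun k => by positivity
  have hbound : ∀ (k : ℕ) (ζ : ℂ), s / q ^ k ≤ ζ.re → ζ.re ≤ q * (s / q ^ k) →
      ‖deriv (Psi f φ) ζ‖ ≤ C * (2 / 3) ^ k / (s / q ^ k) := by
    intro k ζ h1 h2
    rw [le_div_iff₀ (hsk k), mul_comm]
    exact (mul_le_mul_of_nonneg_right h1 (norm_nonneg _)).trans (hdec k ζ h1 h2)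
  have hmv : ∀ (k : ℕ) (ζ ζ' : ℂ), s / q ^ k ≤ ζ.re → ζ.re ≤ q * (s / q ^ k) →
      s / q ^ k ≤ ζ'.re → ζ'.re ≤ q * (s / q ^ k) →
      dist (Psi f φ ζ) (Psi f φ ζ') ≤ C * (2 / 3) ^ k / (s / q ^ k) * dist ζ ζ' := by
    intro k ζ ζ' h1 h2 h3 h4
    rw [dist_eq_norm, dist_eq_norm]
    refine Convex.norm_image_sub_le_of_norm_deriv_le (s := {w : ℂ | s / q ^ k ≤ w.re} ∩
      {w : ℂ | w.re ≤ q * (s / q ^ k)}) (fun w hw => h.differentiableAt_Psi hd ((hsk k).trans_le hw.1))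
      (fun w hw => hbound k w hw.1 hw.2)
      ((convex_halfSpace_re_ge _).inter (convex_halfSpace_re_le _)) ⟨h3, h4⟩ ⟨h1, h2⟩
  have hstep : ∀ k : ℕ, s / q ^ k = q * (s / q ^ (k + 1)) := by
    intro k; rw [pow_succ]; field_simp
  -- variation along vertical lines
  have hvert : ∀ (n k : ℕ) (ζ ζ' : ℂ), s / q ^ (k + n) ≤ ζ.re → ζ.re ≤ s / q ^ k →
      ζ'.re = s / q ^ k → ζ'.im = ζ.im →
      dist (Psi f φ ζ) (Psi f φ ζ') ≤ 3 * C * q * (2 / 3) ^ k := by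
    intro n
    induction n with
    | zero =>
      intro k ζ ζ' h1 h2 h3 h4
      have : ζ = ζ' := Complex.ext (by rw [h3]; exact le_antisymm h2 h1) h4.symm
      rw [this, dist_self]
      positivity
    | succ n ih =>
      intro k ζ ζ' h1 h2 h3 h4
      have hone : ∀ w : ℂ, s / q ^ (k + 1) ≤ w.re → w.re ≤ s / q ^ k → w.im = ζ.im →
          dist (Psi f φ w) (Psi f φ ζ') ≤ C * q * (2 / 3) ^ (k + 1) := by
        intro w hw1 hw2 hw3
        have a1 := hsk (k + 1)
        have a2 := hstep k
        refine (hmv (k + 1) w ζ' hw1 (hw2.trans_eq a2) (by nlinarith) (by rw [h3, a2])).trans ?_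
        have hdist : dist w ζ' ≤ q * (s / q ^ (k + 1)) := by
          rw [dist_eq_norm]
          have : w - ζ' = ((w.re - ζ'.re : ℝ) : ℂ) :=
            Complex.ext (by simp) (by simp [h4, hw3])
          rw [this, Complex.norm_real, Real.norm_eq_abs, abs_le, h3, ← a2]
          constructor <;> linarith
        calc C * (2 / 3) ^ (k + 1) / (s / q ^ (k + 1)) * dist w ζ'
            ≤ C * (2 / 3) ^ (k + 1) / (s / q ^ (k + 1)) * (q * (s / q ^ (k + 1))) := by gcongr
          _ = C * q * (2 / 3) ^ (k + 1) := by field_simp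
      have hpk : (0 : ℝ) < (2 / 3) ^ k := by positivity
      have hCq : 0 ≤ C * q * (2 / 3) ^ k := by positivity
      by_cases hcase : s / q ^ (k + 1) ≤ ζ.re
      · refine (hone ζ hcase h2 rfl).trans ?_
        rw [pow_succ]; linarith
      · push Not at hcase
        set v : ℂ := ⟨s / q ^ (k + 1), ζ.im⟩ with hv
        -- The geometric series is summed by induction: `3 + 1 = 4` copies of `C q (2/3)^(k+1)` make
        -- `8 / 3 ≤ 3` copies of `C q (2/3)^k`.
        have e1 := ih (k + 1) ζ v (by rwa [show k + 1 + n = k + (n + 1) by ring]) hcase.le rfl rfl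
        have e2 := hone v le_rfl (by
          show s / q ^ (k + 1) ≤ _
          have := hsk (k + 1); have := hstep k; nlinarith) rfl
        have := dist_triangle (Psi f φ ζ) (Psi f φ v) (Psi f φ ζ')
        rw [pow_succ] at e1 e2
        linarith
  have hvert' : ∀ (k : ℕ) (ζ ζ' : ℂ), 0 < ζ.re → ζ.re ≤ s / q ^ k →
      ζ'.re = s / q ^ k → ζ'.im = ζ.im →
      dist (Psi f φ ζ) (Psi f φ ζ') ≤ 3 * C * q * (2 / 3) ^ k := by
    intro k ζ ζ' h0 h1 h2 h3
    have : Tendsto (fun n : ℕ => s * (q ^ (n + k))⁻¹) atTop (𝓝 0) := by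
      have := ((tendsto_inv_atTop_zero.comp (tendsto_pow_atTop_atTop_of_one_lt hq)).const_mul
        s).comp (tendsto_add_atTop_nat k)
      simpa [Function.comp_def] using this
    obtain ⟨n, hn⟩ := (this.eventually (gt_mem_nhds h0)).exists
    refine hvert n k ζ ζ' ?_ h1 h2 h3
    rw [div_eq_mul_inv, add_comm k n]
    exact hn.le
  obtain ⟨k, hk⟩ : ∃ k : ℕ, 3 * C * q * (2 / 3) ^ k < ε / 3 := by
    have : Tendsto (fun k : ℕ => 3 * C * q * (2 / 3 : ℝ) ^ k) atTop (𝓝 (3 * C * q * 0)) :=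
      (tendsto_pow_atTop_nhds_zero_of_lt_one (by norm_num) (by norm_num)).const_mul _
    rw [mul_zero] at this
    exact (this.eventually (gt_mem_nhds (by positivity))).exists
  set t := s / q ^ k with ht
  have ht0 : 0 < t := hsk k
  set L := C * (2 / 3) ^ k / t with hL
  have hL0 : 0 ≤ L := by positivity
  -- Both points are raised along their rays to the level `t`, at a cost of `ε / 3` each; along that
  -- level the derivative of `Psi` is at most `L`.
  refine ⟨min t (ε / (3 * (L + 1))), by positivity, fun ζ ζ' h1 h2 h3 h4 h5 => ?_⟩
  have g1 := hvert' k ζ ⟨t, ζ.im⟩ h1 (h2.le.trans (min_le_left _ _)) rfl rfl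
  have g2 := hvert' k ζ' ⟨t, ζ'.im⟩ h3 (h4.le.trans (min_le_left _ _)) rfl rfl
  have htq : t ≤ q * t := by nlinarith
  have g3 : dist (Psi f φ ⟨t, ζ.im⟩) (Psi f φ ⟨t, ζ'.im⟩) ≤
      L * dist (⟨t, ζ.im⟩ : ℂ) ⟨t, ζ'.im⟩ := hmv k ⟨t, ζ.im⟩ ⟨t, ζ'.im⟩ le_rfl htq le_rfl htq
  have g4 : dist (⟨t, ζ.im⟩ : ℂ) ⟨t, ζ'.im⟩ < ε / (3 * (L + 1)) := by
    rw [Complex.dist_of_re_eq (show (⟨t, ζ.im⟩ : ℂ).re = (⟨t, ζ'.im⟩ : ℂ).re from rfl), Real.dist_eq]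
    exact h5.trans_le (min_le_right _ _)
  have g5 : L * dist (⟨t, ζ.im⟩ : ℂ) ⟨t, ζ'.im⟩ ≤ ε / 3 := by
    calc L * dist (⟨t, ζ.im⟩ : ℂ) ⟨t, ζ'.im⟩ ≤ (L + 1) * (ε / (3 * (L + 1))) := by
          gcongr; linarith
      _ = ε / 3 := by field_simp
  have t1 := dist_triangle (Psi f φ ζ) (Psi f φ ⟨t, ζ.im⟩) (Psi f φ ζ')
  have t2 := dist_triangle_right (Psi f φ ⟨t, ζ.im⟩) (Psi f φ ζ') (Psi f φ ⟨t, ζ'.im⟩)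
  linarith

end IsBottcherMap

/-! ### External rays and their landing points -/

/-- A postcritically finite hyperbolic polynomial together with a Böttcher map. -/
structure RayData (f : ℂ[X]) (φ : ℂ → ℂ) : Prop where
  two_le : 2 ≤ f.natDegree
  hyperbolic : IsHyperbolic f
  pcf : IsPostcriticallyFinite f
  bottcher : IsBottcherMap f φ

open Classical in
/-- The point of potential `s` on the external ray of angle `θ`, and the landing point of that ray
for `s ≤ 0`. -/
noncomputable def rayPt (f : ℂ[X]) (φ : ℂ → ℂ) (s θ : ℝ) : ℂ :=
  if 0 < s then Psi f φ ⟨s, 2 * Real.pi * θ⟩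
  else limUnder (𝓝[>] (0 : ℝ)) fun t => Psi f φ ⟨t, 2 * Real.pi * θ⟩

theorem rayPt_of_pos {f : ℂ[X]} {φ : ℂ → ℂ} {s : ℝ} (hs : 0 < s) (θ : ℝ) :
    rayPt f φ s θ = Psi f φ ⟨s, 2 * Real.pi * θ⟩ := if_pos hs

namespace RayData

variable {f : ℂ[X]} {φ : ℂ → ℂ}

theorem one_lt_degree (H : RayData f φ) : (1 : ℝ) < f.natDegree := by
  have := H.two_le
  exact_mod_cast (by omega : 1 < f.natDegree)

theorem degree_pow_pos (H : RayData f φ) (n : ℕ) : (0 : ℝ) < (f.natDegree : ℝ) ^ n := by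
  have := H.one_lt_degree
  positivity

/-- Uniform continuity of `Psi` makes the ray Cauchy as the potential decreases to `0`, so the limit
in `rayPt` is genuine. -/
theorem tendsto_rayPt_zero (H : RayData f φ) (θ : ℝ) :
    Tendsto (fun t : ℝ => Psi f φ ⟨t, 2 * Real.pi * θ⟩) (𝓝[>] (0 : ℝ)) (𝓝 (rayPt f φ 0 θ)) := by
  rw [rayPt, if_neg (lt_irrefl _)]
  apply tendsto_nhds_limUnder
  rw [← cauchy_map_iff_exists_tendsto, Metric.cauchy_iff]
  refine ⟨inferInstance, fun ε hε => ?_⟩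
  obtain ⟨η, hη, hu⟩ := H.bottcher.uniform_continuity H.two_le H.hyperbolic H.pcf hε
  refine ⟨(fun t : ℝ => Psi f φ ⟨t, 2 * Real.pi * θ⟩) '' Ioo 0 η,
    image_mem_map (Ioo_mem_nhdsGT hη), ?_⟩
  rintro _ ⟨t, ht, rfl⟩ _ ⟨t', ht', rfl⟩
  exact hu _ _ ht.1 ht.2 ht'.1 ht'.2 (by simpa using hη)

/-- Uniform continuity of the ray parametrization near potential `0`. -/
theorem exists_dist_rayPt_le (H : RayData f φ) {ε : ℝ} (hε : 0 < ε) :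
    ∃ η > 0, ∀ s s' θ θ' : ℝ, 0 ≤ s → s < η → 0 ≤ s' → s' < η → |θ - θ'| < η →
      dist (rayPt f φ s θ) (rayPt f φ s' θ') ≤ ε := by
  obtain ⟨η, hη, hu⟩ := H.bottcher.uniform_continuity H.two_le H.hyperbolic H.pcf hε
  have hpi := Real.two_pi_pos
  have hpi1 : 1 ≤ 2 * Real.pi := by linarith [Real.pi_gt_three]
  have key : ∀ s s' θ θ' : ℝ, 0 < s → s < η → 0 < s' → s' < η → |θ - θ'| < η / (2 * Real.pi) →
      dist (Psi f φ ⟨s, 2 * Real.pi * θ⟩) (Psi f φ ⟨s', 2 * Real.pi * θ'⟩) ≤ ε := by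
    intro s s' θ θ' h1 h2 h3 h4 h5
    refine (hu _ _ h1 h2 h3 h4 ?_).le
    show |2 * Real.pi * θ - 2 * Real.pi * θ'| < η
    rw [← mul_sub, abs_mul, abs_of_pos hpi]
    rwa [lt_div_iff₀' hpi] at h5
  -- Potential `0` is approximated by positive potentials on the same ray, so the estimate passes to
  -- landing points.
  have lim : ∀ s θ : ℝ, 0 ≤ s → s < η → ∃ u : ℕ → ℝ, (∀ n, 0 < u n ∧ u n < η) ∧
      Tendsto (fun n => Psi f φ ⟨u n, 2 * Real.pi * θ⟩) atTop (𝓝 (rayPt f φ s θ)) := by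
    intro s θ h0 h1
    rcases h0.eq_or_lt with rfl | h0
    · obtain ⟨u, -, hu1, hu2⟩ := exists_seq_strictAnti_tendsto' hη
      refine ⟨u, fun n => hu1 n, (H.tendsto_rayPt_zero θ).comp
        (tendsto_nhdsWithin_iff.2 ⟨hu2, Eventually.of_forall fun n => (hu1 n).1⟩)⟩
    · exact ⟨fun _ => s, fun _ => ⟨h0, h1⟩, by rw [rayPt_of_pos h0]; exact tendsto_const_nhds⟩
  refine ⟨η / (2 * Real.pi), by positivity, fun s s' θ θ' h1 h2 h3 h4 h5 => ?_⟩
  have hle : η / (2 * Real.pi) ≤ η := div_le_self hη.le hpi1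
  obtain ⟨u, hu1, hu2⟩ := lim s θ h1 (h2.trans_le hle)
  obtain ⟨v, hv1, hv2⟩ := lim s' θ' h3 (h4.trans_le hle)
  exact le_of_tendsto (hu2.dist hv2) (Eventually.of_forall fun n =>
    key _ _ _ _ (hu1 n).1 (hu1 n).2 (hv1 n).1 (hv1 n).2 h5)

theorem continuousOn_rayPt (H : RayData f φ) :
    ContinuousOn (fun p : ℝ × ℝ => rayPt f φ p.1 p.2) {p | 0 ≤ p.1} := by
  rintro ⟨s, θ⟩ (hs : 0 ≤ s)
  rcases hs.eq_or_lt with rfl | hs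
  · rw [Metric.continuousWithinAt_iff]
    intro ε hε
    obtain ⟨η, hη, hu⟩ := H.exists_dist_rayPt_le (half_pos hε)
    refine ⟨η, hη, ?_⟩
    rintro ⟨t, θ'⟩ (ht : 0 ≤ t) hdist
    rw [Prod.dist_eq, max_lt_iff, Real.dist_eq, Real.dist_eq] at hdist
    simp only [sub_zero] at hdist
    exact (hu _ _ _ _ ht ((le_abs_self t).trans_lt hdist.1) le_rfl hη hdist.2).trans_lt
      (half_lt_self hε)
  · apply ContinuousAt.continuousWithinAt
    have h1 : ContinuousAt (fun p : ℝ × ℝ => Psi f φ ⟨p.1, 2 * Real.pi * p.2⟩) (s, θ) := by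
      have h2 : ContinuousAt (fun p : ℝ × ℝ => (⟨p.1, 2 * Real.pi * p.2⟩ : ℂ)) (s, θ) := by
        have : (fun p : ℝ × ℝ => (⟨p.1, 2 * Real.pi * p.2⟩ : ℂ)) =
            fun p => (p.1 : ℂ) + (2 * Real.pi * p.2 : ℝ) * Complex.I := by
          ext p; exact Complex.mk_eq_add_mul_I _ _
        rw [this]; fun_prop
      exact ContinuousAt.comp (g := Psi f φ)
        (H.bottcher.differentiableAt_Psi H.two_le (show 0 < (⟨s, 2 * Real.pi * θ⟩ : ℂ).re from hs)).continuousAt h2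
    refine h1.congr ?_
    filter_upwards [(isOpen_lt continuous_const continuous_fst).mem_nhds (show (0 : ℝ) < (s, θ).1 from hs)]
      with p hp
    exact (rayPt_of_pos hp p.2).symm

theorem rayPt_mem_basin (H : RayData f φ) {s : ℝ} (hs : 0 < s) (θ : ℝ) :
    rayPt f φ s θ ∈ basin f := by
  rw [rayPt_of_pos hs]
  exact H.bottcher.Psi_mem hs

theorem tendsto_rayPt (H : RayData f φ) (θ : ℝ) :
    Tendsto (fun t : ℝ => rayPt f φ t θ) (𝓝[>] (0 : ℝ)) (𝓝 (rayPt f φ 0 θ)) := by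
  refine (H.tendsto_rayPt_zero θ).congr' ?_
  filter_upwards [self_mem_nhdsWithin] with t ht
  exact (rayPt_of_pos ht θ).symm

/-- If the limit were in the basin, continuity of `φ` there would give it modulus `lim exp t = 1`,
whereas `|φ| > 1` on the basin. -/
theorem rayPt_zero_mem_julia (H : RayData f φ) (θ : ℝ) : rayPt f φ 0 θ ∈ julia f := by
  rw [mem_julia_iff H.two_le]
  have hlim := H.tendsto_rayPt θ
  refine ⟨mem_closure_of_tendsto hlim ?_, fun hb => ?_⟩
  · filter_upwards [self_mem_nhdsWithin] with t ht using H.rayPt_mem_basin ht θ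
  · have h1 : ContinuousAt φ (rayPt f φ 0 θ) :=
      (H.bottcher.differentiableOn.differentiableAt
        ((isOpen_basin H.two_le).mem_nhds hb)).continuousAt
    have h2 := (h1.tendsto.comp hlim).norm
    have h3 : Tendsto (fun t : ℝ => Real.exp t) (𝓝[>] (0 : ℝ)) (𝓝 1) := by
      have : Tendsto Real.exp (𝓝 0) (𝓝 (Real.exp 0)) := Real.continuous_exp.continuousAt
      rw [Real.exp_zero] at this
      exact this.mono_left nhdsWithin_le_nhds
    have h4 := tendsto_nhds_unique (h2.congr' (f₂ := fun t : ℝ => Real.exp t) (by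
      filter_upwards [self_mem_nhdsWithin] with t ht
      rw [Function.comp_apply, rayPt_of_pos ht, H.bottcher.map_Psi (ζ := ⟨t, 2 * Real.pi * θ⟩) ht, Complex.norm_exp])) h3
    exact (H.bottcher.one_lt_norm hb).ne' h4

theorem rayPt_add_int (s θ : ℝ) (k : ℤ) : rayPt f φ s (θ + k) = rayPt f φ s θ := by
  have h : ∀ t : ℝ, Psi f φ ⟨t, 2 * Real.pi * (θ + k)⟩ = Psi f φ ⟨t, 2 * Real.pi * θ⟩ := by
    intro t
    rw [← IsBottcherMap.Psi_periodic k ⟨t, 2 * Real.pi * θ⟩]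
    congr 1
    apply Complex.ext
    · simp
    · simp; ring
  simp only [rayPt, h]

theorem toMap_rayPt (H : RayData f φ) {s : ℝ} (hs : 0 ≤ s) (θ : ℝ) :
    toMap f (rayPt f φ s θ) = rayPt f φ (f.natDegree * s) (f.natDegree * θ) := by
  have hd : (0 : ℝ) < f.natDegree := by linarith [H.one_lt_degree]
  have hpos : ∀ t : ℝ, 0 < t →
      toMap f (rayPt f φ t θ) = rayPt f φ (f.natDegree * t) (f.natDegree * θ) := by
    intro t ht
    rw [rayPt_of_pos ht, H.bottcher.toMap_Psi H.two_le ht, rayPt_of_pos (by positivity)]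
    congr 1
    apply Complex.ext
    · simp
    · simp; ring
  rcases hs.eq_or_lt with rfl | hs
  · have h1 : Tendsto (fun t : ℝ => toMap f (rayPt f φ t θ)) (𝓝[>] (0 : ℝ))
        (𝓝 (toMap f (rayPt f φ 0 θ))) :=
      ((differentiable_toMap f).continuous.continuousAt.tendsto).comp (H.tendsto_rayPt θ)
    have h2 : Tendsto (fun t : ℝ => (f.natDegree : ℝ) * t) (𝓝[>] 0) (𝓝[>] 0) := by
      refine tendsto_nhdsWithin_iff.2 ⟨?_, ?_⟩
      · have : Tendsto (fun t : ℝ => (f.natDegree : ℝ) * t) (𝓝 0) (𝓝 ((f.natDegree : ℝ) * 0)) :=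
          (continuous_const.mul continuous_id).continuousAt
        rw [mul_zero] at this
        exact this.mono_left nhdsWithin_le_nhds
      · filter_upwards [self_mem_nhdsWithin] with t ht
        exact mul_pos hd ht
    have h3 := (H.tendsto_rayPt (f.natDegree * θ)).comp h2
    rw [mul_zero]
    refine tendsto_nhds_unique h1 (h3.congr' ?_)
    filter_upwards [self_mem_nhdsWithin] with t ht
    exact (hpos t ht).symm
  · exact hpos s hs

theorem iterate_rayPt (H : RayData f φ) {s : ℝ} (hs : 0 ≤ s) (θ : ℝ) (n : ℕ) :
    (toMap f)^[n] (rayPt f φ s θ) =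
      rayPt f φ ((f.natDegree : ℝ) ^ n * s) ((f.natDegree : ℝ) ^ n * θ) := by
  induction n with
  | zero => simp
  | succ n ih =>
    have := H.degree_pow_pos n
    rw [Function.iterate_succ_apply', ih, H.toMap_rayPt (by positivity), pow_succ']
    ring_nf

theorem exists_rayPt_eq (H : RayData f φ) {z : ℂ} (hz : z ∈ basin f) :
    ∃ s > 0, ∃ θ ∈ Icc (0 : ℝ) 1, rayPt f φ s θ = z := by
  obtain ⟨ζ, hζ, rfl⟩ := H.bottcher.exists_Psi_eq hz
  have hpi := Real.two_pi_pos
  refine ⟨ζ.re, hζ, Int.fract (ζ.im / (2 * Real.pi)),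
    ⟨Int.fract_nonneg _, (Int.fract_lt_one _).le⟩, ?_⟩
  have h1 : Int.fract (ζ.im / (2 * Real.pi)) =
      ζ.im / (2 * Real.pi) + ((-⌊ζ.im / (2 * Real.pi)⌋ : ℤ) : ℝ) := by
    rw [Int.fract]; push_cast; ring
  rw [h1, rayPt_add_int, rayPt_of_pos hζ]
  congr 1
  exact Complex.ext rfl (by simp only; field_simp)

theorem rayPt_injective (H : RayData f φ) {s s' θ θ' : ℝ} (hs : 0 < s) (hs' : 0 < s')
    (h : rayPt f φ s θ = rayPt f φ s' θ') : s = s' ∧ ∃ k : ℤ, θ = θ' + k := by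
  rw [rayPt_of_pos hs, rayPt_of_pos hs'] at h
  have h1 := H.bottcher.exp_eq_of_Psi_eq (ζ := ⟨s, 2 * Real.pi * θ⟩)
    (ζ' := ⟨s', 2 * Real.pi * θ'⟩) hs hs' h
  obtain ⟨k, hk⟩ := Complex.exp_eq_exp_iff_exists_int.1 h1
  have hre := congrArg Complex.re hk
  have him := congrArg Complex.im hk
  simp at hre him
  refine ⟨hre, k, ?_⟩
  have hpi := Real.two_pi_pos
  have : 2 * Real.pi * θ = 2 * Real.pi * (θ' + k) := by linarith
  exact mul_left_cancel₀ hpi.ne' this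

theorem green_rayPt (H : RayData f φ) {s : ℝ} (hs : 0 ≤ s) (θ : ℝ) :
    green f (rayPt f φ s θ) = s := by
  rcases hs.eq_or_lt with rfl | hs
  · exact green_of_notMem H.two_le ((mem_julia_iff H.two_le).1 (H.rayPt_zero_mem_julia θ)).2
  · rw [rayPt_of_pos hs, H.bottcher.green_Psi H.two_le hs]

/-- Points of large potential are far away. -/
theorem exists_lt_norm_rayPt (H : RayData f φ) (R : ℝ) :
    ∃ S > 0, ∀ s θ : ℝ, S < s → R < ‖rayPt f φ s θ‖ := by
  have h1 : ∀ᶠ z in Bornology.cobounded ℂ, 1 / 2 < ‖φ z / z‖ ∧ ‖φ z / z‖ < 2 :=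
    (H.bottcher.tendsto_div.norm.eventually (lt_mem_nhds (by norm_num))).and
      (H.bottcher.tendsto_div.norm.eventually (gt_mem_nhds (by norm_num)))
  obtain ⟨r, -, hr⟩ := (Metric.hasBasis_cobounded_compl_closedBall (0 : ℂ)).eventually_iff.1 h1
  obtain ⟨R', hR'⟩ := exists_isEscapeRadius H.two_le
  set ρ := max (max (r + 1) R) R' with hρ
  have hρr : r + 1 ≤ ρ := (le_max_left _ _).trans (le_max_left _ _)
  have hρR : R ≤ ρ := (le_max_right _ _).trans (le_max_left _ _)
  have hρR' : R' ≤ ρ := le_max_right _ _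
  have hρ1 : 1 ≤ ρ := hR'.1.trans hρR'
  have hbd : ∀ z, ρ ≤ ‖z‖ → 1 / 2 * ‖z‖ < ‖φ z‖ ∧ ‖φ z‖ < 2 * ‖z‖ := by
    intro z hz
    have hz0 : 0 < ‖z‖ := by linarith
    have := hr (x := z) (by rw [mem_compl_iff, mem_closedBall_zero_iff]; linarith)
    rwa [norm_div, lt_div_iff₀ hz0, div_lt_iff₀ hz0] at this
  have hlog : 0 < Real.log (2 * ρ) := Real.log_pos (by linarith)
  -- `E` is an interval that omits `ρ`, since modulus `ρ` forces potential below `log (2 ρ)`, and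
  -- contains `4 ρ`; so it lies above `ρ`.
  set E : Set ℝ := (fun ζ => ‖Psi f φ ζ‖) '' {ζ : ℂ | Real.log (2 * ρ) < ζ.re} with hE
  have hpos : ∀ ζ : ℂ, Real.log (2 * ρ) < ζ.re → 0 < ζ.re := fun ζ h => hlog.trans h
  have hEc : IsPreconnected E := by
    refine (convex_halfSpace_re_gt _).isPreconnected.image _ ?_
    exact ((H.bottcher.differentiableOn_Psi H.two_le).continuousOn.mono fun ζ hζ => hpos ζ hζ).norm
  have hEρ : ρ ∉ E := by
    rintro ⟨ζ, hζ, h2⟩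
    have h2 : ‖Psi f φ ζ‖ = ρ := h2
    have h3 := (hbd _ h2.ge).2
    rw [H.bottcher.map_Psi (hpos ζ hζ), Complex.norm_exp, h2] at h3
    have h4 := Real.exp_lt_exp.2 hζ
    rw [Real.exp_log (by linarith)] at h4
    linarith
  obtain ⟨v, hv, hvρ⟩ : ∃ v ∈ E, ρ < v := by
    have hn : ‖((4 * ρ : ℝ) : ℂ)‖ = 4 * ρ := by
      rw [Complex.norm_real, Real.norm_of_nonneg (by linarith)]
    have hb : ((4 * ρ : ℝ) : ℂ) ∈ basin f := hR'.mem_basin (by rw [hn]; linarith)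
    obtain ⟨ζ, hζ, hζz⟩ := H.bottcher.exists_Psi_eq hb
    have h2 := (hbd ((4 * ρ : ℝ) : ℂ) (by rw [hn]; linarith)).1
    rw [← hζz, H.bottcher.map_Psi hζ, Complex.norm_exp, hζz, hn] at h2
    refine ⟨4 * ρ, ⟨ζ, ?_, by simp only [hζz, hn]⟩, by linarith⟩
    show Real.log (2 * ρ) < ζ.re
    rw [Real.log_lt_iff_lt_exp (by linarith)]
    linarith
  refine ⟨Real.log (2 * ρ), hlog, fun s θ hs => ?_⟩
  by_contra! hcon
  rw [rayPt_of_pos (hlog.trans hs)] at hcon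
  exact hEρ (hEc.ordConnected.out ⟨⟨s, 2 * Real.pi * θ⟩, hs, rfl⟩ hv ⟨hcon.trans hρR, hvρ.le⟩)

/-- Unions of closed rays over closed sets of angles are closed. -/
theorem isClosed_image_rayPt (H : RayData f φ) {C : Set ℝ} (hC : IsClosed C)
    (hC1 : C ⊆ Icc 0 1) : IsClosed ((fun p : ℝ × ℝ => rayPt f φ p.1 p.2) '' (Ici 0 ×ˢ C)) := by
  refine isClosed_of_closure_subset fun z hz => ?_
  -- Points of potential above `S` stay at distance more than `1` from `z`, so only a compact part
  -- of the rays matters near `z`.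
  obtain ⟨S, hS, hfar⟩ := H.exists_lt_norm_rayPt (‖z‖ + 1)
  set T := (fun p : ℝ × ℝ => rayPt f φ p.1 p.2) '' (Icc 0 S ×ˢ C) with hT
  have hTc : IsCompact T :=
    (isCompact_Icc.prod (isCompact_Icc.of_isClosed_subset hC hC1)).image_of_continuousOn
      (H.continuousOn_rayPt.mono fun p hp => hp.1.1)
  have hzT : z ∈ T := by
    rw [← hTc.isClosed.closure_eq, mem_closure_iff_nhds]
    intro N hN
    obtain ⟨y, ⟨hy1, hy2⟩, ⟨s, θ⟩, ⟨hs, hθ⟩, rfl⟩ := mem_closure_iff_nhds.1 hz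
      (N ∩ Metric.ball z 1) (inter_mem hN (Metric.ball_mem_nhds z one_pos))
    refine ⟨_, hy1, (s, θ), ⟨⟨hs, ?_⟩, hθ⟩, rfl⟩
    by_contra! hcon
    have h1 := hfar s θ hcon
    rw [mem_ball_iff_norm] at hy2
    have := norm_sub_norm_le (rayPt f φ s θ) z
    simp only at hy2
    linarith
  obtain ⟨p, hp, rfl⟩ := hzT
  exact ⟨p, ⟨hp.1.1, hp.2⟩, rfl⟩

/-- Every point of the Julia set is the landing point of a ray. -/
theorem exists_rayPt_zero_eq (H : RayData f φ) {z : ℂ} (hz : z ∈ julia f) :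
    ∃ θ ∈ Icc (0 : ℝ) 1, rayPt f φ 0 θ = z := by
  have hcl := H.isClosed_image_rayPt isClosed_Icc (Subset.refl (Icc (0 : ℝ) 1))
  have hsub : closure (basin f) ⊆
      (fun p : ℝ × ℝ => rayPt f φ p.1 p.2) '' (Ici 0 ×ˢ Icc (0 : ℝ) 1) := by
    refine closure_minimal (fun w hw => ?_) hcl
    obtain ⟨s, hs, θ, hθ, h⟩ := H.exists_rayPt_eq hw
    exact ⟨(s, θ), ⟨hs.le, hθ⟩, h⟩
  obtain ⟨h1, h2⟩ := (mem_julia_iff H.two_le).1 hz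
  obtain ⟨⟨s, θ⟩, ⟨hs, hθ⟩, rfl⟩ := hsub h1
  rcases (show (0 : ℝ) ≤ s from hs).eq_or_lt with rfl | hs
  · exact ⟨θ, hθ, rfl⟩
  · exact absurd (H.rayPt_mem_basin hs θ) h2

theorem ofReal_mul_toCircle {r : ℝ} (hr : 0 < r) (θ : ℝ) :
    (r : ℂ) * (AddCircle.toCircle (θ : UnitAddCircle) : ℂ) =
      Complex.exp ⟨Real.log r, 2 * Real.pi * θ⟩ := by
  rw [AddCircle.toCircle_apply_mk, Circle.coe_exp, Complex.mk_eq_add_mul_I, Complex.exp_add,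
    ← Complex.ofReal_exp, Real.exp_log hr, div_one]

/-- Landing is defined with an arbitrary Böttcher map; by uniqueness all of them have the same
inverse, and the radius `r` corresponds to potential `log r`. -/
theorem rayLandsAt_iff (H : RayData f φ) {θ : ℝ} {z : ℂ} :
    RayLandsAt f (θ : UnitAddCircle) z ↔ rayPt f φ 0 θ = z := by
  have hlog : Tendsto Real.log (𝓝[>] 1) (𝓝[>] 0) := by
    refine tendsto_nhdsWithin_iff.2 ⟨?_, ?_⟩
    · have : Tendsto Real.log (𝓝 1) (𝓝 (Real.log 1)) :=
        (Real.continuousAt_log one_ne_zero).tendsto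
      rw [Real.log_one] at this
      exact this.mono_left nhdsWithin_le_nhds
    · filter_upwards [self_mem_nhdsWithin] with t ht using Real.log_pos ht
  have hlim : ∀ φ', IsBottcherMap f φ' → Tendsto (fun r : ℝ => Function.invFunOn φ' (basin f)
      ((r : ℂ) * (AddCircle.toCircle (θ : UnitAddCircle) : ℂ))) (𝓝[>] 1)
      (𝓝 (rayPt f φ 0 θ)) := by
    intro φ' h'
    refine ((H.tendsto_rayPt_zero θ).comp hlog).congr' ?_
    filter_upwards [self_mem_nhdsWithin] with r hr
    have hr : 1 < r := hr
    rw [ofReal_mul_toCircle (by linarith)]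
    exact (H.bottcher.Psi_eq H.two_le h' (Real.log_pos hr)).symm
  constructor
  · rintro ⟨φ', h', hz⟩
    exact tendsto_nhds_unique (hlim φ' h') hz
  · rintro rfl
    exact ⟨φ, H.bottcher, hlim φ H.bottcher⟩

theorem mem_externalRay_iff (H : RayData f φ) {θ : ℝ} {z : ℂ} :
    z ∈ externalRay f (θ : UnitAddCircle) ↔ ∃ s > 0, z = rayPt f φ s θ := by
  constructor
  · rintro ⟨φ', h', hz, r, hr, hφ⟩
    refine ⟨Real.log r, Real.log_pos hr, H.bottcher.eq_of_map_eq hz (H.rayPt_mem_basin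
      (Real.log_pos hr) θ) ?_⟩
    rw [rayPt_of_pos (Real.log_pos hr), H.bottcher.map_Psi (Real.log_pos hr),
      H.bottcher.eqOn H.two_le h' hz, hφ, ofReal_mul_toCircle (by linarith)]
  · rintro ⟨s, hs, rfl⟩
    refine ⟨φ, H.bottcher, H.rayPt_mem_basin hs θ, Real.exp s, Real.one_lt_exp_iff.2 hs, ?_⟩
    rw [rayPt_of_pos hs, H.bottcher.map_Psi hs, ofReal_mul_toCircle (Real.exp_pos s), Real.log_exp]

end RayData

end PolyDyn

/-! ### Topology of the puzzle graph -/

/-- The complement of a component of the complement of a closed connected set is connected. -/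
theorem isPreconnected_compl_component {Γ : Set ℂ} (hΓ : IsClosed Γ) (hΓc : IsPreconnected Γ)
    (hne : Γ.Nonempty) (a : ℂ) : IsPreconnected (connectedComponentIn Γᶜ a)ᶜ := by
  set Y := connectedComponentIn Γᶜ a with hY
  have hYo : IsOpen Y := hΓ.isOpen_compl.connectedComponentIn
  have hYΓ : Y ⊆ Γᶜ := connectedComponentIn_subset _ _
  obtain ⟨g, hg⟩ := hne
  have hΓY : Γ ⊆ Yᶜ := fun x hx hxY => hYΓ hxY hx
  refine isPreconnected_of_forall g fun x hx => ?_
  by_cases hxΓ : x ∈ Γ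
  · exact ⟨Γ, hΓY, hg, hxΓ, hΓc⟩
  set W := connectedComponentIn Γᶜ x with hW
  have hxW : x ∈ W := mem_connectedComponentIn hxΓ
  have hWY : W ⊆ Yᶜ := fun y hyW hyY => by
    have h1 : Y = connectedComponentIn Γᶜ y := connectedComponentIn_eq hyY
    have h2 : W = connectedComponentIn Γᶜ y := connectedComponentIn_eq hyW
    exact hx (by rw [h1, ← h2]; exact hxW)
  have hWcl : closure W ⊆ Yᶜ := closure_minimal hWY hYo.isClosed_compl
  have hWu : W ≠ univ := fun h =>
    connectedComponentIn_subset Γᶜ x (show g ∈ W by rw [h]; trivial) hg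
  -- Any other component has a frontier point, necessarily in `Γ`, so its closure attaches to `Γ`
  -- without meeting `Y`.
  obtain ⟨p, hp⟩ := nonempty_frontier_iff.2 ⟨⟨x, hxW⟩, hWu⟩
  have hpΓ : p ∈ Γ := by
    by_contra h
    exact ProperMap.notMem_of_mem_frontier_component hΓ.isOpen_compl hp h
  exact ⟨closure W ∪ Γ, union_subset hWcl hΓY, Or.inr hg, Or.inl (subset_closure hxW),
    isPreconnected_connectedComponentIn.closure.union p hp.1 hpΓ hΓc⟩

namespace PolyDyn

/-- An admissible set for a postcritically finite hyperbolic polynomial. -/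
structure PuzzleData (f : ℂ[X]) (φ : ℂ → ℂ) (Z : Set ℂ) : Prop extends RayData f φ where
  adm : IsAdmissible f Z

theorem finite_preimage_iterate {f : ℂ[X]} (hd : 2 ≤ f.natDegree) {Z : Set ℂ} (hZ : Z.Finite)
    (n : ℕ) : ((toMap f)^[n] ⁻¹' Z).Finite := by
  induction n with
  | zero => exact hZ
  | succ n ih =>
    rw [Function.iterate_succ, preimage_comp]
    refine ih.preimage' fun w _ => ?_
    have hne : f - C w ≠ 0 := by
      intro h
      have := congrArg Polynomial.natDegree (sub_eq_zero.1 h)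
      rw [natDegree_C] at this
      omega
    refine ((f - C w).roots.toFinset.finite_toSet).subset fun z hz => ?_
    have hz' : f.eval z = w := hz
    simp [hne, hz']

namespace PuzzleData

variable {f : ℂ[X]} {φ : ℂ → ℂ} {Z : Set ℂ}

theorem exists_rayPt_of_mem (H : PuzzleData f φ Z) {z : ℂ} (hz : z ∈ Z) :
    ∃ θ, rayPt f φ 0 θ = z := by
  obtain ⟨s, -, -, hs, -⟩ := H.adm.two_rays z hz
  obtain ⟨θ, rfl⟩ := QuotientAddGroup.mk_surjective s
  exact ⟨θ, H.rayLandsAt_iff.1 hs⟩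

theorem subset_julia (H : PuzzleData f φ Z) : Z ⊆ julia f := by
  intro z hz
  obtain ⟨θ, rfl⟩ := H.exists_rayPt_of_mem hz
  exact H.rayPt_zero_mem_julia θ

theorem notMem_basin (H : PuzzleData f φ Z) {z : ℂ} (hz : z ∈ Z) : z ∉ basin f :=
  ((mem_julia_iff H.two_le).1 (H.subset_julia hz)).2

theorem mem_puzzleGraph_iff_of_notMem_basin (H : PuzzleData f φ Z) {z : ℂ} (hz : z ∉ basin f)
    (n : ℕ) : z ∈ puzzleGraph f Z n ↔ (toMap f)^[n] z ∈ Z := by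
  have hz' : (toMap f)^[n] z ∉ basin f := fun h => hz ((iterate_mem_basin_iff n).1 h)
  constructor
  · rintro ((⟨w, hw, t, ht, φ', h1, h2, -⟩ | h) | h)
    · exact absurd h2 hz'
    · exact h
    · have h1 : green f ((toMap f)^[n] z) = 1 := h
      rw [green_of_notMem H.two_le hz'] at h1
      exact absurd h1 zero_ne_one
  · exact fun h => Or.inl (Or.inr h)

/-- In the coordinates potential and angle, the graph consists of whole closed rays and one
equipotential. This reduces questions about pieces to the set of angles landing on preimages of `Z`.
-/
theorem rayPt_mem_puzzleGraph_iff (H : PuzzleData f φ Z) {s : ℝ} (hs : 0 ≤ s) (θ : ℝ) (n : ℕ) :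
    rayPt f φ s θ ∈ puzzleGraph f Z n ↔
      (toMap f)^[n] (rayPt f φ 0 θ) ∈ Z ∨ (f.natDegree : ℝ) ^ n * s = 1 := by
  rcases hs.eq_or_lt with rfl | hs
  · rw [H.mem_puzzleGraph_iff_of_notMem_basin
      ((mem_julia_iff H.two_le).1 (H.rayPt_zero_mem_julia θ)).2]
    simp
  have hs' : 0 < (f.natDegree : ℝ) ^ n * s := mul_pos (H.degree_pow_pos n) hs
  rw [puzzleGraph, mem_preimage, H.iterate_rayPt hs.le, H.iterate_rayPt le_rfl, mul_zero]
  generalize (f.natDegree : ℝ) ^ n * s = s' at *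
  generalize (f.natDegree : ℝ) ^ n * θ = θ'
  constructor
  · rintro ((⟨w, hw, t, ht, hm⟩ | h) | h)
    · obtain ⟨θ₁, rfl⟩ := QuotientAddGroup.mk_surjective t
      obtain ⟨s₁, hs₁, he⟩ := H.mem_externalRay_iff.1 hm
      obtain ⟨-, k, rfl⟩ := H.rayPt_injective hs' hs₁ he
      rw [RayData.rayPt_add_int, H.rayLandsAt_iff.1 ht]
      exact Or.inl hw
    · exact absurd (H.rayPt_mem_basin hs' θ') (H.notMem_basin h)
    · exact Or.inr ((H.green_rayPt hs'.le θ').symm.trans h)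
  · rintro (h | h)
    · exact Or.inl (Or.inl ⟨_, h, (θ' : UnitAddCircle), H.rayLandsAt_iff.2 rfl,
        H.mem_externalRay_iff.2 ⟨s', hs', rfl⟩⟩)
    · exact Or.inr ((H.green_rayPt hs'.le θ').trans h)

theorem exists_rayPt_of_mem_puzzleGraph (H : PuzzleData f φ Z) {z : ℂ} {n : ℕ}
    (hz : z ∈ puzzleGraph f Z n) :
    ∃ s, 0 ≤ s ∧ ∃ θ ∈ Icc (0 : ℝ) 1, rayPt f φ s θ = z := by
  by_cases hb : z ∈ basin f
  · obtain ⟨s, hs, θ, hθ, h⟩ := H.exists_rayPt_eq hb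
    exact ⟨s, hs.le, θ, hθ, h⟩
  · rw [H.mem_puzzleGraph_iff_of_notMem_basin hb] at hz
    obtain ⟨θ, hθ, h⟩ := H.exists_rayPt_zero_eq
      ((iterate_mem_julia_iff H.two_le n).1 (H.subset_julia hz))
    exact ⟨0, le_rfl, θ, hθ, h⟩

theorem continuous_rayPt_zero (H : RayData f φ) : Continuous (rayPt f φ 0) := by
  rw [← continuousOn_univ]
  exact H.continuousOn_rayPt.comp (f := fun θ : ℝ => ((0 : ℝ), θ)) (by fun_prop)
    (fun θ _ => show (0 : ℝ) ≤ 0 from le_rfl)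

/-- The angles whose rays land on the `n`-th preimage of `Z`. -/
theorem isClosed_angles (H : PuzzleData f φ Z) (n : ℕ) :
    IsClosed {θ : ℝ | (toMap f)^[n] (rayPt f φ 0 θ) ∈ Z} :=
  H.adm.finite.isClosed.preimage
    ((differentiable_iterate f n).continuous.comp (continuous_rayPt_zero H.toRayData))

/-- At depth `0` the graph is a union of closed rays over a closed set of angles together with a
compact equipotential; preimages preserve closedness. -/
theorem isClosed_puzzleGraph (H : PuzzleData f φ Z) (n : ℕ) : IsClosed (puzzleGraph f Z n) := by
  have h0 : IsClosed (puzzleGraph f Z 0) := by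
    have : puzzleGraph f Z 0 = (fun p : ℝ × ℝ => rayPt f φ p.1 p.2) ''
          (Ici 0 ×ˢ (Icc 0 1 ∩ {θ : ℝ | (toMap f)^[0] (rayPt f φ 0 θ) ∈ Z})) ∪
        (fun p : ℝ × ℝ => rayPt f φ p.1 p.2) '' ({1} ×ˢ Icc 0 1) := by
      apply Subset.antisymm
      · intro z hz
        obtain ⟨s, hs, θ, hθ, rfl⟩ := H.exists_rayPt_of_mem_puzzleGraph hz
        rcases (H.rayPt_mem_puzzleGraph_iff hs θ 0).1 hz with h | h
        · exact Or.inl ⟨(s, θ), ⟨hs, hθ, h⟩, rfl⟩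
        · rw [pow_zero, one_mul] at h
          exact Or.inr ⟨(s, θ), ⟨h, hθ⟩, rfl⟩
      · rintro _ (⟨⟨s, θ⟩, ⟨hs, hθ, h⟩, rfl⟩ | ⟨⟨s, θ⟩, ⟨hs, hθ⟩, rfl⟩)
        · exact (H.rayPt_mem_puzzleGraph_iff hs θ 0).2 (Or.inl h)
        · obtain rfl : s = 1 := hs
          exact (H.rayPt_mem_puzzleGraph_iff zero_le_one θ 0).2 (Or.inr (by simp))
    rw [this]
    refine (H.isClosed_image_rayPt (isClosed_Icc.inter (H.isClosed_angles 0))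
      inter_subset_left).union ?_
    refine ((isCompact_singleton.prod isCompact_Icc).image_of_continuousOn
      (H.continuousOn_rayPt.mono ?_)).isClosed
    rintro ⟨s, θ⟩ ⟨hs, -⟩
    obtain rfl : s = 1 := hs
    exact zero_le_one (α := ℝ)
  exact h0.preimage (differentiable_iterate f n).continuous

theorem isPreconnected_image_rayPt (H : RayData f φ) {S T : Set ℝ} (hS : IsPreconnected S)
    (hS0 : S ⊆ Ici 0) (hT : IsPreconnected T) :
    IsPreconnected ((fun p : ℝ × ℝ => rayPt f φ p.1 p.2) '' (S ×ˢ T)) :=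
  (hS.prod hT).image _ (H.continuousOn_rayPt.mono fun _ hp => hS0 hp.1)

theorem rayPt_mem_puzzleGraph_of_eq (H : PuzzleData f φ Z) (n : ℕ) (θ : ℝ) :
    rayPt f φ (1 / (f.natDegree : ℝ) ^ n) θ ∈ puzzleGraph f Z n :=
  (H.rayPt_mem_puzzleGraph_iff (one_div_pos.2 (H.degree_pow_pos n)).le θ n).2
    (Or.inr (mul_one_div_cancel (H.degree_pow_pos n).ne'))

/-- The equipotential is connected and every closed ray of the graph crosses it. Preimages of `Z`
create no stray points, because every point of the Julia set is the landing point of some ray. -/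
theorem isPreconnected_puzzleGraph (H : PuzzleData f φ Z) (n : ℕ) :
    IsPreconnected (puzzleGraph f Z n) := by
  have hD := H.degree_pow_pos n
  set r := 1 / (f.natDegree : ℝ) ^ n with hr
  have hr0 : 0 < r := one_div_pos.2 hD
  set E := (fun p : ℝ × ℝ => rayPt f φ p.1 p.2) '' ({r} ×ˢ univ) with hE
  have hEc : IsPreconnected E := isPreconnected_image_rayPt H.toRayData isPreconnected_singleton
    (by simpa using hr0.le) isPreconnected_univ
  have hEΓ : E ⊆ puzzleGraph f Z n := by
    rintro _ ⟨⟨s, θ⟩, ⟨hs, -⟩, rfl⟩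
    obtain rfl : s = r := hs
    exact H.rayPt_mem_puzzleGraph_of_eq n θ
  have hmemE : ∀ θ, rayPt f φ r θ ∈ E := fun θ => ⟨(r, θ), ⟨rfl, trivial⟩, rfl⟩
  refine isPreconnected_of_forall (rayPt f φ r 0) fun z hz => ?_
  obtain ⟨s, hs, θ, hθ, rfl⟩ := H.exists_rayPt_of_mem_puzzleGraph hz
  rcases (H.rayPt_mem_puzzleGraph_iff hs θ n).1 hz with h | h
  · refine ⟨E ∪ (fun p : ℝ × ℝ => rayPt f φ p.1 p.2) '' (Ici 0 ×ˢ {θ}), union_subset hEΓ ?_,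
      Or.inl (hmemE 0), Or.inr ⟨(s, θ), ⟨hs, rfl⟩, rfl⟩,
      hEc.union (rayPt f φ r θ) (hmemE θ) ⟨(r, θ), ⟨hr0.le, rfl⟩, rfl⟩
        (isPreconnected_image_rayPt H.toRayData isPreconnected_Ici subset_rfl
          isPreconnected_singleton)⟩
    rintro _ ⟨⟨s', θ'⟩, ⟨hs', hθ'⟩, rfl⟩
    obtain rfl : θ' = θ := hθ'
    exact (H.rayPt_mem_puzzleGraph_iff hs' θ' n).2 (Or.inl h)
  · obtain rfl : s = r := by rw [hr]; field_simp; linarith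
    exact ⟨E, hEΓ, hmemE 0, hmemE θ, hEc⟩

end PuzzleData

/-! ### Puzzle pieces and their images -/

namespace IsPuzzlePiece

variable {f : ℂ[X]} {φ : ℂ → ℂ} {Z Y : Set ℂ} {n : ℕ}

theorem isPreconnected (hY : IsPuzzlePiece f Z n Y) : IsPreconnected Y := by
  obtain ⟨⟨a, -, rfl⟩, -⟩ := hY
  exact isPreconnected_connectedComponentIn

theorem nonempty (hY : IsPuzzlePiece f Z n Y) : Y.Nonempty := by
  obtain ⟨⟨a, ha, rfl⟩, -⟩ := hY
  exact ⟨a, mem_connectedComponentIn ha⟩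

theorem notMem_puzzleGraph (hY : IsPuzzlePiece f Z n Y) {x : ℂ} (hx : x ∈ Y) :
    x ∉ puzzleGraph f Z n := by
  obtain ⟨⟨a, -, rfl⟩, -⟩ := hY
  exact connectedComponentIn_subset _ _ hx

theorem isOpen (hY : IsPuzzlePiece f Z n Y) (H : PuzzleData f φ Z) : IsOpen Y := by
  obtain ⟨⟨a, -, rfl⟩, -⟩ := hY
  exact (H.isClosed_puzzleGraph n).isOpen_compl.connectedComponentIn

theorem frontier_subset (hY : IsPuzzlePiece f Z n Y) (H : PuzzleData f φ Z) :
    frontier Y ⊆ puzzleGraph f Z n := by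
  obtain ⟨⟨a, -, rfl⟩, -⟩ := hY
  intro x hx
  by_contra h
  exact ProperMap.notMem_of_mem_frontier_component (H.isClosed_puzzleGraph n).isOpen_compl hx h

theorem eq_component (hY : IsPuzzlePiece f Z n Y) {x : ℂ} (hx : x ∈ Y) :
    Y = connectedComponentIn (puzzleGraph f Z n)ᶜ x := by
  obtain ⟨⟨a, -, rfl⟩, -⟩ := hY
  exact connectedComponentIn_eq hx

theorem eq_of_mem {Y' : Set ℂ} (hY : IsPuzzlePiece f Z n Y) (hY' : IsPuzzlePiece f Z n Y') {x : ℂ}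
    (hx : x ∈ Y) (hx' : x ∈ Y') : Y = Y' :=
  (hY.eq_component hx).trans (hY'.eq_component hx').symm

theorem subset_of_isPreconnected (hY : IsPuzzlePiece f Z n Y) {S : Set ℂ} (hS : IsPreconnected S)
    (hSΓ : ∀ x ∈ S, x ∉ puzzleGraph f Z n) {x : ℂ} (hxS : x ∈ S) (hx : x ∈ Y) : S ⊆ Y := by
  rw [hY.eq_component hx]
  exact hS.subset_connectedComponentIn hxS hSΓ

theorem isPreconnected_compl (hY : IsPuzzlePiece f Z n Y) (H : PuzzleData f φ Z) :
    IsPreconnected Yᶜ := by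
  obtain ⟨⟨a, -, rfl⟩, -⟩ := hY
  exact isPreconnected_compl_component (H.isClosed_puzzleGraph n) (H.isPreconnected_puzzleGraph n)
    ⟨_, H.rayPt_mem_puzzleGraph_of_eq n 0⟩ a

theorem angle_notMem (hY : IsPuzzlePiece f Z n Y) (H : PuzzleData f φ Z) {s θ : ℝ} (hs : 0 ≤ s)
    (h : rayPt f φ s θ ∈ Y) : (toMap f)^[n] (rayPt f φ 0 θ) ∉ Z := fun h' =>
  hY.notMem_puzzleGraph h ((H.rayPt_mem_puzzleGraph_iff hs θ n).2 (Or.inl h'))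

/-- Points of a puzzle piece lie below the bounding equipotential. -/
theorem potential_lt (hY : IsPuzzlePiece f Z n Y) (H : PuzzleData f φ Z) {s θ : ℝ} (hs : 0 ≤ s)
    (h : rayPt f φ s θ ∈ Y) : (f.natDegree : ℝ) ^ n * s < 1 := by
  by_contra! hge
  have hD := H.degree_pow_pos n
  have hne : (f.natDegree : ℝ) ^ n * s ≠ 1 := fun h' =>
    hY.notMem_puzzleGraph h ((H.rayPt_mem_puzzleGraph_iff hs θ n).2 (Or.inr h'))
  have hgt := lt_of_le_of_ne hge hne.symm
  -- Above the equipotential, the rest of the ray avoids the graph and would lie in the bounded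
  -- piece.
  have hsub : (fun p : ℝ × ℝ => rayPt f φ p.1 p.2) '' (Ici s ×ˢ {θ}) ⊆ Y := by
    refine hY.subset_of_isPreconnected (PuzzleData.isPreconnected_image_rayPt H.toRayData
      isPreconnected_Ici (Ici_subset_Ici.2 hs) isPreconnected_singleton) ?_
      ⟨(s, θ), ⟨self_mem_Ici, rfl⟩, rfl⟩ h
    rintro _ ⟨⟨s', θ'⟩, ⟨hs', hθ'⟩, rfl⟩
    obtain rfl : θ' = θ := hθ'
    have hs'' : s ≤ s' := hs'
    show rayPt f φ s' θ' ∉ _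
    rw [H.rayPt_mem_puzzleGraph_iff (hs.trans hs'')]
    rintro (h' | h')
    · exact hY.angle_notMem H hs h h'
    · have := mul_le_mul_of_nonneg_left hs'' hD.le
      linarith
  obtain ⟨R, hR⟩ := hY.2.exists_norm_le
  obtain ⟨S, -, hS⟩ := H.exists_lt_norm_rayPt R
  have h1 := hS (max s (S + 1)) θ (lt_of_lt_of_le (lt_add_one S) (le_max_right _ _))
  exact absurd (hR _ (hsub ⟨(max s (S + 1), θ), ⟨mem_Ici.2 (le_max_left _ _), rfl⟩, rfl⟩)) (not_le.2 h1)

/-- A box of low potential avoiding the angles of the puzzle graph lies in a single piece. -/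
theorem rayPt_mem_of_forall (hY : IsPuzzlePiece f Z n Y) (H : PuzzleData f φ Z) {I : Set ℝ}
    (hI : IsPreconnected I) (hIZ : ∀ θ ∈ I, (toMap f)^[n] (rayPt f φ 0 θ) ∉ Z) {s θ : ℝ}
    (hs : 0 ≤ s) (hθ : θ ∈ I) (h : rayPt f φ s θ ∈ Y) {s' θ' : ℝ} (hs' : 0 ≤ s')
    (hs'1 : (f.natDegree : ℝ) ^ n * s' < 1) (hθ' : θ' ∈ I) : rayPt f φ s' θ' ∈ Y := by
  have hD := H.degree_pow_pos n
  have hmem : ∀ t : ℝ, (f.natDegree : ℝ) ^ n * t < 1 → t < 1 / (f.natDegree : ℝ) ^ n :=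
    fun t ht => by rwa [lt_div_iff₀' hD]
  refine hY.subset_of_isPreconnected
    (PuzzleData.isPreconnected_image_rayPt H.toRayData
      (isPreconnected_Ico (a := 0) (b := 1 / (f.natDegree : ℝ) ^ n)) (fun _ ht => ht.1) hI) ?_
    ⟨(s, θ), ⟨⟨hs, hmem s (hY.potential_lt H hs h)⟩, hθ⟩, rfl⟩ h
    ⟨(s', θ'), ⟨⟨hs', hmem s' hs'1⟩, hθ'⟩, rfl⟩
  rintro _ ⟨⟨t, τ⟩, ⟨ht, hτ⟩, rfl⟩
  show rayPt f φ t τ ∉ _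
  rw [H.rayPt_mem_puzzleGraph_iff ht.1]
  rintro (h' | h')
  · exact hIZ τ hτ h'
  · have := (lt_div_iff₀' hD).1 ht.2
    exact this.ne h'

/-- Rays persist at greater depth because `f(Z) ⊆ Z`. The equipotential does not, but a piece of
depth `n + 1` lies below its own lower equipotential and misses that of depth `n`. -/
theorem notMem_puzzleGraph_of_succ (hY : IsPuzzlePiece f Z (n + 1) Y) (H : PuzzleData f φ Z)
    {x : ℂ} (hx : x ∈ Y) : x ∉ puzzleGraph f Z n := by
  intro hΓ
  obtain ⟨s, hs, θ, -, rfl⟩ := H.exists_rayPt_of_mem_puzzleGraph hΓ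
  rcases (H.rayPt_mem_puzzleGraph_iff hs θ n).1 hΓ with h | h
  · refine hY.angle_notMem H hs hx ?_
    rw [Function.iterate_succ_apply']
    exact H.adm.mapsTo h
  · have h1 := hY.potential_lt H hs hx
    rw [pow_succ', mul_assoc, h, mul_one] at h1
    exact absurd h1 (not_lt.2 H.one_lt_degree.le)

theorem subset_of_succ {Y' : Set ℂ} (hY : IsPuzzlePiece f Z (n + 1) Y)
    (hY' : IsPuzzlePiece f Z n Y') (H : PuzzleData f φ Z) {x : ℂ} (hx : x ∈ Y) (hx' : x ∈ Y') :
    Y ⊆ Y' :=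
  hY'.subset_of_isPreconnected hY.isPreconnected
    (fun _ h => hY.notMem_puzzleGraph_of_succ H h) hx hx'

/-- The image is open, and relatively closed in the component containing it, since the frontier of
`Y` is mapped into the graph of depth `n`. -/
theorem image (hY : IsPuzzlePiece f Z (n + 1) Y) (H : PuzzleData f φ Z) :
    IsPuzzlePiece f Z n (toMap f '' Y) := by
  have hc : Continuous (toMap f) := (differentiable_toMap f).continuous
  obtain ⟨y, hy⟩ := hY.nonempty
  have hΓ : ∀ x, toMap f x ∈ puzzleGraph f Z n ↔ x ∈ puzzleGraph f Z (n + 1) := fun x => by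
    simp only [puzzleGraph, mem_preimage, Function.iterate_succ_apply]
  have hyΓ : toMap f y ∈ (puzzleGraph f Z n)ᶜ := fun h => hY.notMem_puzzleGraph hy ((hΓ y).1 h)
  have hcomp : IsCompact (closure Y) := hY.2.isCompact_closure
  have hcl : closure (toMap f '' Y) ⊆ toMap f '' closure Y :=
    closure_minimal (image_mono subset_closure) (hcomp.image hc).isClosed
  refine ⟨⟨toMap f y, hyΓ, Subset.antisymm ?_ ?_⟩,
    (hcomp.image hc).isBounded.subset (image_mono subset_closure)⟩
  · refine (hY.isPreconnected.image _ hc.continuousOn).subset_connectedComponentIn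
      (mem_image_of_mem _ hy) ?_
    rintro _ ⟨x, hx, rfl⟩ h
    exact hY.notMem_puzzleGraph hx ((hΓ x).1 h)
  · refine isPreconnected_connectedComponentIn.subset_of_closure_inter_subset
      (isOpenMap_toMap H.two_le _ (hY.isOpen H))
      ⟨toMap f y, mem_connectedComponentIn hyΓ, mem_image_of_mem _ hy⟩ ?_
    rintro w ⟨hw, hwW⟩
    obtain ⟨x, hx, rfl⟩ := hcl hw
    by_cases hxY : x ∈ Y
    · exact mem_image_of_mem _ hxY
    have hxf : x ∈ frontier Y := by
      rw [(hY.isOpen H).frontier_eq]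
      exact ⟨hx, hxY⟩
    exact absurd ((hΓ x).2 (hY.frontier_subset H hxf)) (connectedComponentIn_subset _ _ hwW)

theorem image_iterate (H : PuzzleData f φ Z) (k : ℕ) (hY : IsPuzzlePiece f Z (n + k) Y) :
    IsPuzzlePiece f Z n ((toMap f)^[k] '' Y) := by
  induction k generalizing Y with
  | zero => simpa using hY
  | succ k ih =>
    rw [Function.iterate_succ, image_comp]
    exact ih (IsPuzzlePiece.image (n := n + k) hY H)

theorem closure_image_iterate_inter (H : PuzzleData f φ Z) (k : ℕ)
    (h : (closure Y ∩ Z).Nonempty) : (closure ((toMap f)^[k] '' Y) ∩ Z).Nonempty := by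
  obtain ⟨z, hz, hzZ⟩ := h
  exact ⟨(toMap f)^[k] z, image_closure_subset_closure_image
    (differentiable_iterate f k).continuous (mem_image_of_mem _ hz), H.adm.mapsTo.iterate k hzZ⟩

/-- An iterate without critical points on a puzzle piece is injective there. -/
theorem injOn_iterate (H : PuzzleData f φ Z) (k : ℕ) (hY : IsPuzzlePiece f Z (n + k) Y)
    (hcrit : ∀ x ∈ Y, deriv (toMap f)^[k] x ≠ 0) : InjOn (toMap f)^[k] Y := by
  have hY' := image_iterate H k hY
  refine ProperMap.injOn (differentiable_iterate f k) (hY.isOpen H) hY.isPreconnected hY.2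
    (hY'.isOpen H) hY'.isPreconnected hY'.2 (hY'.isPreconnected_compl H) (mapsTo_image _ _) ?_
    hcrit
  intro x hx hx'
  refine hY'.notMem_puzzleGraph hx' ?_
  have := hY.frontier_subset H hx
  rwa [puzzleGraph, mem_preimage, Function.iterate_add_apply] at this

/-- Potentials on a piece of depth `n` are below `d^(-n)`, while a basin point has a neighbourhood
where the potential is bounded below by a positive number. -/
theorem notMem_basin_of_forall_mem_closure (H : PuzzleData f φ Z) {Y : ℕ → Set ℂ}
    (hY : ∀ n, IsPuzzlePiece f Z n (Y n)) {x : ℂ} (hx : ∀ n, x ∈ closure (Y n)) : x ∉ basin f := by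
  intro hb
  have hopen := isOpen_basin (f := f) H.two_le
  have hφ : ContinuousAt φ x := (H.bottcher.differentiableOn.continuousOn).continuousAt
    (hopen.mem_nhds hb)
  have h1 := H.bottcher.one_lt_norm hb
  have hlog : ContinuousAt (fun z => Real.log ‖φ z‖) x :=
    hφ.norm.log (by linarith)
  have hpos : 0 < Real.log ‖φ x‖ := Real.log_pos h1
  obtain ⟨n, hn⟩ := pow_unbounded_of_one_lt (2 / Real.log ‖φ x‖) H.one_lt_degree
  have hev : ∀ᶠ z in 𝓝 x, z ∈ basin f ∧ Real.log ‖φ x‖ / 2 < Real.log ‖φ z‖ :=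
    (hopen.eventually_mem hb).and (hlog.eventually_const_lt (by linarith))
  obtain ⟨y, ⟨hyb, hylog⟩, hyY⟩ := (mem_closure_iff_nhds.1 (hx n)) _ hev
  obtain ⟨s, hs, θ, -, rfl⟩ := H.exists_rayPt_eq hyb
  have h2 := (hY n).potential_lt H hs.le hyY
  rw [← H.bottcher.green_of_mem H.two_le hyb, H.green_rayPt hs.le] at hylog
  rw [div_lt_iff₀ hpos] at hn
  have := mul_lt_mul_of_pos_left hylog (H.degree_pow_pos n)
  linarith

end IsPuzzlePiece

end PolyDyn

/-! ### Deep pieces touching `Z` contain no critical point -/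

/-- A decreasing sequence of connected sets through a point of a closed set `L` whose closures
accumulate only countably often outside `L` eventually avoids any given point outside `L`. -/
theorem exists_notMem_closure_of_countable {Y : ℕ → Set ℂ} (hYc : ∀ n, IsPreconnected (Y n))
    (hYb : Bornology.IsBounded (Y 0)) (hanti : Antitone Y) {L : Set ℂ} (hL : IsClosed L)
    {c z : ℂ} (hc : c ∈ L) (hcY : ∀ n, c ∈ Y n) (hcount : ((⋂ n, closure (Y n)) \ L).Countable)
    (hz : z ∉ L) : ∃ n, z ∉ closure (Y n) := by
  by_contra! hzY
  have hLne : L.Nonempty := ⟨c, hc⟩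
  have htpos : 0 < Metric.infDist z L := (hL.notMem_iff_infDist_pos hLne).1 hz
  -- Each connected closure contains `c` and `z`, so it meets every level set of the distance to `L`
  -- in between; by compactness so does the intersection. An interval of values would then be
  -- countable.
  have hsub : Ioo 0 (Metric.infDist z L) ⊆
      (fun x => Metric.infDist x L) '' ((⋂ n, closure (Y n)) \ L) := by
    intro t ht
    have hcont : Continuous fun x => Metric.infDist x L := Metric.continuous_infDist_pt L
    have hne : (⋂ n, closure (Y n) ∩ {x | Metric.infDist x L = t}).Nonempty := by
      have hcl : IsClosed {x | Metric.infDist x L = t} := isClosed_singleton.preimage hcont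
      apply IsCompact.nonempty_iInter_of_sequence_nonempty_isCompact_isClosed
      · exact fun n => inter_subset_inter_left _ (closure_mono (hanti n.le_succ))
      · intro n
        obtain ⟨x, hx, hxt⟩ := (hYc n).closure.intermediate_value (subset_closure (hcY n)) (hzY n)
          hcont.continuousOn ⟨by
            show Metric.infDist c L ≤ t
            rw [Metric.infDist_zero_of_mem hc]
            exact ht.1.le, ht.2.le⟩
        exact ⟨x, hx, hxt⟩
      · exact hYb.isCompact_closure.inter_right hcl
      · exact fun n => isClosed_closure.inter hcl
    obtain ⟨x, hx⟩ := hne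
    rw [mem_iInter] at hx
    have hxt : Metric.infDist x L = t := (hx 0).2
    refine ⟨x, ⟨mem_iInter.2 fun n => (hx n).1, fun hxL => ?_⟩, hxt⟩
    rw [Metric.infDist_zero_of_mem hxL] at hxt
    exact ht.1.ne hxt
  exact not_le.2 htpos (Cardinal.Real.Ioo_countable_iff.1 ((hcount.image _).mono hsub))

namespace PolyDyn

namespace PuzzleData

variable {f : ℂ[X]} {φ : ℂ → ℂ} {Z : Set ℂ}

/-- Deep pieces around a critical point stay away from `Z`. -/
theorem exists_forall_critical_notMem (H : PuzzleData f φ Z) {c : ℂ} (hc : ∃ Y : ℕ → Set ℂ,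
    (∀ n, IsPuzzlePiece f Z n (Y n) ∧ c ∈ Y n) ∧ ⋂ n, Y n = closure (fatouComponentAt f c)) :
    ∃ N, ∀ n, N ≤ n → ∀ Y, IsPuzzlePiece f Z n Y → (closure Y ∩ Z).Nonempty → c ∉ Y := by
  obtain ⟨Y, hY, hL⟩ := hc
  have hanti : Antitone Y := antitone_nat_of_succ_le fun n =>
    (hY (n + 1)).1.subset_of_succ (hY n).1 H (hY (n + 1)).2 (hY n).2
  -- A point in all the closures but outside some `Y m` is a frontier point of `Y m` off the basin,
  -- hence a preimage of `Z` under `f^m`.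
  have hcount : ((⋂ n, closure (Y n)) \ ⋂ n, Y n).Countable := by
    refine (countable_iUnion fun m =>
      (finite_preimage_iterate H.two_le H.adm.finite m).countable).mono ?_
    rintro x ⟨hx, hxL⟩
    rw [mem_iInter] at hx hxL
    push Not at hxL
    obtain ⟨m, hm⟩ := hxL
    have hxf : x ∈ frontier (Y m) := by
      rw [((hY m).1.isOpen H).frontier_eq]
      exact ⟨hx m, hm⟩
    have hxb := IsPuzzlePiece.notMem_basin_of_forall_mem_closure H (fun n => (hY n).1) hx
    exact mem_iUnion.2 ⟨m, (H.mem_puzzleGraph_iff_of_notMem_basin hxb m).1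
      ((hY m).1.frontier_subset H hxf)⟩
  -- The hypothesis on `c` enters only through the closedness of `⋂ n, Y n`; this set misses `Z`
  -- because pieces avoid the graph.
  have hz : ∀ z ∈ Z, ∃ n, z ∉ closure (Y n) := fun z hz =>
    exists_notMem_closure_of_countable (fun n => (hY n).1.isPreconnected) (hY 0).1.2 hanti
      (by rw [hL]; exact isClosed_closure) (mem_iInter.2 fun n => (hY n).2) (fun n => (hY n).2)
      hcount fun h => (hY 0).1.notMem_puzzleGraph (mem_iInter.1 h 0)
        ((H.mem_puzzleGraph_iff_of_notMem_basin (H.notMem_basin hz) 0).2 hz)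
  choose! N hN using hz
  obtain ⟨M, hM⟩ := (H.adm.finite.image N).bddAbove
  refine ⟨M, fun n hn Y' hY' ⟨z, hzY, hzZ⟩ hcY => hN z hzZ ?_⟩
  have h1 : N z ≤ n := (hM (mem_image_of_mem N hzZ)).trans hn
  have h2 : Y' = Y n := hY'.eq_of_mem (hY n).1 hcY (hY n).2
  exact closure_mono (hanti h1) (h2 ▸ hzY)

theorem finite_critSet (H : RayData f φ) : (critSet f).Finite := by
  have hne : f.derivative ≠ 0 := fun h => by
    have := Polynomial.derivative_eq_zero.1 h
    have := H.two_le
    omega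
  refine f.derivative.roots.toFinset.finite_toSet.subset fun z hz => ?_
  have hz' : f.derivative.eval z = 0 := hz
  simp [hne, hz']

/-- Deep pieces touching `Z` contain no critical point. -/
theorem exists_depth_critical_free (H : PuzzleData f φ Z) (hcrit : CriticalPiecesShrink f Z) :
    ∃ N, ∀ n, N ≤ n → ∀ Y, IsPuzzlePiece f Z n Y → (closure Y ∩ Z).Nonempty →
      ∀ c ∈ critSet f, c ∉ Y := by
  choose! N hN using fun c (hc : c ∈ critSet f) => H.exists_forall_critical_notMem (hcrit c hc)
  obtain ⟨M, hM⟩ := ((finite_critSet H.toRayData).image N).bddAbove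
  exact ⟨M, fun n hn Y hY hZ c hc =>
    hN c hc n ((hM (mem_image_of_mem N hc)).trans hn) Y hY hZ⟩

/-- A critical point of `f^k` in `Y` would put a critical point of `f` in some `f^i(Y)` with `i <
k`, which is a piece of depth above `N` still touching `Z`. -/
theorem injOn_iterate_of_critical_free (H : PuzzleData f φ Z) {N : ℕ}
    (hN : ∀ n, N ≤ n → ∀ Y, IsPuzzlePiece f Z n Y → (closure Y ∩ Z).Nonempty →
      ∀ c ∈ critSet f, c ∉ Y) (k : ℕ) {Y : Set ℂ} (hY : IsPuzzlePiece f Z (N + k) Y)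
    (hYZ : (closure Y ∩ Z).Nonempty) : InjOn (toMap f)^[k] Y := by
  refine IsPuzzlePiece.injOn_iterate H k hY fun x hx h0 => ?_
  obtain ⟨i, hi, hc⟩ := exists_critical_of_deriv_iterate_eq_zero h0
  have hk : N + k = N + (k - i) + i := by omega
  rw [hk] at hY
  exact hN _ (by omega) _ (IsPuzzlePiece.image_iterate H i hY)
    (IsPuzzlePiece.closure_image_iterate_inter H i hYZ) _ hc (mem_image_of_mem _ hx)

/-! ### Finiteness of the set of rays landing on preimages of `Z` -/

/-- Rays landing together whose images are close are themselves close. -/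
theorem exists_dvd_of_near (H : PuzzleData f φ Z) :
    ∃ η > 0, ∀ θ θ' : ℝ, rayPt f φ 0 θ ∈ Z → rayPt f φ 0 θ = rayPt f φ 0 θ' → ∀ k : ℤ,
      |f.natDegree * θ - f.natDegree * θ' - k| < f.natDegree * η →
        (f.natDegree : ℤ) ∣ k := by
  have hd : (0 : ℝ) < f.natDegree := zero_lt_one.trans H.one_lt_degree
  have hloc : ∀ z ∈ Z, ∃ η > 0, ∀ θ θ' : ℝ, rayPt f φ 0 θ = z → rayPt f φ 0 θ' = z → ∀ k : ℤ,
      |f.natDegree * θ - f.natDegree * θ' - k| < f.natDegree * η →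
        (f.natDegree : ℤ) ∣ k := by
    intro z hz
    have hdz : deriv (toMap f) z ≠ 0 := by
      rw [deriv_toMap]
      exact fun h => critical_iterate_notMem_julia H.two_le H.hyperbolic h 0 (H.subset_julia hz)
    obtain ⟨U, hU, hzU, hinj⟩ := ProperMap.exists_nhds_injOn (differentiable_toMap f) hdz
    obtain ⟨δ, hδ, hball⟩ := Metric.isOpen_iff.1 hU z hzU
    obtain ⟨η, hη, hu⟩ := H.exists_dist_rayPt_le (half_pos hδ)
    refine ⟨η, hη, fun θ θ' hθ hθ' k hk => ?_⟩
    have h1 : |θ - (θ' + k / f.natDegree)| < η := by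
      have : (f.natDegree : ℝ) * θ - f.natDegree * θ' - k =
          f.natDegree * (θ - (θ' + k / f.natDegree)) := by
        field_simp
        ring
      rw [this, abs_mul, abs_of_pos hd] at hk
      exact lt_of_mul_lt_mul_left hk hd.le
    have hs : 0 < η / 2 := half_pos hη
    have hs' : η / 2 < η := half_lt_self hη
    have hmem : ∀ α, dist (rayPt f φ (η / 2) α) z ≤ δ / 2 → rayPt f φ (η / 2) α ∈ U :=
      fun α hα => hball (Metric.mem_ball.2 (hα.trans_lt (half_lt_self hδ)))
    have hA := hmem (θ' + k / f.natDegree) (by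
      rw [← hθ]
      exact hu _ _ _ _ hs.le hs' le_rfl hη (by rwa [abs_sub_comm]))
    have hB := hmem θ' (by
      rw [← hθ']
      exact hu _ _ _ _ hs.le hs' le_rfl hη (by simpa using hη))
    -- The angles `θ' + k / d` and `θ'` have the same image modulo `1`, and at potential `η / 2`
    -- both rays lie where `f` is injective; so the angles agree modulo `1`, that is `d ∣ k`.
    have heq := hinj hA hB (by
      rw [H.toMap_rayPt hs.le, H.toMap_rayPt hs.le, mul_add, mul_div_cancel₀ _ hd.ne',
        RayData.rayPt_add_int])
    obtain ⟨-, k', hk'⟩ := H.rayPt_injective hs hs heq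
    refine ⟨k', ?_⟩
    have : (k : ℝ) / f.natDegree = k' := by linarith
    rw [div_eq_iff hd.ne', mul_comm] at this
    exact_mod_cast this
  choose! η hη hη' using hloc
  have hev : ∀ᶠ t in 𝓝[>] (0 : ℝ), ∀ z ∈ Z, t < η z :=
    (eventually_all_finite H.adm.finite).2 fun z hz =>
      nhdsWithin_le_nhds (eventually_lt_nhds (hη z hz))
  obtain ⟨t, ht, ht0⟩ := (hev.and self_mem_nhdsWithin).exists
  have ht0' : 0 < t := ht0
  refine ⟨t, ht0', fun θ θ' hθ hθθ' k hk => hη' _ hθ θ θ' rfl hθθ'.symm k (hk.trans ?_)⟩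
  exact mul_lt_mul_of_pos_left (ht _ hθ) hd

/-- Closeness modulo `1` is pulled back one iterate at a time, gaining a factor `d` each time.
Landing points remain in `Z` and remain common, so `exists_dvd_of_near` applies at every step. -/
theorem exists_near_of_iterate_near (H : PuzzleData f φ Z) :
    ∃ η > 0, ∀ (n : ℕ) (θ θ' : ℝ), rayPt f φ 0 θ ∈ Z → rayPt f φ 0 θ = rayPt f φ 0 θ' → ∀ k : ℤ,
      |(f.natDegree : ℝ) ^ n * θ - (f.natDegree : ℝ) ^ n * θ' - k| < η →
        ∃ k' : ℤ, |θ - θ' - k'| < η / (f.natDegree : ℝ) ^ n := by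
  have hd : (0 : ℝ) < f.natDegree := zero_lt_one.trans H.one_lt_degree
  obtain ⟨η, hη, h⟩ := H.exists_dvd_of_near
  refine ⟨η, hη, fun n => ?_⟩
  induction n with
  | zero => exact fun θ θ' _ _ k hk => ⟨k, by simpa using hk⟩
  | succ n ih =>
    intro θ θ' hθ hθθ' k hk
    have hland : ∀ α, (toMap f) (rayPt f φ 0 α) = rayPt f φ 0 (f.natDegree * α) := fun α => by
      rw [H.toMap_rayPt le_rfl, mul_zero]
    obtain ⟨k₁, hk₁⟩ := ih (f.natDegree * θ) (f.natDegree * θ')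
      (by rw [← hland]; exact H.adm.mapsTo hθ) (by rw [← hland, ← hland, hθθ']) k
      (by convert hk using 3; ring)
    have hlt : |f.natDegree * θ - f.natDegree * θ' - k₁| < f.natDegree * η := by
      refine hk₁.trans_le ((div_le_self hη.le (one_le_pow₀ H.one_lt_degree.le)).trans ?_)
      exact le_mul_of_one_le_left hη.le H.one_lt_degree.le
    obtain ⟨k', rfl⟩ := h θ θ' hθ hθθ' k₁ hlt
    refine ⟨k', ?_⟩
    have he : (f.natDegree : ℝ) * θ - f.natDegree * θ' - ((f.natDegree * k' : ℤ) : ℝ) =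
        f.natDegree * (θ - θ' - k') := by
      push_cast
      ring
    rw [he, abs_mul, abs_of_pos hd] at hk₁
    rw [pow_succ, ← div_div, lt_div_iff₀' hd]
    exact hk₁

/-- Only finitely many rays land at a point of `Z`. -/
theorem finite_angles_at (H : PuzzleData f φ Z) {z : ℂ} (hz : z ∈ Z) :
    {θ ∈ Ico (0 : ℝ) 1 | rayPt f φ 0 θ = z}.Finite := by
  obtain ⟨η, hη, hnear⟩ := H.exists_near_of_iterate_near
  by_contra hinf
  obtain ⟨M, hM⟩ := exists_nat_gt (1 / η)
  have hM0 : (0 : ℝ) < M := (one_div_pos.2 hη).trans hM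
  obtain ⟨t, htT, htc⟩ := Set.Infinite.exists_subset_card_eq hinf (M + 1)
  -- The minimum is the distance between the two angles on the circle.
  have hev : ∀ᶠ n : ℕ in atTop, ∀ p ∈ t ×ˢ t, p.1 ≠ p.2 →
      η / (f.natDegree : ℝ) ^ n < min |p.1 - p.2| (1 - |p.1 - p.2|) := by
    refine (eventually_all_finset _).2 fun p hp => ?_
    rw [Finset.mem_product] at hp
    have h1 := (htT hp.1).1
    have h2 := (htT hp.2).1
    by_cases hne : p.1 = p.2
    · exact Eventually.of_forall fun n h => absurd hne h
    have hpos : 0 < min |p.1 - p.2| (1 - |p.1 - p.2|) := by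
      refine lt_min (abs_pos.2 (sub_ne_zero.2 hne)) (sub_pos.2 (abs_lt.2 ⟨?_, ?_⟩))
      · linarith [h1.1, h2.2]
      · linarith [h1.2, h2.1]
    have hlim : Tendsto (fun n : ℕ => η / (f.natDegree : ℝ) ^ n) atTop (𝓝 0) :=
      (tendsto_pow_atTop_atTop_of_one_lt H.one_lt_degree).const_div_atTop η
    filter_upwards [hlim.eventually_lt_const hpos] with n hn _ using hn
  obtain ⟨n, hn⟩ := hev.exists
  set D := (f.natDegree : ℝ) ^ n with hD
  -- Among `M + 1` angles, two have `d^n`-multiples in the same arc of length `1 / M < η`. Pulled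
  -- back, the two angles are within `η / d^n` on the circle, contradicting the choice of `n`.
  obtain ⟨θ, hθ, θ', hθ', hne, heq⟩ := Finset.exists_ne_map_eq_of_card_lt_of_maps_to
    (s := t) (t := Finset.range M) (f := fun θ => ⌊M * Int.fract (D * θ)⌋₊)
    (by rw [Finset.card_range, htc]; exact M.lt_succ_self) (by
      intro θ _
      rw [Finset.mem_coe, Finset.mem_range, Nat.floor_lt (by positivity)]
      exact mul_lt_of_lt_one_right hM0 (Int.fract_lt_one _))
  have hclose : |Int.fract (D * θ) - Int.fract (D * θ')| < η := by
    have e1 := Nat.floor_le (show (0 : ℝ) ≤ M * Int.fract (D * θ) by positivity)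
    have e2 := Nat.lt_floor_add_one ((M : ℝ) * Int.fract (D * θ))
    have e3 := Nat.floor_le (show (0 : ℝ) ≤ M * Int.fract (D * θ') by positivity)
    have e4 := Nat.lt_floor_add_one ((M : ℝ) * Int.fract (D * θ'))
    have heq' : ⌊(M : ℝ) * Int.fract (D * θ)⌋₊ = ⌊(M : ℝ) * Int.fract (D * θ')⌋₊ := heq
    rw [heq'] at e1 e2
    have h5 : |(M : ℝ) * (Int.fract (D * θ) - Int.fract (D * θ'))| < 1 := by
      rw [abs_lt]
      constructor <;> linarith
    rw [abs_mul, abs_of_pos hM0] at h5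
    have h6 : 1 < M * η := (div_lt_iff₀ hη).1 hM
    exact lt_of_mul_lt_mul_left (h5.trans h6) hM0.le
  obtain ⟨k', hk'⟩ := hnear n θ θ' (by rw [(htT hθ).2]; exact hz)
    ((htT hθ).2.trans (htT hθ').2.symm) (⌊D * θ⌋ - ⌊D * θ'⌋) (by
      convert hclose using 2
      rw [Int.fract, Int.fract]
      push_cast
      ring)
  have hmin := hn (θ, θ') (Finset.mem_product.2 ⟨hθ, hθ'⟩) hne
  rw [lt_min_iff] at hmin
  by_cases hk0 : k' = 0
  · rw [hk0, Int.cast_zero, sub_zero] at hk'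
    exact absurd hmin.1 (not_lt.2 hk'.le)
  · have h1 : (1 : ℝ) ≤ |(k' : ℝ)| := by exact_mod_cast Int.one_le_abs hk0
    have h2 : |(k' : ℝ)| ≤ |θ - θ'| + |θ - θ' - k'| := by
      calc |(k' : ℝ)| = |(θ - θ') - (θ - θ' - k')| := by ring_nf
        _ ≤ _ := abs_sub _ _
    have h3 : η / D < 1 - |θ - θ'| := hmin.2
    linarith

theorem iterate_rayPt_zero (H : RayData f φ) (n : ℕ) (θ : ℝ) :
    (toMap f)^[n] (rayPt f φ 0 θ) = rayPt f φ 0 ((f.natDegree : ℝ) ^ n * θ) := by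
  rw [H.iterate_rayPt le_rfl, mul_zero]

/-- An angle is recovered from the fractional part of its `d^n`-multiple, which lands on `Z`, and
the integer part, one of `d^n` values. -/
theorem finite_angles (H : PuzzleData f φ Z) (n : ℕ) :
    {θ ∈ Ico (0 : ℝ) 1 | (toMap f)^[n] (rayPt f φ 0 θ) ∈ Z}.Finite := by
  have hD := H.degree_pow_pos n
  have h0 : {θ ∈ Ico (0 : ℝ) 1 | rayPt f φ 0 θ ∈ Z}.Finite := by
    refine (H.adm.finite.biUnion fun z hz => H.finite_angles_at hz).subset ?_
    exact fun θ hθ => mem_biUnion hθ.2 ⟨hθ.1, rfl⟩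
  refine ((h0.prod (finite_Ico (0 : ℤ) ((f.natDegree : ℤ) ^ n))).image
    fun p : ℝ × ℤ => (p.1 + p.2) / (f.natDegree : ℝ) ^ n).subset ?_
  rintro θ ⟨hθ, hθZ⟩
  refine ⟨(Int.fract ((f.natDegree : ℝ) ^ n * θ), ⌊(f.natDegree : ℝ) ^ n * θ⌋),
    ⟨⟨⟨Int.fract_nonneg _, Int.fract_lt_one _⟩, ?_⟩, ?_, ?_⟩, ?_⟩
  · rw [iterate_rayPt_zero H.toRayData, ← Int.fract_add_floor ((f.natDegree : ℝ) ^ n * θ),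
      RayData.rayPt_add_int] at hθZ
    exact hθZ
  · exact Int.floor_nonneg.2 (mul_nonneg hD.le hθ.1)
  · rw [Int.floor_lt]
    push_cast
    exact mul_lt_of_lt_one_right hD hθ.2
  · show (Int.fract _ + (⌊_⌋ : ℝ)) / _ = θ
    rw [Int.fract_add_floor]
    field_simp

end PuzzleData

end PolyDyn

/-! ### Diameter estimates from the frontier -/

/-- A bounded connected open plane set whose frontier is covered by sets of small diameter and a
finite set is small. -/
theorem ediam_le_of_frontier_subset {Y E : Set ℂ} (hYo : IsOpen Y) (hYc : IsPreconnected Y)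
    (hYb : Bornology.IsBounded Y) {ι : Type*} (I : Finset ι) {C : ι → Set ℂ} (hE : E.Finite)
    (hfr : frontier Y ⊆ (⋃ i ∈ I, C i) ∪ E) {ε : ENNReal} (hC : ∀ i ∈ I, Metric.ediam (C i) ≤ ε) :
    Metric.ediam Y ≤ I.card * ε := by
  refine Metric.ediam_le fun y₁ h₁ y₂ h₂ => ?_
  rcases eq_or_ne y₁ y₂ with rfl | hne
  · simp
  set u : ℂ := (y₂ - y₁) / (‖y₂ - y₁‖ : ℝ) with hu
  have hnorm : ‖y₂ - y₁‖ ≠ 0 := norm_ne_zero_iff.2 (sub_ne_zero.2 hne.symm)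
  have hu1 : ‖u‖ = 1 := by
    rw [hu, norm_div, Complex.norm_real, norm_norm, div_self hnorm]
  set p : ℂ → ℝ := fun x => (x * (starRingEnd ℂ) u).re with hp
  have huu : u * (starRingEnd ℂ) u = 1 := by
    rw [Complex.mul_conj, Complex.normSq_eq_norm_sq, hu1]
    simp
  have hlip : LipschitzWith 1 p := LipschitzWith.of_dist_le_mul fun x y => by
    rw [NNReal.coe_one, one_mul, Real.dist_eq, dist_eq_norm, ← Complex.sub_re, ← sub_mul]
    refine (Complex.abs_re_le_norm _).trans ?_
    rw [norm_mul, Complex.norm_conj, hu1, mul_one]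
  have hp12 : p y₂ - p y₁ = ‖y₂ - y₁‖ := by
    have : y₂ - y₁ = (‖y₂ - y₁‖ : ℝ) * u := by
      rw [hu, mul_div_cancel₀ _ (Complex.ofReal_ne_zero.2 hnorm)]
    show (y₂ * _).re - (y₁ * _).re = _
    rw [← Complex.sub_re, ← sub_mul, this, mul_assoc, huu, mul_one, Complex.ofReal_re, ← this]
  have hline : Icc (p y₁) (p y₂) ⊆ (⋃ i ∈ I, p '' C i) ∪ p '' E := by
    intro t ht
    obtain ⟨y, hy, hyt⟩ := hYc.intermediate_value h₁ h₂ hlip.continuous.continuousOn ht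
    -- This line is perpendicular to the direction `u`; it starts in the bounded set `Y`, so it
    -- meets the frontier at a point with the same projection `t`.
    set l : ℝ → ℂ := fun r => y + r * (Complex.I * u) with hl
    have hlp : ∀ r, p (l r) = t := by
      intro r
      rw [← hyt]
      show ((y + r * (Complex.I * u)) * _).re = (y * _).re
      have : (y + r * (Complex.I * u)) * (starRingEnd ℂ) u =
          y * (starRingEnd ℂ) u + r * Complex.I * (u * (starRingEnd ℂ) u) := by ring
      rw [this, huu]
      simp
    have hlc : Continuous l := by fun_prop
    have hmeet : (range l ∩ frontier Y).Nonempty := by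
      by_contra! hempty
      have hsub : range l ⊆ Y := by
        refine (isPreconnected_range hlc).subset_of_closure_inter_subset hYo
          ⟨y, ⟨0, by simp [hl]⟩, hy⟩ ?_
        rintro x ⟨hx, hxl⟩
        by_contra hxY
        have : x ∈ range l ∩ frontier Y := ⟨hxl, by rw [hYo.frontier_eq]; exact ⟨hx, hxY⟩⟩
        rw [hempty] at this
        exact this
      obtain ⟨R, hR⟩ := hYb.exists_norm_le
      have h0 := hR y hy
      have h1 := hR _ (hsub ⟨2 * R + 1, rfl⟩)
      have h2 : ‖((2 * R + 1 : ℝ) : ℂ) * (Complex.I * u)‖ = 2 * R + 1 := by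
        rw [norm_mul, norm_mul, hu1, Complex.norm_I, Complex.norm_real, Real.norm_eq_abs,
          abs_of_nonneg (by linarith [norm_nonneg y])]
        ring
      have h3 : ‖((2 * R + 1 : ℝ) : ℂ) * (Complex.I * u)‖ ≤ ‖l (2 * R + 1)‖ + ‖y‖ := by
        refine le_trans (le_of_eq ?_) (norm_sub_le _ _)
        simp only [hl]
        congr 1
        ring
      linarith
    obtain ⟨_, ⟨r, rfl⟩, hr⟩ := hmeet
    rcases hfr hr with h | h
    · obtain ⟨i, hi, hri⟩ := mem_iUnion₂.1 h
      exact Or.inl (mem_iUnion₂.2 ⟨i, hi, l r, hri, hlp r⟩)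
    · exact Or.inr ⟨l r, h, hlp r⟩
  -- Compare lengths: finite sets are null, and the projection is `1`-Lipschitz, so each projected
  -- set has measure at most `ε`.
  calc edist y₁ y₂ = MeasureTheory.volume (Icc (p y₁) (p y₂)) := by
        rw [Real.volume_Icc, hp12, edist_comm, edist_dist, dist_eq_norm]
    _ ≤ MeasureTheory.volume (⋃ i ∈ I, p '' C i) + MeasureTheory.volume (p '' E) :=
        (MeasureTheory.measure_mono hline).trans (MeasureTheory.measure_union_le _ _)
    _ ≤ ∑ i ∈ I, MeasureTheory.volume (p '' C i) := by
        rw [(hE.image p).measure_zero, add_zero]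
        exact MeasureTheory.measure_biUnion_finset_le _ _
    _ ≤ ∑ _i ∈ I, ε := Finset.sum_le_sum fun i hi => (Real.volume_le_diam _).trans
        ((hlip.ediam_image_le _).trans (by simpa using hC i hi))
    _ = I.card * ε := by rw [Finset.sum_const, nsmul_eq_mul]

/-! ### Counting and measuring the sectors of a piece -/

namespace PolyDyn

namespace PuzzleData

variable {f : ℂ[X]} {φ : ℂ → ℂ} {Z Y : Set ℂ}

/-- The angles of the puzzle graph bounding, on the right, a sector of the piece `Y`. -/
def sectorAngles (f : ℂ[X]) (φ : ℂ → ℂ) (Z : Set ℂ) (n : ℕ) (Y : Set ℂ) : Set ℝ :=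
  {a ∈ Ico (0 : ℝ) 1 | (toMap f)^[n] (rayPt f φ 0 a) ∈ Z ∧ ∃ θ > a, ∃ s > 0,
    rayPt f φ s θ ∈ Y ∧ ∀ α ∈ Ioc a θ, (toMap f)^[n] (rayPt f φ 0 α) ∉ Z}

theorem iterate_add_angle (H : RayData f φ) (N k : ℕ) (θ : ℝ) :
    (toMap f)^[N + k] (rayPt f φ 0 θ) =
      (toMap f)^[N] (rayPt f φ 0 ((f.natDegree : ℝ) ^ k * θ)) := by
  rw [Function.iterate_add_apply, iterate_rayPt_zero H k]

/-- Multiplication by `d^k` sends sector angles to angles of depth `N`. If two had the same image,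
points of equal potential and equal small offset `u` in the two sectors would have the same image
under the injective `f^k`. -/
theorem ncard_sectorAngles_le (H : PuzzleData f φ Z) {N k : ℕ} (hY : IsPuzzlePiece f Z (N + k) Y)
    (hinj : InjOn (toMap f)^[k] Y) :
    (sectorAngles f φ Z (N + k) Y).ncard ≤
      {θ ∈ Ico (0 : ℝ) 1 | (toMap f)^[N] (rayPt f φ 0 θ) ∈ Z}.ncard := by
  set D := (f.natDegree : ℝ) ^ k with hD
  refine Set.ncard_le_ncard_of_injOn (fun a => Int.fract (D * a)) ?_ ?_ (H.finite_angles N)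
  · rintro a ⟨-, ha, -⟩
    refine ⟨⟨Int.fract_nonneg _, Int.fract_lt_one _⟩, ?_⟩
    rw [iterate_add_angle H.toRayData, ← hD, ← Int.fract_add_floor (D * a),
      RayData.rayPt_add_int] at ha
    exact ha
  · rintro a₁ ⟨h₁, hZ₁, θ₁, hθ₁, s₁, hs₁, hy₁, hf₁⟩ a₂ ⟨h₂, hZ₂, θ₂, hθ₂, s₂, hs₂, hy₂, hf₂⟩ heq
    have hu : 0 < min (θ₁ - a₁) (θ₂ - a₂) := lt_min (sub_pos.2 hθ₁) (sub_pos.2 hθ₂)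
    have hu₁ := min_le_left (θ₁ - a₁) (θ₂ - a₂)
    have hu₂ := min_le_right (θ₁ - a₁) (θ₂ - a₂)
    set u := min (θ₁ - a₁) (θ₂ - a₂)
    have hs : 0 < min s₁ s₂ := lt_min hs₁ hs₂
    have hpow := (H.degree_pow_pos (N + k)).le
    have hm₁ : rayPt f φ (min s₁ s₂) (a₁ + u) ∈ Y :=
      hY.rayPt_mem_of_forall H isPreconnected_Ioc hf₁ hs₁.le ⟨hθ₁, le_rfl⟩ hy₁ hs.le
        ((mul_le_mul_of_nonneg_left (min_le_left _ _) hpow).trans_lt (hY.potential_lt H hs₁.le hy₁))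
        ⟨by linarith, by linarith⟩
    have hm₂ : rayPt f φ (min s₁ s₂) (a₂ + u) ∈ Y :=
      hY.rayPt_mem_of_forall H isPreconnected_Ioc hf₂ hs₂.le ⟨hθ₂, le_rfl⟩ hy₂ hs.le
        ((mul_le_mul_of_nonneg_left (min_le_right _ _) hpow).trans_lt
          (hY.potential_lt H hs₂.le hy₂))
        ⟨by linarith, by linarith⟩
    obtain ⟨m, hm⟩ := Int.fract_eq_fract.1 heq
    have hpt := hinj hm₁ hm₂ (by
      rw [H.iterate_rayPt hs.le, H.iterate_rayPt hs.le, ← hD,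
        show D * (a₁ + u) = D * (a₂ + u) + m by linarith, RayData.rayPt_add_int])
    obtain ⟨-, j, hj⟩ := H.rayPt_injective hs hs hpt
    have hj0 : j = 0 := by
      have e1 : (j : ℝ) < 1 := by linarith [h₁.2, h₂.1]
      have e2 : (-1 : ℝ) < j := by linarith [h₁.1, h₂.2]
      have e3 : j < 1 := by exact_mod_cast e1
      have e4 : -1 < j := by exact_mod_cast e2
      omega
    rw [hj0, Int.cast_zero] at hj
    linarith

/-- The angles landing on `f^(-(N+k))(Z)` form a closed set invariant under translation by `1 /
d^k`, so the greatest one below a given angle is less than `1 / d^k` away. Reducing it modulo `1`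
requires shifting `θ` as well. -/
theorem exists_sector (H : PuzzleData f φ Z) (hZne : Z.Nonempty) {N k : ℕ}
    (hY : IsPuzzlePiece f Z (N + k) Y) {y : ℂ} (hy : y ∈ Y) (hyb : y ∈ basin f) :
    ∃ a ∈ sectorAngles f φ Z (N + k) Y, ∃ s > 0, ∃ θ,
      rayPt f φ s θ = y ∧ a < θ ∧ θ < a + 1 / (f.natDegree : ℝ) ^ k := by
  have hD := H.degree_pow_pos k
  set D := (f.natDegree : ℝ) ^ k with hDdef
  set Θ := {θ : ℝ | (toMap f)^[N + k] (rayPt f φ 0 θ) ∈ Z} with hΘ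
  have hmem : ∀ θ, θ ∈ Θ ↔ (toMap f)^[N] (rayPt f φ 0 (D * θ)) ∈ Z := fun θ => by
    rw [hDdef, ← iterate_add_angle H.toRayData]
    rfl
  have hper : ∀ θ (j : ℤ), θ ∈ Θ → θ + j / D ∈ Θ := fun θ j hθ => by
    rw [hmem] at hθ ⊢
    rwa [mul_add, mul_div_cancel₀ _ hD.ne', RayData.rayPt_add_int]
  obtain ⟨s, hs, θ, -, rfl⟩ := H.exists_rayPt_eq hyb
  have hθΘ : θ ∉ Θ := hY.angle_notMem H hs.le hy
  obtain ⟨z, hz⟩ := hZne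
  obtain ⟨θ₀, hθ₀⟩ := H.exists_rayPt_of_mem hz
  have hθ₀Θ : θ₀ ∈ Θ := by
    show (toMap f)^[N + k] _ ∈ Z
    rw [hθ₀]
    exact H.adm.mapsTo.iterate _ hz
  have hne : (Θ ∩ Iic θ).Nonempty := by
    refine ⟨θ₀ + (⌊D * (θ - θ₀)⌋ : ℤ) / D, hper _ _ hθ₀Θ, ?_⟩
    have h := Int.floor_le (D * (θ - θ₀))
    have : (⌊D * (θ - θ₀)⌋ : ℝ) / D ≤ θ - θ₀ := (div_le_iff₀' hD).2 h
    show θ₀ + _ ≤ θ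
    linarith
  have hbdd : BddAbove (Θ ∩ Iic θ) := ⟨θ, fun _ h => h.2⟩
  have hcl : IsClosed (Θ ∩ Iic θ) := (H.isClosed_angles (N + k)).inter isClosed_Iic
  set a := sSup (Θ ∩ Iic θ) with ha
  have haΘ : a ∈ Θ ∩ Iic θ := hcl.csSup_mem hne hbdd
  have hle : ∀ α ∈ Θ, α ≤ θ → α ≤ a := fun α hα hαθ => le_csSup hbdd ⟨hα, hαθ⟩
  have haθ : a < θ := lt_of_le_of_ne haΘ.2 fun h => hθΘ (h ▸ haΘ.1)
  have hθa : θ < a + 1 / D := by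
    by_contra! h
    have h1 := hper a 1 haΘ.1
    rw [Int.cast_one] at h1
    have := hle _ h1 h
    have : 0 < 1 / D := one_div_pos.2 hD
    linarith
  have hshift : ∀ (t α : ℝ) (j : ℤ), rayPt f φ t (α - j) = rayPt f φ t α := fun t α j => by
    rw [← RayData.rayPt_add_int t (α - j) j, sub_add_cancel]
  have hfract : Int.fract a = a - ⌊a⌋ := rfl
  refine ⟨Int.fract a, ⟨⟨Int.fract_nonneg _, Int.fract_lt_one _⟩, ?_, θ - ⌊a⌋, ?_, s, hs, ?_, ?_⟩,
    s, hs, θ - ⌊a⌋, hshift _ _ _, ?_, ?_⟩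
  · rw [hfract, hshift]
    exact haΘ.1
  · rw [hfract]
    exact sub_lt_sub_right haθ _
  · rw [hshift]
    exact hy
  · intro α hα hαZ
    rw [hfract] at hα
    have h1 : α + ⌊a⌋ ∈ Θ := by
      show (toMap f)^[N + k] (rayPt f φ 0 (α + ⌊a⌋)) ∈ Z
      rwa [RayData.rayPt_add_int]
    have h2 := hle _ h1 (by linarith [hα.2])
    linarith [hα.1]
  · rw [hfract]
    exact sub_lt_sub_right haθ _
  · rw [hfract]
    linarith

/-- The bound is the number of sectors, controlled by injectivity in terms of `N` alone, times the
diameter of one sector, controlled by uniform continuity. -/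
theorem ediam_le_of_injOn (H : PuzzleData f φ Z) (hZne : Z.Nonempty) {N k : ℕ}
    (hY : IsPuzzlePiece f Z (N + k) Y) (hinj : InjOn (toMap f)^[k] Y) {ε η : ℝ}
    (hu : ∀ s s' θ θ' : ℝ, 0 ≤ s → s < η → 0 ≤ s' → s' < η → |θ - θ'| < η →
      dist (rayPt f φ s θ) (rayPt f φ s' θ') ≤ ε) (hk : 1 / (f.natDegree : ℝ) ^ k ≤ η) :
    Metric.ediam Y ≤ {θ ∈ Ico (0 : ℝ) 1 | (toMap f)^[N] (rayPt f φ 0 θ) ∈ Z}.ncard *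
      ENNReal.ofReal ε := by
  have hfin : (sectorAngles f φ Z (N + k) Y).Finite :=
    (H.finite_angles (N + k)).subset fun a ha => ⟨ha.1, ha.2.1⟩
  have hcard := H.ncard_sectorAngles_le hY hinj
  rw [ncard_eq_toFinset_card _ hfin] at hcard
  have hdepth : 1 / (f.natDegree : ℝ) ^ (N + k) ≤ η := by
    refine le_trans (one_div_le_one_div_of_le (H.degree_pow_pos k) ?_) hk
    exact pow_le_pow_right₀ H.one_lt_degree.le (Nat.le_add_left k N)
  let C : ℝ → Set ℂ := fun a => {z | ∃ s θ, 0 ≤ s ∧ s < η ∧ a < θ ∧ θ < a + η ∧ rayPt f φ s θ = z}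
  have hC : ∀ a, Metric.ediam (closure (C a)) ≤ ENNReal.ofReal ε := by
    intro a
    rw [Metric.ediam_closure]
    refine Metric.ediam_le_of_forall_dist_le ?_
    rintro _ ⟨s, θ, h1, h2, h3, h4, rfl⟩ _ ⟨s', θ', h1', h2', h3', h4', rfl⟩
    exact hu s s' θ θ' h1 h2 h1' h2' (abs_lt.2 ⟨by linarith, by linarith⟩)
  have hsub : basin f ∩ Y ⊆ ⋃ a ∈ hfin.toFinset, C a := by
    rintro y ⟨hyb, hy⟩
    obtain ⟨a, ha, s, hs, θ, rfl, h1, h2⟩ := H.exists_sector hZne hY hy hyb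
    refine mem_iUnion₂.2 ⟨a, hfin.mem_toFinset.2 ha, s, θ, hs.le, ?_, h1, by linarith, rfl⟩
    exact ((lt_div_iff₀' (H.degree_pow_pos (N + k))).2 (hY.potential_lt H hs.le hy)).trans_le hdepth
  -- A frontier point in the open basin is a limit of basin points of `Y`, which lie in sectors; off
  -- the basin the graph consists only of preimages of `Z`.
  have hfr : frontier Y ⊆ (⋃ a ∈ hfin.toFinset, closure (C a)) ∪ (toMap f)^[N + k] ⁻¹' Z := by
    intro x hx
    by_cases hb : x ∈ basin f
    · left
      have h1 := closure_mono hsub ((isOpen_basin H.two_le).inter_closure ⟨hb, hx.1⟩)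
      rwa [Finset.closure_biUnion] at h1
    · exact Or.inr ((H.mem_puzzleGraph_iff_of_notMem_basin hb _).1 (hY.frontier_subset H hx))
  refine (ediam_le_of_frontier_subset (hY.isOpen H) hY.isPreconnected hY.2 hfin.toFinset
    (finite_preimage_iterate H.two_le H.adm.finite (N + k)) hfr fun a _ => hC a).trans ?_
  gcongr

end PuzzleData

end PolyDyn

/-! ### The shrinking theorem -/

theorem proposition2p4 (d : ℕ) (hd : 2 ≤ d) (f₀ : Polynomial ℂ)
    (hf₀ : PolyDyn.IsMonicCentered d f₀)
    (hpcf : PolyDyn.IsPostcriticallyFinite f₀)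
    (hhyp : PolyDyn.IsHyperbolic f₀)
    (hprim : PolyDyn.IsPrimitive f₀)
    (hne : f₀ ≠ Polynomial.X ^ d)
    (Z : Set ℂ) (hZ : PolyDyn.IsAdmissible f₀ Z)
    (hcrit : PolyDyn.CriticalPiecesShrink f₀ Z) :
    Tendsto
      (fun n : ℕ =>
        ⨆ Y ∈ {Y : Set ℂ | PolyDyn.IsPuzzlePiece f₀ Z n Y ∧ (closure Y ∩ Z).Nonempty},
          Metric.ediam Y)
      atTop (𝓝 0) := by
  rcases Z.eq_empty_or_nonempty with rfl | hZne
  · simp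
  obtain ⟨z, hz⟩ := hZne
  -- The existence of a Böttcher map is extracted from the landing of a ray at `z`.
  obtain ⟨t, -, -, ⟨φ, hφ, -⟩, -⟩ := hZ.two_rays z hz
  have H : PolyDyn.PuzzleData f₀ φ Z :=
    { two_le := by rw [hf₀.2.1]; exact hd
      hyperbolic := hhyp
      pcf := hpcf
      bottcher := hφ
      adm := hZ }
  obtain ⟨N, hN⟩ := H.exists_depth_critical_free hcrit
  set M := {θ ∈ Ico (0 : ℝ) 1 |
    (PolyDyn.toMap f₀)^[N] (PolyDyn.rayPt f₀ φ 0 θ) ∈ Z}.ncard with hM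
  rw [ENNReal.tendsto_nhds_zero]
  intro ε hε
  -- `M` depends only on the fixed depth `N`, so the allowed sector size `δ` can be chosen before
  -- `k`.
  obtain ⟨δ, hδ, hδε⟩ : ∃ δ : ℝ, 0 < δ ∧ M * ENNReal.ofReal δ ≤ ε := by
    rcases eq_or_ne ε ⊤ with rfl | hε'
    · exact ⟨1, one_pos, le_top⟩
    have hεpos := ENNReal.toReal_pos hε.ne' hε'
    refine ⟨ε.toReal / (M + 1), by positivity, ?_⟩
    rw [← ENNReal.ofReal_natCast, ← ENNReal.ofReal_mul (by positivity)]
    refine ENNReal.ofReal_le_of_le_toReal ?_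
    rw [← mul_div_assoc, div_le_iff₀ (by positivity), mul_comm]
    nlinarith
  obtain ⟨η, hη, hu⟩ := H.exists_dist_rayPt_le hδ
  have hlim : Tendsto (fun k : ℕ => 1 / (f₀.natDegree : ℝ) ^ k) atTop (𝓝 0) :=
    (tendsto_pow_atTop_atTop_of_one_lt H.one_lt_degree).const_div_atTop 1
  filter_upwards [eventually_ge_atTop N,
    (tendsto_sub_atTop_nat N).eventually (hlim.eventually_le_const hη)] with n hn hk
  refine iSup₂_le fun Y hY => ?_
  obtain ⟨k, rfl⟩ := Nat.exists_eq_add_of_le hn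
  rw [Nat.add_sub_cancel_left] at hk
  exact (H.ediam_le_of_injOn ⟨z, hz⟩ hY.1 (H.injOn_iterate_of_critical_free hN k hY.1 hY.2)
    hu hk).trans hδε
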